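/- Let $n\ge 2$. There exist constants $c_n\in(0,1)$ and $\tilde c_n>0$, depending only on $n$, such that the following holds. Let $a=(a_1,\dots,a_n)$ with real-valued $a_j\in L^2_{loc}(\mathbb R^n)$, let $V\in L^1_{loc}(\mathbb R^n)$ be real-valued with $V\ge 0$, put $\nabla_a u=\nabla u+iau$, and let $H_{a,V}$ be the operator in $L^2(\mathbb R^n)$ defined by the closure of the quadratic form $h_{a,V}(u,u)=\int_{\mathbb R^n}(|\nabla_a u|^2+V|u|^2)\,dx$, $u\in C_c^\infty(\mathbb R^n)$. Let $Q_d$ denote a closed cube with edge length $d>0$ and edges parallel to the coordinate axes, $\overset{\circ}{Q}_d$ its interior, and put $$\mu_0(Q_d)=\inf\left\{\frac{\int_{Q_d}|\nabla_a u|^2dx}{\int_{Q_d}|u|^2dx}\;:\;u\in \bigl(C^\infty(\overset{\circ}{Q}_d)\setminus\{0\}\bigr)\cap L^2(\overset{\circ}{Q}_d)\right\},$$ $$M_c(Q_d;V)=\inf\left\{\int_{Q_d\setminus F}V\,dx\;:\;F\subset Q_d\text{ compact},\ \mathrm{cap}(F)\le c\,\mathrm{cap}(Q_d)\right\}\qquad(0<c<1).$$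 Here $\mathrm{cap}(F)=\inf\int_{\mathbb R^n}|\nabla u|^2dx$ over all Lipschitz functions $u$ with compact support in $\Omega$ and $u|_F=1$, where $\Omega=\mathbb R^n$ if $n\ge3$, and, if $n=2$, $\Omega$ is the open square with the same center as $Q_d$ and edge length $2d$. Then the following conditions are equivalent: (a) $H_{a,V}$ is strictly positive, i.e. $H_{a,V}\ge\varepsilon I$ for some $\varepsilon>0$. (b) There exist $c\in(0,1)$, $d_1>0$ and $d>0$ such that for every cube $Q_d\subset\mathbb R^n$ (with this $d$) $$\mu_0(Q_d)+d^{-n}M_c(Q_d;V)\ge d_1^{-2}.$$ (c) There exist $d_1>0$ and $d>0$ such that for every cube $Q_d\subset\mathbb R^n$ (with this $d$) $$\mu_0(Q_d)+d^{-n}M_{c_n}(Q_d;V)\ge d_1^{-2}.$$ (d) There exist $c\in(0,1)$, $\tilde c>0$ and $d_2>0$ such that for every $d>d_2$ and every cube $Q_d\subset\mathbb R^n$ $$\mu_0(Q_d)+d^{-n}M_c(Q_d;V)\ge \tilde c\,d^{-2}.$$ (e) There exists $d_2>0$ such that for every $d>d_2$ and every cube $Q_d\subset\mathbb R^n$ $$\mu_0(Q_d)+d^{-n}M_{c_n}(Q_d;V)\ge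 \tilde c_n\,d^{-2}.$$ -/

import Mathlib

open MeasureTheory Filter Topology Set
open scoped ENNReal ContDiff ComplexConjugate

noncomputable section

namespace MagneticSchroedinger

/-- Euclidean space `ℝⁿ`. -/
abbrev E (n : ℕ) : Type := EuclideanSpace ℝ (Fin n)

/-- The complex Hilbert space `L²(ℝⁿ)`. -/
abbrev L2 (n : ℕ) : Type := Lp ℂ 2 (volume : Measure (E n))

/-- The `j`-th partial derivative of a complex-valued function. -/
def partialDeriv {n : ℕ} (u : E n → ℂ) (x : E n) (j : Fin n) : ℂ :=
  fderiv ℝ u x (EuclideanSpace.single j (1 : ℝ))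

/-- The `j`-th component of the magnetic gradient `∇ₐ u = ∇ u + i a u`. -/
def magGrad {n : ℕ} (a : E n → E n) (u : E n → ℂ) (x : E n) (j : Fin n) : ℂ :=
  partialDeriv u x j + Complex.I * (a x j : ℂ) * u x

/-- `a ∈ L²_loc(ℝⁿ)`: every component is square integrable on every compact set. -/
def L2loc {n : ℕ} (a : E n → E n) : Prop :=
  ∀ (j : Fin n) (K : Set (E n)), IsCompact K → MemLp (fun x => a x j) 2 (volume.restrict K)

/-- The class `C_c^∞(ℝⁿ)` of complex-valued test functions. -/
def IsTest {n : ℕ} (φ : E n → ℂ) : Prop :=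
  ContDiff ℝ ∞ φ ∧ HasCompactSupport φ

/-- The quadratic form `h_{a,V}(u,u)_G = ∫_G (|∇ₐ u|² + V |u|²) dx`, with values in `[0,∞]`
(for `V ≥ 0`). -/
def quadForm {n : ℕ} (a : E n → E n) (V : E n → ℝ) (G : Set (E n)) (u : E n → ℂ) : ℝ≥0∞ :=
  ∫⁻ x in G, ((∑ j, ‖magGrad a u x j‖ₑ ^ 2) + ENNReal.ofReal (V x) * ‖u x‖ₑ ^ 2)

/-- The sesquilinear form `h_{a,V}(u,v) = ∫ (∇ₐ u · conj (∇ₐ v) + V u conj v) dx`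
(for test functions `u`, `v`). -/
def sesqForm {n : ℕ} (a : E n → E n) (V : E n → ℝ) (u v : E n → ℂ) : ℂ :=
  ∫ x, ((∑ j, magGrad a u x j * conj (magGrad a v x j)) + (V x : ℂ) * u x * conj (v x))

/-- `φ` is a sequence of test functions which converges to `u` in `L²(ℝⁿ)` and is Cauchy with
respect to `h_{a,V}`. The functions `u` which possess such a sequence form the domain of the
closure of the form `h_{a,V}`, and the value of the closed form at `(u, v)` is the limit of
`h_{a,V}(φ k, ψ k)` for any such sequences `φ` for `u` and `ψ` for `v`. -/
def FormApprox {n : ℕ} (a : E n → E n) (V : E n → ℝ) (φ : ℕ → E n → ℂ) (u : L2 n) : Prop :=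
  (∀ k, IsTest (φ k)) ∧
  Tendsto (fun k => eLpNorm (fun x => φ k x - u x) 2 volume) atTop (𝓝 0) ∧
  Tendsto (fun p : ℕ × ℕ => quadForm a V univ (fun x => φ p.1 x - φ p.2 x)) atTop (𝓝 0)

/-- The graph of the operator `H_{a,V}` in `L²(ℝⁿ)` defined by the closure `h` of the form
`h_{a,V}`: the pair `(u, f)` belongs to it (i.e. `u` is in the domain of `H_{a,V}` and
`H_{a,V} u = f`) if and only if `u` is in the domain of `h` and `h(u, v) = (f, v)` for all `v` in
the domain of `h`. The inner product of Mathlib is linear in the second variable. -/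
def operatorGraph {n : ℕ} (a : E n → E n) (V : E n → ℝ) : Set (L2 n × L2 n) :=
  {p | ∃ φ : ℕ → E n → ℂ, FormApprox a V φ p.1 ∧
    ∀ (v : L2 n) (ψ : ℕ → E n → ℂ), FormApprox a V ψ v →
      Tendsto (fun k => sesqForm a V (φ k) (ψ k)) atTop (𝓝 (inner ℂ v p.2))}

/-- `H_{a,V}` is strictly positive: `H_{a,V} ≥ ε I` for some `ε > 0`. -/
def StrictlyPositive {n : ℕ} (a : E n → E n) (V : E n → ℝ) : Prop :=
  ∃ ε : ℝ, 0 < ε ∧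
    ∀ u f : L2 n, (u, f) ∈ operatorGraph a V → ε * ‖u‖ ^ 2 ≤ (inner ℂ u f : ℂ).re

/-- The closed cube with center `z`, edge length `d` and edges parallel to the axes. -/
def cube {n : ℕ} (z : E n) (d : ℝ) : Set (E n) := {x | ∀ j, |x j - z j| ≤ d / 2}

/-- The open cube with center `z`, edge length `d` and edges parallel to the axes. -/
def openCube {n : ℕ} (z : E n) (d : ℝ) : Set (E n) := {x | ∀ j, |x j - z j| < d / 2}

/-- The bottom of the Neumann spectrum of `H_{a,V}` in the open set `G`: the infimum of
`h_{a,V}(u,u)_G / (u,u)_G` over `u ∈ (C^∞(G) \ {0}) ∩ L²(G)`. -/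
def neumannBottom {n : ℕ} (a : E n → E n) (V : E n → ℝ) (G : Set (E n)) : ℝ≥0∞ :=
  ⨅ (u : E n → ℂ) (_ : ContDiffOn ℝ ∞ u G) (_ : MemLp u 2 (volume.restrict G))
    (_ : ∃ x ∈ G, u x ≠ 0), quadForm a V G u / ∫⁻ x in G, ‖u x‖ₑ ^ 2

/-- The local energy `μ₀(Q_d) = μ(Q_d; H_{a,0})` of the magnetic field in the cube `Q_d` with
center `z`. -/
def localEnergy {n : ℕ} (a : E n → E n) (z : E n) (d : ℝ) : ℝ≥0∞ :=
  neumannBottom a (fun _ => 0) (openCube z d)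

/-- The Wiener capacity of `F` relative to `Ω`: the infimum of `∫ |∇ u|² dx` over all Lipschitz
functions `u` with compact support in `Ω` such that `u = 1` on `F`. -/
def capacityIn {n : ℕ} (Ω F : Set (E n)) : ℝ≥0∞ :=
  ⨅ (u : E n → ℂ) (_ : ∃ K, LipschitzWith K u) (_ : HasCompactSupport u) (_ : tsupport u ⊆ Ω)
    (_ : ∀ x ∈ F, u x = 1), ∫⁻ x, ∑ j, ‖partialDeriv u x j‖ₑ ^ 2

/-- The capacity of a compact subset `F` of the cube `Q_d` with center `z`: relative to `ℝⁿ` if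
`n ≥ 3`, and relative to the open square of edge `2 d` with the same center if `n = 2`. -/
def capacity {n : ℕ} (z : E n) (d : ℝ) (F : Set (E n)) : ℝ≥0∞ :=
  if n = 2 then capacityIn (openCube z (2 * d)) F else capacityIn univ F

/-- The Molchanov functional `M_c(Q_d; V)` of the cube `Q_d` with center `z` (for `V ≥ 0`): the
infimum of `∫_{Q_d \ F} V dx` over the compact sets `F ⊆ Q_d` with `cap F ≤ c cap Q_d`. -/
def molchanov {n : ℕ} (c : ℝ) (V : E n → ℝ) (z : E n) (d : ℝ) : ℝ≥0∞ :=
  ⨅ (F : Set (E n)) (_ : IsCompact F) (_ : F ⊆ cube z d)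
    (_ : capacity z d F ≤ ENNReal.ofReal c * capacity z d (cube z d)),
    ∫⁻ x in cube z d \ F, ENNReal.ofReal (V x)

/-- The left-hand side `μ₀(Q_d) + d⁻ⁿ M_c(Q_d; V)` of the criterion, for the cube with
center `z`. -/
def criterion {n : ℕ} (c : ℝ) (a : E n → E n) (V : E n → ℝ) (z : E n) (d : ℝ) : ℝ≥0∞ :=
  localEnergy a z d + ENNReal.ofReal ((d ^ n)⁻¹) * molchanov c V z d

end MagneticSchroedinger

end

namespace MagneticSchroedinger

/-! Strict positivity is first turned into the inequality `FormBound`, `ε ‖φ‖² ≤ h(φ, φ)` for test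
functions. One direction passes to the limit along approximating sequences
(`FormBound.strictlyPositive`). The other solves `(H + 1) u = φ` by orthogonal projection and
applies Cauchy–Schwarz twice (`StrictlyPositive.exists_formBound`). The rest is a comparison between
`FormBound` and the criterion on cubes.

Common to both halves is that a function `u` of mean square one on a cube `Q` of edge `d`, with
magnetic energy at most `κ d⁻² |Q|` for small `κ`, has modulus close in `L²(Q)` to a constant `m ≥
3/4`. The diamagnetic inequality bounds the gradient of the smoothed modulus `(1/8 + |u|²)^{1/2}` by
`|∇ₐ u|`, and Poincaré's inequality does the rest (`exists_mean`).

From the criterion on cubes of one fixed size to the form bound (`exists_local_bound`): suppose a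
normalized `w` had too little energy on `Q`. Then the set `F` where its smoothed modulus is at most
`1/2` has small capacity: reflecting across the faces of `Q`, cutting off and clipping yields a
competitor with small Dirichlet integral (`capacity_sublevel_le`). So `F` is admissible in the
Molchanov functional, and off `F` one has `V ≤ 8 V |w|²`. Hence both terms of the criterion are
small, a contradiction. The local bounds are uniform in the cube, and integrating them over all
centers gives the global one (`formBound_of_local`).

From the form bound to the criterion on all large cubes (`FormBound.exists_criterion`): if it fails
on `Q`, there are an almost minimizer `u` of the local energy and a compact `F` of small relative
capacity with `∫_{Q \ F} V` small. Let `P` be an almost optimal potential of `F`, clipped to `[0,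
1]`. The function `η (1 - P) u (1 + |u|²)^{-1/2}`, with a cutoff `η`, has energy `O(d^{n-2})`: the
factor `1 - P` removes `F`, and the truncation makes the bound on `V` usable and controls the terms
with `∇η` and `∇P`. Its mass is at least a multiple of `dⁿ`, because a Hardy inequality (`hardy`)
makes the mass of `P` small when the capacity of `F` is. So `ε d²` is bounded, which fails for large
`d`. The thresholds needed here on the capacity ratio and on the energy depend only on `n`; they are
the two constants of the theorem. -/

theorem enorm_sq_eq_ofReal {F : Type*} [SeminormedAddCommGroup F] (x : F) :
    ‖x‖ₑ ^ 2 = ENNReal.ofReal (‖x‖ ^ 2) := by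
  rw [← ofReal_norm, ENNReal.ofReal_pow (norm_nonneg _)]

theorem sum_enorm_sq_eq_ofReal {ι F : Type*} [SeminormedAddCommGroup F] (s : Finset ι)
    (f : ι → F) : ∑ j ∈ s, ‖f j‖ₑ ^ 2 = ENNReal.ofReal (∑ j ∈ s, ‖f j‖ ^ 2) := by
  rw [ENNReal.ofReal_sum_of_nonneg fun j _ => by positivity]
  exact Finset.sum_congr rfl fun j _ => enorm_sq_eq_ofReal _

/-! ### Operator norm versus sums of squares of partial derivatives -/

section Linear

variable {n : ℕ} {F : Type*} [NormedAddCommGroup F] [NormedSpace ℝ F]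

theorem map_eq_sum_single (L : E n →L[ℝ] F) (x : E n) :
    L x = ∑ j, x j • L (EuclideanSpace.single j 1) := by
  conv_lhs => rw [← (EuclideanSpace.basisFun (Fin n) ℝ).sum_repr x]
  simp

theorem opNorm_sq_le_sum (L : E n →L[ℝ] F) :
    ‖L‖ ^ 2 ≤ ∑ j, ‖L (EuclideanSpace.single j 1)‖ ^ 2 := by
  have h : ‖L‖ ≤ √(∑ j, ‖L (EuclideanSpace.single j 1)‖ ^ 2) := by
    refine L.opNorm_le_bound (Real.sqrt_nonneg _) fun x => ?_
    rw [map_eq_sum_single L x, EuclideanSpace.norm_eq, mul_comm]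
    refine (norm_sum_le _ _).trans ?_
    simp only [norm_smul]
    exact Real.sum_mul_le_sqrt_mul_sqrt _ _ _
  calc ‖L‖ ^ 2 ≤ √(∑ j, ‖L (EuclideanSpace.single j 1)‖ ^ 2) ^ 2 := by gcongr
    _ = _ := Real.sq_sqrt (Finset.sum_nonneg fun _ _ => by positivity)

theorem norm_map_single_le (L : E n →L[ℝ] F) (j : Fin n) :
    ‖L (EuclideanSpace.single j 1)‖ ≤ ‖L‖ := by
  simpa using L.le_opNorm (EuclideanSpace.single j 1)

theorem sum_sq_le_opNorm (L : E n →L[ℝ] F) :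
    ∑ j, ‖L (EuclideanSpace.single j 1)‖ ^ 2 ≤ n * ‖L‖ ^ 2 := by
  calc _ ≤ ∑ _j : Fin n, ‖L‖ ^ 2 := by gcongr; exact norm_map_single_le _ _
    _ = _ := by simp

end Linear

/-! ### Leibniz rule, diamagnetic inequality and smooth truncation -/

section MagneticGradient

variable {n : ℕ} {a : E n → E n} {u f : E n → ℂ} {x : E n}

theorem partialDeriv_mul (hf : DifferentiableAt ℝ f x) (hu : DifferentiableAt ℝ u x) (j : Fin n) :
    partialDeriv (fun y => f y * u y) x j = f x * partialDeriv u x j + u x * partialDeriv f x j := by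
  simp [partialDeriv, fderiv_fun_mul hf hu]

theorem magGrad_mul (hf : DifferentiableAt ℝ f x) (hu : DifferentiableAt ℝ u x) (j : Fin n) :
    magGrad a (fun y => f y * u y) x j = f x * magGrad a u x j + u x * partialDeriv f x j := by
  simp only [magGrad, partialDeriv_mul hf hu]
  ring

theorem partialDeriv_ofReal {g : E n → ℝ} (hg : DifferentiableAt ℝ g x) (j : Fin n) :
    partialDeriv (fun y => (g y : ℂ)) x j = (fderiv ℝ g x (EuclideanSpace.single j 1) : ℝ) := by
  have h := (Complex.ofRealCLM.hasFDerivAt (x := g x)).comp x hg.hasFDerivAt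
  have h2 : HasFDerivAt (fun y => (g y : ℂ)) (Complex.ofRealCLM.comp (fderiv ℝ g x)) x := h
  simp [partialDeriv, h2.fderiv]

theorem hasFDerivAt_norm_sq_complex (hu : DifferentiableAt ℝ u x) :
    HasFDerivAt (fun y => ‖u y‖ ^ 2) (2 • (innerSL ℝ (u x)).comp (fderiv ℝ u x)) x :=
  hu.hasFDerivAt.norm_sq

/-- The derivative of `|u|²` is controlled by the magnetic gradient. -/
theorem fderiv_norm_sq_single (hu : DifferentiableAt ℝ u x) (j : Fin n) :
    fderiv ℝ (fun y => ‖u y‖ ^ 2) x (EuclideanSpace.single j 1) =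
      2 * (magGrad a u x j * conj (u x)).re := by
  rw [(hasFDerivAt_norm_sq_complex hu).fderiv]
  -- The potential contributes `i a |u|²`, which is purely imaginary, so it disappears from the real
  -- part.
  simp only [magGrad, partialDeriv, _root_.smul_apply, ContinuousLinearMap.comp_apply,
    innerSL_apply_apply, Complex.inner]
  simp
  ring

theorem abs_fderiv_norm_sq_single_le (a : E n → E n) (hu : DifferentiableAt ℝ u x) (j : Fin n) :
    |fderiv ℝ (fun y => ‖u y‖ ^ 2) x (EuclideanSpace.single j 1)| ≤
      2 * (‖magGrad a u x j‖ * ‖u x‖) := by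
  rw [fderiv_norm_sq_single (a := a) hu, abs_mul, abs_two]
  gcongr
  refine (Complex.abs_re_le_norm _).trans ?_
  rw [norm_mul, Complex.norm_conj]

/-- A smooth substitute of `|u|`. -/
noncomputable def smoothAbs (δ : ℝ) (u : E n → ℂ) (x : E n) : ℝ := √(δ + ‖u x‖ ^ 2)

theorem smoothAbs_sq {δ : ℝ} (hδ : 0 ≤ δ) (u : E n → ℂ) (x : E n) :
    smoothAbs δ u x ^ 2 = δ + ‖u x‖ ^ 2 := Real.sq_sqrt (by positivity)

theorem smoothAbs_pos {δ : ℝ} (hδ : 0 < δ) (u : E n → ℂ) (x : E n) : 0 < smoothAbs δ u x :=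
  Real.sqrt_pos.2 (by positivity)

theorem norm_le_smoothAbs {δ : ℝ} (hδ : 0 ≤ δ) (u : E n → ℂ) (x : E n) :
    ‖u x‖ ≤ smoothAbs δ u x := Real.le_sqrt_of_sq_le (by linarith)

theorem hasFDerivAt_smoothAbs {δ : ℝ} (hδ : 0 < δ) (hu : DifferentiableAt ℝ u x) :
    HasFDerivAt (smoothAbs δ u)
      ((1 / (2 * smoothAbs δ u x)) • fderiv ℝ (fun y => ‖u y‖ ^ 2) x) x := by
  have h : HasFDerivAt (fun y => δ + ‖u y‖ ^ 2) (fderiv ℝ (fun y => ‖u y‖ ^ 2) x) x :=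
    ((hasFDerivAt_norm_sq_complex hu).differentiableAt.hasFDerivAt).const_add δ
  exact h.sqrt (by positivity)

/-- The diamagnetic inequality. -/
theorem abs_fderiv_smoothAbs_single_le (a : E n → E n) {δ : ℝ} (hδ : 0 < δ)
    (hu : DifferentiableAt ℝ u x) (j : Fin n) :
    |fderiv ℝ (smoothAbs δ u) x (EuclideanSpace.single j 1)| ≤ ‖magGrad a u x j‖ := by
  have hp := smoothAbs_pos hδ u x
  rw [(hasFDerivAt_smoothAbs hδ hu).fderiv, _root_.smul_apply, smul_eq_mul, abs_mul,
    abs_of_pos (by positivity)]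
  calc 1 / (2 * smoothAbs δ u x) * |fderiv ℝ (fun y => ‖u y‖ ^ 2) x (EuclideanSpace.single j 1)|
      ≤ 1 / (2 * smoothAbs δ u x) * (2 * (‖magGrad a u x j‖ * smoothAbs δ u x)) := by
        gcongr
        refine (abs_fderiv_norm_sq_single_le a hu j).trans ?_
        gcongr
        exact norm_le_smoothAbs hδ.le u x
    _ = _ := by field_simp

theorem norm_fderiv_smoothAbs_sq_le (a : E n → E n) {δ : ℝ} (hδ : 0 < δ)
    (hu : DifferentiableAt ℝ u x) :
    ‖fderiv ℝ (smoothAbs δ u) x‖ ^ 2 ≤ ∑ j, ‖magGrad a u x j‖ ^ 2 := by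
  refine (opNorm_sq_le_sum _).trans (Finset.sum_le_sum fun j _ => ?_)
  rw [Real.norm_eq_abs]
  gcongr
  exact abs_fderiv_smoothAbs_single_le a hδ hu j

/-- The smooth truncation `u / (1 + |u|²)^{1/2}`. -/
noncomputable def truncate (u : E n → ℂ) (x : E n) : ℂ := (((smoothAbs 1 u x)⁻¹ : ℝ) : ℂ) * u x

theorem norm_truncate_le_one (u : E n → ℂ) (x : E n) : ‖truncate u x‖ ≤ 1 := by
  have hp := smoothAbs_pos one_pos u x
  rw [truncate, norm_mul, Complex.norm_real, norm_inv, Real.norm_of_nonneg hp.le,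
    inv_mul_le_iff₀ hp, mul_one]
  exact norm_le_smoothAbs zero_le_one u x

theorem norm_truncate_sq (u : E n → ℂ) (x : E n) :
    ‖truncate u x‖ ^ 2 = ‖u x‖ ^ 2 / (1 + ‖u x‖ ^ 2) := by
  have hp := smoothAbs_pos one_pos u x
  rw [truncate, norm_mul, Complex.norm_real, norm_inv, Real.norm_of_nonneg hp.le, mul_pow, inv_pow,
    smoothAbs_sq zero_le_one]
  ring

/-- With `s = (1 + |u|²)^{1/2} ≥ 1`, the Leibniz rule gives `s⁻¹ ∇ₐ u` and `-u s⁻² ∇s`. Since `|u| ≤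
s`, and the components of `∇s` are dominated by those of `∇ₐ u` by the diamagnetic inequality, each
term costs one factor `1`. -/
theorem norm_magGrad_truncate_le (a : E n → E n) (hu : DifferentiableAt ℝ u x) (j : Fin n) :
    ‖magGrad a (truncate u) x j‖ ≤ 2 * ‖magGrad a u x j‖ := by
  have hp := smoothAbs_pos one_pos u x
  have hs : DifferentiableAt ℝ (smoothAbs 1 u) x := (hasFDerivAt_smoothAbs one_pos hu).differentiableAt
  have hi : HasFDerivAt (fun y => (smoothAbs 1 u y)⁻¹)
      (-(smoothAbs 1 u x ^ 2)⁻¹ • fderiv ℝ (smoothAbs 1 u) x) x := (hasDerivAt_inv hp.ne').comp_hasFDerivAt x hs.hasFDerivAt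
  have hi' : DifferentiableAt ℝ (fun y => (((smoothAbs 1 u y)⁻¹ : ℝ) : ℂ)) x :=
    Complex.ofRealCLM.differentiableAt.comp x hi.differentiableAt
  have h1 : 1 ≤ smoothAbs 1 u x := Real.one_le_sqrt.2 (by nlinarith [sq_nonneg ‖u x‖])
  change ‖magGrad a (fun y => (((smoothAbs 1 u y)⁻¹ : ℝ) : ℂ) * u y) x j‖ ≤ _
  rw [magGrad_mul hi' hu, partialDeriv_ofReal hi.differentiableAt, hi.fderiv]
  refine (norm_add_le _ _).trans ?_
  rw [two_mul, norm_mul, norm_mul, Complex.norm_real, Complex.norm_real, Real.norm_eq_abs,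
    Real.norm_eq_abs, _root_.smul_apply, smul_eq_mul, abs_mul, abs_neg, abs_inv,
    abs_inv, abs_of_pos hp, abs_of_pos (by positivity : 0 < smoothAbs 1 u x ^ 2)]
  refine add_le_add (mul_le_of_le_one_left (norm_nonneg _) (inv_le_one_of_one_le₀ h1)) ?_
  calc ‖u x‖ * ((smoothAbs 1 u x ^ 2)⁻¹ * |fderiv ℝ (smoothAbs 1 u) x (EuclideanSpace.single j 1)|)
      ≤ smoothAbs 1 u x * ((smoothAbs 1 u x ^ 2)⁻¹ * ‖magGrad a u x j‖) := by
        gcongr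
        · exact norm_le_smoothAbs zero_le_one u x
        · exact abs_fderiv_smoothAbs_single_le a one_pos hu j
    _ = (smoothAbs 1 u x)⁻¹ * ‖magGrad a u x j‖ := by field_simp
    _ ≤ _ := mul_le_of_le_one_left (norm_nonneg _) (inv_le_one_of_one_le₀ h1)

theorem contDiffOn_smoothAbs {δ : ℝ} (hδ : 0 < δ) {k : WithTop ℕ∞} {G : Set (E n)}
    (hu : ContDiffOn ℝ k u G) : ContDiffOn ℝ k (smoothAbs δ u) G :=
  (contDiffOn_const.add (hu.norm_sq ℝ)).sqrt fun x _ => by positivity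

theorem contDiffOn_truncate {k : WithTop ℕ∞} {G : Set (E n)} (hu : ContDiffOn ℝ k u G) :
    ContDiffOn ℝ k (truncate u) G :=
  (Complex.ofRealCLM.contDiff.comp_contDiffOn
    ((contDiffOn_smoothAbs one_pos hu).inv fun x _ => (smoothAbs_pos one_pos u x).ne')).mul hu

theorem continuous_smoothAbs {δ : ℝ} (hu : Continuous u) : Continuous (smoothAbs δ u) := by
  unfold smoothAbs; fun_prop

/-- The squares of `smoothAbs δ u` and `|u|` differ by a constant, so their increments have equal
differences of squares; the sum of the two values is larger for `smoothAbs`, hence the difference is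
smaller. -/
theorem abs_smoothAbs_sub_le {δ : ℝ} (hδ : 0 < δ) (u : E n → ℂ) (x y : E n) :
    |smoothAbs δ u x - smoothAbs δ u y| ≤ ‖u x - u y‖ := by
  have hx := smoothAbs_pos hδ u x
  have hy := smoothAbs_pos hδ u y
  have hx' := norm_le_smoothAbs hδ.le u x
  have hy' := norm_le_smoothAbs hδ.le u y
  refine le_trans ?_ (abs_norm_sub_norm_le _ _)
  have key : (smoothAbs δ u x - smoothAbs δ u y) * (smoothAbs δ u x + smoothAbs δ u y) =
      (‖u x‖ - ‖u y‖) * (‖u x‖ + ‖u y‖) := by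
    have h1 := smoothAbs_sq hδ.le u x
    have h2 := smoothAbs_sq hδ.le u y
    linear_combination h1 - h2
  have key2 := congrArg abs key
  rw [abs_mul, abs_mul, abs_of_pos (by positivity : 0 < smoothAbs δ u x + smoothAbs δ u y),
    abs_of_nonneg (by positivity : 0 ≤ ‖u x‖ + ‖u y‖)] at key2
  have : |‖u x‖ - ‖u y‖| * (‖u x‖ + ‖u y‖) ≤
      |‖u x‖ - ‖u y‖| * (smoothAbs δ u x + smoothAbs δ u y) := by gcongr
  exact le_of_mul_le_mul_right (key2 ▸ this) (by positivity)

end MagneticGradient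

/-! ### Cubes and Lipschitz cutoffs -/

section Cubes

variable {n : ℕ} {z : E n} {d : ℝ}

theorem cube_eq_preimage (z : E n) (d : ℝ) :
    cube z d = (WithLp.ofLp : E n → Fin n → ℝ) ⁻¹' Icc (fun j => z j - d / 2) (fun j => z j + d / 2) := by
  ext x
  simp only [cube, mem_ofPred_eq, mem_preimage, mem_Icc, Pi.le_def, abs_le, ← forall_and]
  exact forall_congr' fun j => ⟨fun h => ⟨by linarith, by linarith⟩, fun h => ⟨by linarith, by linarith⟩⟩

theorem openCube_eq_preimage (z : E n) (d : ℝ) :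
    openCube z d = (WithLp.ofLp : E n → Fin n → ℝ) ⁻¹'
      (univ.pi fun j => Ioo (z j - d / 2) (z j + d / 2)) := by
  ext x
  simp only [openCube, mem_ofPred_eq, mem_preimage, mem_univ_pi, mem_Ioo, abs_lt]
  exact forall_congr' fun j => ⟨fun h => ⟨by linarith, by linarith⟩, fun h => ⟨by linarith, by linarith⟩⟩

theorem isCompact_cube (z : E n) (d : ℝ) : IsCompact (cube z d) := by
  rw [cube_eq_preimage]
  exact (EuclideanSpace.equiv (Fin n) ℝ).toHomeomorph.isCompact_preimage.2 isCompact_Icc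

theorem isOpen_openCube (z : E n) (d : ℝ) : IsOpen (openCube z d) := by
  rw [openCube_eq_preimage]
  exact (isOpen_set_pi finite_univ fun _ _ => isOpen_Ioo).preimage (PiLp.continuous_ofLp 2 _)

theorem convex_openCube (z : E n) (d : ℝ) : Convex ℝ (openCube z d) := by
  rw [openCube_eq_preimage]
  exact (convex_pi fun _ _ => convex_Ioo _ _).linear_preimage
    (EuclideanSpace.equiv (Fin n) ℝ).toLinearMap

theorem openCube_subset_cube (z : E n) (d : ℝ) : openCube z d ⊆ cube z d :=
  fun _ h j => (h j).le

theorem cube_subset_openCube {r : ℝ} (h : r < d) : cube z r ⊆ openCube z d :=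
  fun _ hx j => (hx j).trans_lt (by linarith)

theorem cube_subset_cube {r : ℝ} (h : r ≤ d) : cube z r ⊆ cube z d :=
  fun _ hx j => (hx j).trans (by linarith)

theorem volume_cube (z : E n) (hd : 0 < d) : volume (cube z d) = ENNReal.ofReal (d ^ n) := by
  rw [cube_eq_preimage, (PiLp.volume_preserving_ofLp (Fin n)).measure_preimage
    measurableSet_Icc.nullMeasurableSet, Real.volume_Icc_pi, ENNReal.ofReal_pow hd.le]
  simp

theorem volume_openCube (z : E n) (hd : 0 < d) :
    volume (openCube z d) = ENNReal.ofReal (d ^ n) := by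
  rw [openCube_eq_preimage, (PiLp.volume_preserving_ofLp (Fin n)).measure_preimage
    (MeasurableSet.univ_pi fun _ => measurableSet_Ioo).nullMeasurableSet, Real.volume_pi_Ioo,
    ENNReal.ofReal_pow hd.le]
  simp

theorem openCube_ae_eq_cube (z : E n) (hd : 0 < d) :
    openCube z d =ᵐ[volume] cube z d :=
  ae_eq_of_subset_of_measure_ge (openCube_subset_cube z d)
    (by rw [volume_cube z hd, volume_openCube z hd])
    (isOpen_openCube z d).measurableSet.nullMeasurableSet
    (by rw [volume_cube z hd]; exact ENNReal.ofReal_ne_top)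

/-- The supremum distance. -/
noncomputable def supDist (z x : E n) : ℝ := ‖(WithLp.ofLp (x - z) : Fin n → ℝ)‖

theorem supDist_le_iff {r : ℝ} (hr : 0 ≤ r) {x : E n} : supDist z x ≤ r ↔ ∀ j, |x j - z j| ≤ r := by
  rw [supDist, pi_norm_le_iff_of_nonneg hr]; simp

theorem mem_cube_iff (hd : 0 ≤ d) {x : E n} : x ∈ cube z d ↔ supDist z x ≤ d / 2 :=
  (supDist_le_iff (by positivity)).symm

theorem abs_supDist_sub_le (z x y : E n) : |supDist z x - supDist z y| ≤ ‖x - y‖ := by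
  refine (abs_norm_sub_norm_le _ _).trans ?_
  rw [← WithLp.ofLp_sub, sub_sub_sub_cancel_right, pi_norm_le_iff_of_nonneg (norm_nonneg _)]
  exact fun j => PiLp.norm_apply_le (x - y) j

/-- A Lipschitz cut-off function which is `1` on the concentric cube of edge `d / 2` and is
supported in the concentric cube of edge `3 d / 4`. -/
noncomputable def cutoff (z : E n) (d : ℝ) (x : E n) : ℝ :=
  max 0 (min 1 (3 - 8 * supDist z x / d))

theorem cutoff_nonneg (z : E n) (d : ℝ) (x : E n) : 0 ≤ cutoff z d x := le_max_left _ _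

theorem cutoff_le_one (z : E n) (d : ℝ) (x : E n) : cutoff z d x ≤ 1 :=
  max_le zero_le_one (min_le_left _ _)

theorem abs_cutoff_le_one (z : E n) (d : ℝ) (x : E n) : |cutoff z d x| ≤ 1 := by
  rw [abs_of_nonneg (cutoff_nonneg z d x)]; exact cutoff_le_one z d x

theorem cutoff_eq_one (hd : 0 < d) {x : E n} (hx : x ∈ cube z (d / 2)) : cutoff z d x = 1 := by
  have h := (mem_cube_iff (by positivity)).1 hx
  have : 8 * supDist z x / d ≤ 2 := by rw [div_le_iff₀ hd]; linarith
  rw [cutoff, min_eq_left (by linarith), max_eq_right zero_le_one]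

theorem cutoff_eq_zero (hd : 0 < d) {x : E n} (hx : x ∉ cube z (3 * d / 4)) :
    cutoff z d x = 0 := by
  rw [mem_cube_iff (by positivity), not_le] at hx
  have : 3 ≤ 8 * supDist z x / d := by rw [le_div_iff₀ hd]; linarith
  exact max_eq_left ((min_le_right _ _).trans (by linarith))

theorem tsupport_cutoff_subset (z : E n) (hd : 0 < d) :
    tsupport (cutoff z d) ⊆ cube z (3 * d / 4) :=
  closure_minimal (fun _ hx => by_contra fun h => hx (cutoff_eq_zero hd h))
    (isCompact_cube _ _).isClosed

theorem abs_cutoff_sub_le (hd : 0 < d) (x y : E n) :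
    |cutoff z d x - cutoff z d y| ≤ 8 / d * ‖x - y‖ := by
  unfold cutoff
  refine (abs_max_sub_max_le_max _ _ _ _).trans (max_le (by simp; positivity) ?_)
  refine (abs_min_sub_min_le_max _ _ _ _).trans (max_le (by simp; positivity) ?_)
  have : 3 - 8 * supDist z x / d - (3 - 8 * supDist z y / d) =
    8 / d * (supDist z y - supDist z x) := by ring
  rw [this, abs_mul, abs_of_pos (by positivity), abs_sub_comm]
  gcongr
  exact abs_supDist_sub_le z x y

theorem lipschitzWith_cutoff (z : E n) (hd : 0 < d) :
    LipschitzWith (8 / d).toNNReal (cutoff z d) :=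
  LipschitzWith.of_dist_le_mul fun x y => by
    rw [Real.coe_toNNReal _ (by positivity), Real.dist_eq, dist_eq_norm]
    exact abs_cutoff_sub_le hd x y

end Cubes

/-! ### Pointwise gradient bounds and products of Lipschitz functions -/

section Lipschitz

variable {X F : Type*} [NormedAddCommGroup X] [NormedAddCommGroup F]

/-- A chain rule bound for inner maps `R` that need not be differentiable, such as reflections
folded along faces: only increments are compared. Where `f` is not differentiable its `fderiv` is
zero and the bound is trivial. -/
theorem norm_fderiv_le_of_local {G : Type*} [NormedAddCommGroup G] [NormedSpace ℝ G]
    [NormedSpace ℝ X] [NormedSpace ℝ F] {f : X → F} {g : X → G} {x y : X} {R : X → X}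
    (hg : DifferentiableAt ℝ g y) (hR : ContinuousAt R x) (hRx : R x = y)
    (hR1 : ∀ x', ‖R x' - R x‖ ≤ ‖x' - x‖) {C : ℝ} (hC : 0 ≤ C)
    (h : ∀ x', ‖f x' - f x‖ ≤ C * ‖g (R x') - g y‖) :
    ‖fderiv ℝ f x‖ ≤ C * ‖fderiv ℝ g y‖ := by
  refine le_of_forall_pos_le_add fun ε hε => ?_
  by_cases hf : DifferentiableAt ℝ f x
  · refine hf.hasFDerivAt.le_of_lip' (by positivity) ?_
    -- The error is taken as `ε / (C + 1)` rather than `ε / C`, since `C` may vanish.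
    have h1 : ∀ᶠ y' in 𝓝 y, ‖g y' - g y‖ ≤ (‖fderiv ℝ g y‖ + ε / (C + 1)) * ‖y' - y‖ := by
      have := (hasFDerivAt_iff_isLittleO.1 hg.hasFDerivAt).bound
        (show 0 < ε / (C + 1) by positivity)
      filter_upwards [this] with y' hy'
      calc ‖g y' - g y‖ ≤ ‖g y' - g y - fderiv ℝ g y (y' - y)‖ + ‖fderiv ℝ g y (y' - y)‖ := by
            simpa using norm_add_le (g y' - g y - fderiv ℝ g y (y' - y)) (fderiv ℝ g y (y' - y))
        _ ≤ ε / (C + 1) * ‖y' - y‖ + ‖fderiv ℝ g y‖ * ‖y' - y‖ :=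
            add_le_add hy' ((fderiv ℝ g y).le_opNorm _)
        _ = _ := by ring
    have h2 : Tendsto R (𝓝 x) (𝓝 y) := hRx ▸ hR
    filter_upwards [h2.eventually h1] with x' hx'
    have h3 : C * (ε / (C + 1)) ≤ ε := by
      rw [mul_div_assoc', div_le_iff₀ (by positivity)]; nlinarith
    have h4 := hR1 x'
    rw [hRx] at h4
    calc ‖f x' - f x‖ ≤ C * ‖g (R x') - g y‖ := h x'
      _ ≤ C * ((‖fderiv ℝ g y‖ + ε / (C + 1)) * ‖x' - x‖) := by
        gcongr
        exact hx'.trans (by gcongr)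
      _ = (C * ‖fderiv ℝ g y‖ + C * (ε / (C + 1))) * ‖x' - x‖ := by ring
      _ ≤ _ := by gcongr
  · rw [fderiv_zero_of_not_differentiableAt hf, norm_zero]; positivity

theorem lipschitzWith_mul_of_bounded {R : Type*} [NormedRing R] {f g : X → R} {A B : NNReal}
    (hf : LipschitzWith A f) (hg : LipschitzWith B g) {M N : NNReal} (hfM : ∀ x, ‖f x‖ ≤ M)
    (hgN : ∀ x, ‖g x‖ ≤ N) : LipschitzWith (M * B + A * N) (fun x => f x * g x) := by
  refine LipschitzWith.of_dist_le_mul fun x y => ?_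
  rw [dist_eq_norm, dist_eq_norm]
  have h1 : ‖f x - f y‖ ≤ A * ‖x - y‖ := by simpa [dist_eq_norm] using hf.dist_le_mul x y
  have h2 : ‖g x - g y‖ ≤ B * ‖x - y‖ := by simpa [dist_eq_norm] using hg.dist_le_mul x y
  calc ‖f x * g x - f y * g y‖ = ‖f x * (g x - g y) + (f x - f y) * g y‖ := by
        congr 1; noncomm_ring
    _ ≤ ‖f x‖ * ‖g x - g y‖ + ‖f x - f y‖ * ‖g y‖ :=
        (norm_add_le _ _).trans (add_le_add (norm_mul_le _ _) (norm_mul_le _ _))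
    _ ≤ M * (B * ‖x - y‖) + (A * ‖x - y‖) * N := by
        gcongr
        · exact hfM x
        · exact hgN y
    _ = _ := by push_cast; ring

theorem LipschitzWith.exists_bound_of_hasCompactSupport {f : X → F} {K : NNReal}
    (hf : LipschitzWith K f) (hc : HasCompactSupport f) : ∃ M : NNReal, ∀ x, ‖f x‖ ≤ M := by
  obtain ⟨C, hC⟩ := hf.continuous.bounded_above_of_compact_support hc
  exact ⟨C.toNNReal, fun x => (hC x).trans (Real.le_coe_toNNReal C)⟩

end Lipschitz

/-! ### Poincaré's inequality on convex sets and on cubes -/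

section Poincare

variable {n : ℕ}

theorem sq_lintegral_le {α : Type*} [MeasurableSpace α] (μ : Measure α) {f : α → ℝ≥0∞}
    (hf : AEMeasurable f μ) : (∫⁻ x, f x ∂μ) ^ 2 ≤ μ univ * ∫⁻ x, f x ^ 2 ∂μ := by
  have h := ENNReal.lintegral_mul_le_Lp_mul_Lq μ Real.HolderConjugate.two_two hf
    (aemeasurable_const (b := (1 : ℝ≥0∞)))
  simp only [Pi.mul_apply, mul_one, ENNReal.one_rpow, lintegral_const, one_mul] at h
  calc (∫⁻ x, f x ∂μ) ^ 2
      ≤ ((∫⁻ a, f a ^ (2 : ℝ) ∂μ) ^ (1 / 2 : ℝ) * μ univ ^ (1 / 2 : ℝ)) ^ 2 := by gcongr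
    _ = _ := by
      rw [mul_pow, ← ENNReal.rpow_natCast, ← ENNReal.rpow_natCast (μ univ ^ _), ← ENNReal.rpow_mul,
        ← ENNReal.rpow_mul]
      norm_num
      rw [mul_comm]

/-- The Jacobian of the dilation is `t⁻ⁿ`, which is at most `2ⁿ`. -/
theorem lintegral_comp_add_smul_le {g : E n → ℝ≥0∞} (hg : Measurable g) (c : E n) {t : ℝ}
    (ht : 1 / 2 ≤ t) : ∫⁻ y, g (c + t • y) ≤ 2 ^ n * ∫⁻ y, g y := by
  have ht0 : 0 < t := by linarith
  have h1 : ∫⁻ y, g (c + t • y) = ∫⁻ y, g (c + y) ∂(Measure.map (t • ·) volume) :=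
    (lintegral_map (hg.comp (measurable_const_add c)) (measurable_const_smul t)).symm
  rw [h1, Measure.map_addHaar_smul _ ht0.ne', lintegral_smul_measure,
    lintegral_add_left_eq_self g c, smul_eq_mul]
  gcongr
  rw [finrank_euclideanSpace_fin, abs_of_pos (by positivity)]
  refine ENNReal.ofReal_le_of_le_toReal ?_
  have : (t ^ n)⁻¹ ≤ 2 ^ n := by
    rw [← inv_pow]
    gcongr
    rw [inv_le_comm₀ ht0 two_pos]
    linarith
  simpa using this

/-- The point on the segment is `(1 - t) x + t y`, and one of the two coefficients is at least
`1/2`. Integrating first in the variable that carries it keeps the Jacobian bounded uniformly in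
`t`. -/
theorem lintegral_lintegral_segment_le {g : E n → ℝ≥0∞} (hg : Measurable g) (G : Set (E n))
    (t : ℝ) : ∫⁻ x in G, ∫⁻ y in G, g (x + t • (y - x)) ≤
      volume G * (2 ^ n * ∫⁻ y, g y) := by
  have hm : Measurable fun p : E n × E n => g (p.1 + t • (p.2 - p.1)) :=
    hg.comp (by fun_prop)
  rcases le_total (1 / 2) t with ht | ht
  · calc ∫⁻ x in G, ∫⁻ y in G, g (x + t • (y - x))
        ≤ ∫⁻ _ in G, (2 ^ n * ∫⁻ y, g y) := by
          refine lintegral_mono fun x => ?_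
          refine (setLIntegral_le_lintegral _ _).trans (le_trans (le_of_eq ?_)
            (lintegral_comp_add_smul_le hg ((1 - t) • x) ht))
          refine lintegral_congr fun y => congrArg g ?_
          module
      _ = _ := by simp [mul_comm]
  · rw [lintegral_lintegral_swap hm.aemeasurable]
    calc ∫⁻ y in G, ∫⁻ x in G, g (x + t • (y - x))
        ≤ ∫⁻ _ in G, (2 ^ n * ∫⁻ y, g y) := by
          refine lintegral_mono fun y => ?_
          refine (setLIntegral_le_lintegral _ _).trans (le_trans (le_of_eq ?_)
            (lintegral_comp_add_smul_le hg (t • y) (by linarith : 1 / 2 ≤ 1 - t)))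
          refine lintegral_congr fun x => congrArg g ?_
          module
      _ = _ := by simp [mul_comm]

/-- The fundamental theorem of calculus along the segment, followed by Cauchy–Schwarz in the
parameter. -/
theorem enorm_sub_sq_le_segment {G : Set (E n)} (hG : IsOpen G) (hGc : Convex ℝ G) {s : E n → ℝ}
    (hs : ContDiffOn ℝ 1 s G) {x y : E n} (hx : x ∈ G) (hy : y ∈ G) :
    ‖s y - s x‖ₑ ^ 2 ≤
      ‖y - x‖ₑ ^ 2 * ∫⁻ t in Icc (0 : ℝ) 1, ‖fderiv ℝ s (x + t • (y - x))‖ₑ ^ 2 := by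
  have hmem : ∀ t ∈ Icc (0 : ℝ) 1, x + t • (y - x) ∈ G := fun t ht =>
    hGc.add_smul_sub_mem hx hy ht
  have hc : ContDiffOn ℝ 1 (fun t : ℝ => s (x + t • (y - x))) (Icc 0 1) :=
    hs.comp (by fun_prop) hmem
  have h := enorm_sub_le_lintegral_deriv_of_contDiffOn_Icc hc zero_le_one
  simp only [one_smul, zero_smul, add_zero, add_sub_cancel] at h
  have hmeas : Measurable fun t : ℝ => ‖fderiv ℝ s (x + t • (y - x))‖ₑ :=
    ((measurable_fderiv ℝ s).comp (by fun_prop)).enorm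
  calc ‖s y - s x‖ₑ ^ 2
      ≤ (∫⁻ t in Icc (0 : ℝ) 1, ‖deriv (fun t : ℝ => s (x + t • (y - x))) t‖ₑ) ^ 2 := by gcongr
    _ ≤ (∫⁻ t in Icc (0 : ℝ) 1, ‖y - x‖ₑ * ‖fderiv ℝ s (x + t • (y - x))‖ₑ) ^ 2 := by
      gcongr ?_ ^ 2
      refine setLIntegral_mono (hmeas.const_mul _) fun t ht => ?_
      have hd : DifferentiableAt ℝ s (x + t • (y - x)) :=
        (hs.contDiffAt (hG.mem_nhds (hmem t ht))).differentiableAt one_ne_zero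
      have hl : HasDerivAt (fun t : ℝ => x + t • (y - x)) (y - x) t := by
        simpa using ((hasDerivAt_id t).smul_const (y - x)).const_add x
      have hc' : HasDerivAt (fun t : ℝ => s (x + t • (y - x)))
          (fderiv ℝ s (x + t • (y - x)) (y - x)) t := hd.hasFDerivAt.comp_hasDerivAt t hl
      rw [hc'.deriv, mul_comm]
      exact ContinuousLinearMap.le_opENorm _ _
    _ ≤ _ := by
      rw [lintegral_const_mul _ hmeas, mul_pow]
      gcongr
      refine (sq_lintegral_le _ hmeas.aemeasurable).trans ?_
      simp

/-- The Poincaré inequality on a bounded convex open set. -/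
theorem poincare {G : Set (E n)} (hG : IsOpen G) (hGc : Convex ℝ G) (h0 : volume G ≠ 0)
    (h1 : volume G ≠ ⊤) {D : ℝ≥0∞} (hD : ∀ x ∈ G, ∀ y ∈ G, ‖y - x‖ₑ ^ 2 ≤ D)
    {s : E n → ℝ} (hs : ContDiffOn ℝ 1 s G) :
    ∃ x ∈ G, ∫⁻ y in G, ‖s y - s x‖ₑ ^ 2 ≤ D * 2 ^ n * ∫⁻ y in G, ‖fderiv ℝ s y‖ₑ ^ 2 := by
  -- Extension by zero lets the changes of variables run over the whole space, while nothing is lost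
  -- on segments inside the convex set.
  set g : E n → ℝ≥0∞ := G.indicator fun x => ‖fderiv ℝ s x‖ₑ ^ 2
  have hg : Measurable g :=
    ((measurable_fderiv ℝ s).enorm.pow_const 2).indicator hG.measurableSet
  have hgi : ∫⁻ y, g y = ∫⁻ y in G, ‖fderiv ℝ s y‖ₑ ^ 2 := lintegral_indicator hG.measurableSet _
  have hm2 : Measurable fun p : (E n × E n) × ℝ => g (p.1.1 + p.2 • (p.1.2 - p.1.1)) :=
    hg.comp (by fun_prop)
  have hsm : AEMeasurable s (volume.restrict G) := hs.continuousOn.aemeasurable hG.measurableSet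
  have key : ∫⁻ x in G, ∫⁻ y in G, ‖s y - s x‖ₑ ^ 2 ≤
      volume G * (D * 2 ^ n * ∫⁻ y, g y) := by
    calc ∫⁻ x in G, ∫⁻ y in G, ‖s y - s x‖ₑ ^ 2
        ≤ ∫⁻ x in G, ∫⁻ y in G, D * ∫⁻ t in Icc (0 : ℝ) 1, g (x + t • (y - x)) := by
          refine setLIntegral_mono' hG.measurableSet fun x hx => ?_
          refine setLIntegral_mono' hG.measurableSet fun y hy => ?_
          refine (enorm_sub_sq_le_segment hG hGc hs hx hy).trans ?_
          gcongr ?_ * ?_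
          · exact hD x hx y hy
          · refine le_of_eq (setLIntegral_congr_fun measurableSet_Icc fun t ht => ?_)
            exact (indicator_of_mem (hGc.add_smul_sub_mem hx hy ht) fun x => ‖fderiv ℝ s x‖ₑ ^ 2).symm
      _ = D * ∫⁻ x in G, ∫⁻ y in G, ∫⁻ t in Icc (0 : ℝ) 1, g (x + t • (y - x)) := by
          have hA : Measurable fun p : E n × E n =>
            ∫⁻ t in Icc (0 : ℝ) 1, g (p.1 + t • (p.2 - p.1)) := hm2.lintegral_prod_right'
          rw [← lintegral_const_mul _ hA.lintegral_prod_right']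
          refine lintegral_congr fun x => ?_
          rw [lintegral_const_mul]
          exact hA.comp (by fun_prop : Measurable fun y => (x, y))
      _ = D * ∫⁻ x in G, ∫⁻ t in Icc (0 : ℝ) 1, ∫⁻ y in G, g (x + t • (y - x)) := by
          congr 1
          refine lintegral_congr fun x => lintegral_lintegral_swap ?_
          exact (hg.comp (by fun_prop :
            Measurable fun p : E n × ℝ => x + p.2 • (p.1 - x))).aemeasurable
      _ = D * ∫⁻ t in Icc (0 : ℝ) 1, ∫⁻ x in G, ∫⁻ y in G, g (x + t • (y - x)) := by
          congr 1
          refine lintegral_lintegral_swap ?_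
          have : Measurable fun p : (E n × ℝ) × E n => g (p.1.1 + p.1.2 • (p.2 - p.1.1)) :=
            hg.comp (by fun_prop)
          exact this.lintegral_prod_right'.aemeasurable
      _ ≤ D * ∫⁻ _ in Icc (0 : ℝ) 1, volume G * (2 ^ n * ∫⁻ y, g y) := by
          gcongr with t
          exact lintegral_lintegral_segment_le hg G t
      _ = _ := by simp; ring
  have hm : AEMeasurable (fun x => ∫⁻ y in G, ‖s y - s x‖ₑ ^ 2) (volume.restrict G) := by
    have : AEMeasurable (fun p : E n × E n => ‖s p.2 - s p.1‖ₑ ^ 2)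
        ((volume.restrict G).prod (volume.restrict G)) :=
      ((hsm.comp_snd).sub (hsm.comp_fst)).enorm.pow_const 2
    exact this.lintegral_prod_right'
  -- Some `x` has inner integral at most the average, and its value `s x` replaces the mean of `s`.
  -- Such a value is visibly positive when `s` is.
  obtain ⟨x, hx, hle⟩ := exists_le_setLAverage h0 h1 hm
  refine ⟨x, hx, hle.trans ?_⟩
  rw [setLAverage_eq, ← hgi]
  exact ENNReal.div_le_of_le_mul (by rw [mul_comm _ (volume G)]; exact key)

theorem enorm_sub_sq_le_of_mem_openCube {z : E n} {d : ℝ} {x y : E n}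
    (hx : x ∈ openCube z d) (hy : y ∈ openCube z d) :
    ‖y - x‖ₑ ^ 2 ≤ ENNReal.ofReal (n * d ^ 2) := by
  rw [enorm_sq_eq_ofReal]
  refine ENNReal.ofReal_le_ofReal ?_
  rw [EuclideanSpace.norm_sq_eq]
  calc ∑ j, ‖(y - x) j‖ ^ 2 ≤ ∑ _j : Fin n, d ^ 2 := by
        refine Finset.sum_le_sum fun j _ => ?_
        have h1 := abs_lt.1 (hx j)
        have h2 := abs_lt.1 (hy j)
        rw [Real.norm_eq_abs, PiLp.sub_apply]
        have : |y j - x j| ≤ d := abs_le.2 ⟨by linarith, by linarith⟩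
        gcongr
    _ = _ := by simp

/-- The constant in the Poincaré inequality on the unit cube. -/
noncomputable def poincareConst (n : ℕ) : ℝ := (n + 1) * 2 ^ n

theorem poincareConst_pos (n : ℕ) : 0 < poincareConst n := by unfold poincareConst; positivity

theorem poincare_openCube (z : E n) {d : ℝ} (hd : 0 < d) {s : E n → ℝ}
    (hs : ContDiffOn ℝ 1 s (openCube z d)) :
    ∃ x ∈ openCube z d, ∫⁻ y in openCube z d, ‖s y - s x‖ₑ ^ 2 ≤
      ENNReal.ofReal (poincareConst n * d ^ 2) * ∫⁻ y in openCube z d, ‖fderiv ℝ s y‖ₑ ^ 2 := by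
  obtain ⟨x, hx, h⟩ := poincare (isOpen_openCube z d) (convex_openCube z d)
    (by rw [volume_openCube z hd]; simp; positivity)
    (by rw [volume_openCube z hd]; simp)
    (D := ENNReal.ofReal (n * d ^ 2))
    (fun x hx y hy => enorm_sub_sq_le_of_mem_openCube hx hy) hs
  refine ⟨x, hx, h.trans ?_⟩
  gcongr
  rw [show (2 : ℝ≥0∞) ^ n = ENNReal.ofReal (2 ^ n) by simp,
    ← ENNReal.ofReal_mul (by positivity)]
  refine ENNReal.ofReal_le_ofReal ?_
  have : (0 : ℝ) ≤ d ^ 2 * 2 ^ n := by positivity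
  unfold poincareConst
  nlinarith

/-- If `u` is normalized in a cube and its magnetic energy there is small, then the modulus of `u`
is close to a constant which is bounded from below. -/
theorem exists_mean (a : E n → E n) (z : E n) {d κ : ℝ} (hd : 0 < d) {u : E n → ℂ}
    (hu : ContDiffOn ℝ 1 u (openCube z d))
    (hn : ∫⁻ x in openCube z d, ‖u x‖ₑ ^ 2 = ENNReal.ofReal (d ^ n))
    (hκ0 : 0 ≤ κ) (hκ : poincareConst n * κ ≤ 3 / 32)
    (he : ∫⁻ x in openCube z d, ∑ j, ‖magGrad a u x j‖ₑ ^ 2 ≤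
      ENNReal.ofReal (κ / d ^ 2 * d ^ n)) :
    (∃ m : ℝ, 3 / 4 ≤ m ∧ ∫⁻ x in openCube z d, ‖smoothAbs (1 / 8) u x - m‖ₑ ^ 2 ≤
      ENNReal.ofReal (poincareConst n * κ * d ^ n)) ∧
    ∫⁻ x in openCube z d, ‖fderiv ℝ (smoothAbs (1 / 8) u) x‖ₑ ^ 2 ≤
      ENNReal.ofReal (κ / d ^ 2 * d ^ n) := by
  have hP := poincareConst_pos n
  have h8 : (0 : ℝ) < 1 / 8 := by norm_num
  have hG := isOpen_openCube z d
  have hgrad : ∫⁻ x in openCube z d, ‖fderiv ℝ (smoothAbs (1 / 8) u) x‖ₑ ^ 2 ≤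
      ENNReal.ofReal (κ / d ^ 2 * d ^ n) := by
    refine le_trans (setLIntegral_mono' hG.measurableSet fun x hx => ?_) he
    rw [sum_enorm_sq_eq_ofReal, enorm_sq_eq_ofReal]
    exact ENNReal.ofReal_le_ofReal (norm_fderiv_smoothAbs_sq_le a h8
      ((hu.contDiffAt (hG.mem_nhds hx)).differentiableAt one_ne_zero))
  refine ⟨?_, hgrad⟩
  obtain ⟨x, hx, h⟩ := poincare_openCube z hd (contDiffOn_smoothAbs h8 hu)
  have h2 : ∫⁻ y in openCube z d, ‖smoothAbs (1 / 8) u y - smoothAbs (1 / 8) u x‖ₑ ^ 2 ≤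
      ENNReal.ofReal (poincareConst n * κ * d ^ n) := by
    refine h.trans ((mul_le_mul_right hgrad _).trans ?_)
    rw [← ENNReal.ofReal_mul (by positivity)]
    refine ENNReal.ofReal_le_ofReal (le_of_eq ?_)
    field_simp
  refine ⟨_, ?_, h2⟩
  set m := smoothAbs (1 / 8) u x
  have hm : 0 < m := smoothAbs_pos h8 u x
  have hvol := volume_openCube z hd
  -- The smoothed modulus has mean square `1 + 1/8`. It is compared with `m` through `s² ≤ (3/2) m²
  -- + 3 (s - m)²`.
  have h3 : ENNReal.ofReal (9 / 8 * d ^ n) ≤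
      ENNReal.ofReal (3 / 2 * m ^ 2 * d ^ n + 3 * (poincareConst n * κ * d ^ n)) := by
    calc ENNReal.ofReal (9 / 8 * d ^ n)
        = ∫⁻ y in openCube z d, (ENNReal.ofReal (1 / 8) + ‖u y‖ₑ ^ 2) := by
          rw [lintegral_add_left measurable_const, setLIntegral_const, hn, hvol,
            ← ENNReal.ofReal_mul (by positivity), ← ENNReal.ofReal_add (by positivity)
              (by positivity)]
          congr 1; ring
      _ ≤ ∫⁻ y in openCube z d, (ENNReal.ofReal (3 / 2 * m ^ 2) +
            ENNReal.ofReal 3 * ‖smoothAbs (1 / 8) u y - m‖ₑ ^ 2) := by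
          refine lintegral_mono fun y => ?_
          rw [enorm_sq_eq_ofReal, enorm_sq_eq_ofReal, ← ENNReal.ofReal_add (by positivity)
            (by positivity), ← ENNReal.ofReal_mul (by positivity), ← ENNReal.ofReal_add
            (by positivity) (by positivity), ← smoothAbs_sq h8.le]
          refine ENNReal.ofReal_le_ofReal ?_
          rw [Real.norm_eq_abs, sq_abs]
          nlinarith [sq_nonneg (2 * (smoothAbs (1 / 8) u y - m) - m)]
      _ = ENNReal.ofReal (3 / 2 * m ^ 2) * volume (openCube z d) + ENNReal.ofReal 3 *
            ∫⁻ y in openCube z d, ‖smoothAbs (1 / 8) u y - m‖ₑ ^ 2 := by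
          rw [lintegral_add_left measurable_const, setLIntegral_const, lintegral_const_mul' _ _
            ENNReal.ofReal_ne_top]
      _ ≤ ENNReal.ofReal (3 / 2 * m ^ 2) * ENNReal.ofReal (d ^ n) + ENNReal.ofReal 3 *
            ENNReal.ofReal (poincareConst n * κ * d ^ n) := by
          rw [hvol]
          gcongr
      _ = _ := by
          rw [← ENNReal.ofReal_mul (by positivity), ← ENNReal.ofReal_mul (by positivity),
            ← ENNReal.ofReal_add (by positivity) (by positivity)]
  rw [ENNReal.ofReal_le_ofReal_iff (by positivity)] at h3
  have hdn : 0 < d ^ n := by positivity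
  -- With `poincareConst n * κ ≤ 3/32` this reads `m² ≥ (2/3)(9/8 - 9/32) = 9/16`.
  have h4 : 9 / 8 ≤ 3 / 2 * m ^ 2 + 3 * (poincareConst n * κ) := by
    refine le_of_mul_le_mul_right ?_ hdn
    linarith
  nlinarith

end Poincare

/-! ### Hardy inequalities for compactly supported Lipschitz functions -/

section Hardy

variable {n : ℕ} {P : E n → ℝ} {K : NNReal}

theorem norm_fderiv_le_of_lipschitzWith (hP : LipschitzWith K P) (x : E n) :
    ‖fderiv ℝ P x‖ ≤ K := norm_fderiv_le_of_lipschitz ℝ hP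

theorem fderiv_eq_zero_of_notMem_tsupport {F : Type*} [NormedAddCommGroup F] [NormedSpace ℝ F]
    {f : E n → F} {x : E n} (hx : x ∉ tsupport f) : fderiv ℝ f x = 0 :=
  image_eq_zero_of_notMem_tsupport fun h => hx (tsupport_fderiv_subset ℝ h)

theorem integrable_of_bounded_of_compact {f : E n → ℝ} (hf : AEStronglyMeasurable f volume)
    {S : Set (E n)} (hS : IsCompact S) (hs : ∀ x ∉ S, f x = 0) {M : ℝ} (hM : ∀ x, ‖f x‖ ≤ M) :
    Integrable f := by
  have h : IntegrableOn f S :=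
    Measure.integrableOn_of_bounded hS.measure_lt_top.ne hf (Eventually.of_forall hM)
  rwa [integrableOn_iff_integrable_of_support_subset
    (fun x hx => by_contra fun h' => hx (hs x h'))] at h

/-- A weighted Hardy inequality: a vector field `X` with `|X|² ≤ div X` on the support of `P`
gives a bound on `∫ P² div X`. -/
theorem hardy_of_field (hP : LipschitzWith K P) (hc : HasCompactSupport P) {X : Fin n → E n → ℝ}
    {D : NNReal} (hX : ∀ j, LipschitzWith D (X j)) (hXd : ∀ j x, DifferentiableAt ℝ (X j) x)
    (hdiv : ∀ x ∈ tsupport P,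
      ∑ j, X j x ^ 2 ≤ ∑ j, fderiv ℝ (X j) x (EuclideanSpace.single j 1)) :
    Integrable (fun x => (∑ j, fderiv ℝ (X j) x (EuclideanSpace.single j 1)) * P x ^ 2) ∧
    ∫ x, (∑ j, fderiv ℝ (X j) x (EuclideanSpace.single j 1)) * P x ^ 2 ≤
      4 * ∫ x, ‖fderiv ℝ P x‖ ^ 2 := by
  obtain ⟨M, hM⟩ := LipschitzWith.exists_bound_of_hasCompactSupport hP hc
  have hP2 : LipschitzWith (M * K + K * M) (fun x => P x * P x) :=
    lipschitzWith_mul_of_bounded hP hP hM hM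
  have hc2 : HasCompactSupport fun x => P x * P x := hc.mul_left
  have hPm := hP.continuous.measurable
  have hz : ∀ x ∉ tsupport P, P x = 0 := fun x hx => image_eq_zero_of_notMem_tsupport hx
  have hz' : ∀ x ∉ tsupport P, fderiv ℝ P x = 0 := fun x hx => fderiv_eq_zero_of_notMem_tsupport hx
  have hXs : ∀ j, ∃ B, ∀ x ∈ tsupport P, |X j x| ≤ B := fun j =>
    hc.exists_bound_of_continuousOn (hX j).continuous.continuousOn
  choose B hB using hXs
  have hi1 : ∀ j, Integrable fun x => fderiv ℝ (X j) x (EuclideanSpace.single j 1) * (P x * P x) := by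
    intro j
    refine integrable_of_bounded_of_compact ?_ hc (fun x hx => by simp [hz x hx])
      (M := D * (M * M)) fun x => ?_
    · exact ((measurable_fderiv_apply_const ℝ (X j) _).mul (hPm.mul hPm)).aestronglyMeasurable
    · rw [norm_mul, norm_mul]
      gcongr
      · exact (norm_map_single_le _ _).trans (norm_fderiv_le_of_lipschitz ℝ (hX j))
      · exact hM x
      · exact hM x
  have hi2 : ∀ j, Integrable fun x =>
      X j x * (2 * P x * fderiv ℝ P x (EuclideanSpace.single j 1)) := by
    intro j
    refine integrable_of_bounded_of_compact ?_ hc (fun x hx => by simp [hz x hx])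
      (M := |B j| * (2 * M * K)) fun x => ?_
    · exact ((hX j).continuous.measurable.mul ((hPm.const_mul 2).mul
        (measurable_fderiv_apply_const ℝ P _))).aestronglyMeasurable
    · by_cases hx : x ∈ tsupport P
      · rw [norm_mul, norm_mul, norm_mul, Real.norm_two]
        gcongr
        · exact (hB j x hx).trans (le_abs_self _)
        · exact hM x
        · exact (norm_map_single_le _ _).trans (norm_fderiv_le_of_lipschitzWith hP x)
      · simp [hz x hx]; positivity
  have hi3 : Integrable fun x => ‖fderiv ℝ P x‖ ^ 2 := by
    refine integrable_of_bounded_of_compact ?_ hc (fun x hx => by simp [hz' x hx])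
      (M := K ^ 2) fun x => ?_
    · exact ((measurable_fderiv ℝ P).norm.pow_const 2).aestronglyMeasurable
    · rw [norm_pow, norm_norm]
      gcongr
      exact norm_fderiv_le_of_lipschitzWith hP x
  -- Integration by parts for two Lipschitz functions, one of them compactly supported.
  have hparts : ∀ j, ∫ x, fderiv ℝ (X j) x (EuclideanSpace.single j 1) * (P x * P x) =
      -∫ x, X j x * (2 * P x * fderiv ℝ P x (EuclideanSpace.single j 1)) := by
    intro j
    have h := LipschitzWith.integral_lineDeriv_mul_eq (μ := volume) (hX j) hP2 hc2
      (EuclideanSpace.single j 1)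
    rw [← integral_neg]
    refine (integral_congr_ae (Eventually.of_forall fun x => ?_)).trans
      (h.trans (integral_congr_ae ?_))
    · simp only [(hXd j x).lineDeriv_eq_fderiv]
    · filter_upwards [hP.ae_differentiableAt] with x hx
      rw [(hx.fun_mul hx).lineDeriv_eq_fderiv, fderiv_fun_mul hx hx]
      simp
      ring
  have hsum : ∀ x, (∑ j, fderiv ℝ (X j) x (EuclideanSpace.single j 1)) * P x ^ 2 =
      ∑ j, fderiv ℝ (X j) x (EuclideanSpace.single j 1) * (P x * P x) := fun x => by
    rw [Finset.sum_mul]; simp only [sq]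
  have hI : Integrable fun x =>
      (∑ j, fderiv ℝ (X j) x (EuclideanSpace.single j 1)) * P x ^ 2 := by
    simp only [hsum]; exact integrable_finsetSum _ fun j _ => hi1 j
  refine ⟨hI, ?_⟩
  have heq : ∫ x, (∑ j, fderiv ℝ (X j) x (EuclideanSpace.single j 1)) * P x ^ 2 =
      ∫ x, -∑ j, X j x * (2 * P x * fderiv ℝ P x (EuclideanSpace.single j 1)) := by
    simp only [hsum]
    rw [integral_finsetSum _ fun j _ => hi1 j, integral_neg, integral_finsetSum _ fun j _ => hi2 j,
      ← Finset.sum_neg_distrib]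
    exact Finset.sum_congr rfl fun j _ => hparts j
  -- Young's inequality with `|X|² ≤ div X`: the cross term `-2 P X·∇P` is at most half of `P² div
  -- X` plus `2 |∇P|²`, and the half is absorbed on the left.
  have hle : ∫ x, (∑ j, fderiv ℝ (X j) x (EuclideanSpace.single j 1)) * P x ^ 2 ≤
      ∫ x, (1 / 2 * ((∑ j, fderiv ℝ (X j) x (EuclideanSpace.single j 1)) * P x ^ 2) +
        2 * ‖fderiv ℝ P x‖ ^ 2) := by
    rw [heq]
    refine integral_mono ((integrable_finsetSum _ fun j _ => hi2 j).neg)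
      ((hI.const_mul _).add (hi3.const_mul _)) fun x => ?_
    by_cases hx : x ∈ tsupport P
    · have h1 : |∑ j, X j x * fderiv ℝ P x (EuclideanSpace.single j 1)| ≤
          √(∑ j, X j x ^ 2) * ‖fderiv ℝ P x‖ := by
        have : ∑ j, X j x * fderiv ℝ P x (EuclideanSpace.single j 1) =
            fderiv ℝ P x (WithLp.toLp 2 fun j => X j x) := by
          rw [map_eq_sum_single]; simp
        rw [this, ← Real.norm_eq_abs, mul_comm]
        refine (ContinuousLinearMap.le_opNorm _ _).trans (le_of_eq ?_)
        simp [EuclideanSpace.norm_eq]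
      have h2 : (∑ j, X j x * fderiv ℝ P x (EuclideanSpace.single j 1)) ^ 2 ≤
          (∑ j, X j x ^ 2) * ‖fderiv ℝ P x‖ ^ 2 := by
        rw [← sq_abs]
        calc _ ≤ (√(∑ j, X j x ^ 2) * ‖fderiv ℝ P x‖) ^ 2 := by gcongr
          _ = _ := by
            rw [mul_pow, Real.sq_sqrt (Finset.sum_nonneg fun _ _ => sq_nonneg _)]
      have h3 := hdiv x hx
      set S := ∑ j, X j x * fderiv ℝ P x (EuclideanSpace.single j 1) with hS
      set A := ∑ j, X j x ^ 2
      set T := ∑ j, fderiv ℝ (X j) x (EuclideanSpace.single j 1)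
      have h4 : ∑ j, X j x * (2 * P x * fderiv ℝ P x (EuclideanSpace.single j 1)) =
          2 * P x * S := by
        rw [hS, Finset.mul_sum]; exact Finset.sum_congr rfl fun j _ => by ring
      have hA : 0 ≤ A := Finset.sum_nonneg fun _ _ => sq_nonneg _
      have h5 : |S| ≤ √A * ‖fderiv ℝ P x‖ := h1
      have h6 : √A ^ 2 = A := Real.sq_sqrt hA
      have h7 : -(2 * P x * S) ≤ 2 * (|P x| * √A) * ‖fderiv ℝ P x‖ := by
        calc -(2 * P x * S) ≤ |2 * P x * S| := neg_le_abs _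
          _ = 2 * |P x| * |S| := by rw [abs_mul, abs_mul, abs_two]
          _ ≤ 2 * |P x| * (√A * ‖fderiv ℝ P x‖) := by gcongr
          _ = _ := by ring
      have h8 : (|P x| * √A) ^ 2 ≤ T * P x ^ 2 := by
        rw [mul_pow, sq_abs, h6, mul_comm]; gcongr
      have h9 : -(2 * P x * S) ≤ 1 / 2 * (T * P x ^ 2) + 2 * ‖fderiv ℝ P x‖ ^ 2 := by
        nlinarith [sq_nonneg (|P x| * √A - 2 * ‖fderiv ℝ P x‖)]
      simpa only [h4] using h9
    · simp [hz x hx]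
  rw [integral_add (hI.const_mul _) (hi3.const_mul _), integral_const_mul, integral_const_mul] at hle
  linarith

/-- These are the components of the field fed into `hardy_of_field`: the classical Hardy field for
`β = 1`, with `d²` removing the singularity at the center, and a linear field for `β = 0`. -/
theorem hasFDerivAt_radial (z x : E n) (β : ℝ) {d : ℝ} (hd : 0 < d) (hβ : 0 ≤ β) (j : Fin n) :
    HasFDerivAt (fun y : E n => (y j - z j) / (β * ‖y - z‖ ^ 2 + d ^ 2))
      ((β * ‖x - z‖ ^ 2 + d ^ 2)⁻¹ • (EuclideanSpace.proj j : E n →L[ℝ] ℝ) -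
        ((x j - z j) * (2 * β) / (β * ‖x - z‖ ^ 2 + d ^ 2) ^ 2) • innerSL ℝ (x - z)) x := by
  have hρ : 0 < β * ‖x - z‖ ^ 2 + d ^ 2 := by positivity
  have h1 : HasFDerivAt (fun y : E n => y j - z j) (EuclideanSpace.proj j : E n →L[ℝ] ℝ) x :=
    ((EuclideanSpace.proj j : E n →L[ℝ] ℝ).hasFDerivAt).sub_const _
  have h2 : HasFDerivAt (fun y : E n => β * ‖y - z‖ ^ 2 + d ^ 2)
      (β • ((2 : ℝ) • innerSL ℝ (x - z))) x := by
    have := ((hasFDerivAt_id x).sub_const z).norm_sq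
    refine ((this.const_mul β).add_const (d ^ 2)).congr_fderiv ?_
    ext v; simp [two_mul]
  have h3 := h1.mul ((hasDerivAt_inv hρ.ne').comp_hasFDerivAt x h2)
  have h4 : (fun y : E n => (y j - z j) / (β * ‖y - z‖ ^ 2 + d ^ 2)) =
      (fun y => y j - z j) * (Inv.inv ∘ fun y : E n => β * ‖y - z‖ ^ 2 + d ^ 2) := by
    ext y; simp [div_eq_mul_inv]
  rw [h4]
  refine h3.congr_fderiv ?_
  ext v
  simp
  field_simp
  ring

theorem lipschitzWith_radial (z : E n) {β d : ℝ} (hd : 0 < d) (hβ : 0 ≤ β) (j : Fin n) :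
    LipschitzWith (3 / d ^ 2).toNNReal
      (fun y : E n => (y j - z j) / (β * ‖y - z‖ ^ 2 + d ^ 2)) := by
  refine lipschitzWith_of_nnnorm_fderiv_le
    (fun x => (hasFDerivAt_radial z x β hd hβ j).differentiableAt) fun x => ?_
  rw [← NNReal.coe_le_coe, coe_nnnorm, Real.coe_toNNReal _ (by positivity),
    (hasFDerivAt_radial z x β hd hβ j).fderiv]
  have hd2 : 0 < d ^ 2 := by positivity
  set r := ‖x - z‖ with hr
  have hr0 : 0 ≤ r := norm_nonneg _
  set ρ := β * r ^ 2 + d ^ 2 with hρ'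
  have hρ : 0 < ρ := by positivity
  have hdρ : d ^ 2 ≤ ρ := by simp only [hρ']; nlinarith [mul_nonneg hβ (sq_nonneg r)]
  refine ContinuousLinearMap.opNorm_le_bound _ (by positivity) fun v => ?_
  simp only [_root_.sub_apply, _root_.smul_apply, smul_eq_mul, innerSL_apply_apply,
    PiLp.proj_apply]
  have hv : |v j| ≤ ‖v‖ := PiLp.norm_apply_le v j
  have hxz : |x j - z j| ≤ r := by simpa using PiLp.norm_apply_le (x - z) j
  have hin : |inner ℝ (x - z) v| ≤ r * ‖v‖ := abs_real_inner_le_norm _ _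
  have h1 : |ρ⁻¹ * v j| ≤ 1 / d ^ 2 * ‖v‖ := by
    rw [abs_mul, abs_of_pos (by positivity), ← one_div]
    gcongr
  have h2 : |(x j - z j) * (2 * β) / ρ ^ 2 * inner ℝ (x - z) v| ≤ 2 / d ^ 2 * ‖v‖ := by
    rw [abs_mul, abs_div, abs_mul, abs_of_nonneg (by positivity : 0 ≤ 2 * β),
      abs_of_pos (by positivity : 0 < ρ ^ 2)]
    calc |x j - z j| * (2 * β) / ρ ^ 2 * |inner ℝ (x - z) v|
        ≤ r * (2 * β) / ρ ^ 2 * (r * ‖v‖) := by gcongr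
      _ = 2 * (β * r ^ 2) / ρ ^ 2 * ‖v‖ := by ring
      _ ≤ 2 / d ^ 2 * ‖v‖ := by
        gcongr ?_ * _
        rw [div_le_div_iff₀ (by positivity) hd2]
        have : β * r ^ 2 ≤ ρ := by simp only [hρ']; linarith
        have h0 : 0 ≤ β * r ^ 2 := by positivity
        nlinarith
  calc |ρ⁻¹ * v j - (x j - z j) * (2 * β) / ρ ^ 2 * inner ℝ (x - z) v|
      ≤ 1 / d ^ 2 * ‖v‖ + 2 / d ^ 2 * ‖v‖ := (abs_sub _ _).trans (add_le_add h1 h2)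
    _ = _ := by ring

theorem div_radial (z x : E n) {β d : ℝ} (hd : 0 < d) (hβ : 0 ≤ β) :
    ∑ j, fderiv ℝ (fun y : E n => (y j - z j) / (β * ‖y - z‖ ^ 2 + d ^ 2)) x
      (EuclideanSpace.single j 1) = n / (β * ‖x - z‖ ^ 2 + d ^ 2) -
        2 * β * ‖x - z‖ ^ 2 / (β * ‖x - z‖ ^ 2 + d ^ 2) ^ 2 := by
  have hj : ∀ j, fderiv ℝ (fun y : E n => (y j - z j) / (β * ‖y - z‖ ^ 2 + d ^ 2)) x
      (EuclideanSpace.single j 1) = (β * ‖x - z‖ ^ 2 + d ^ 2)⁻¹ -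
        2 * β / (β * ‖x - z‖ ^ 2 + d ^ 2) ^ 2 * (x - z) j ^ 2 := fun j => by
    rw [(hasFDerivAt_radial z x β hd hβ j).fderiv]
    simp only [_root_.sub_apply, _root_.smul_apply, smul_eq_mul, innerSL_apply_apply,
      EuclideanSpace.inner_single_right]
    simp
    ring
  simp only [hj]
  rw [Finset.sum_sub_distrib, ← Finset.mul_sum, ← EuclideanSpace.real_norm_sq_eq]
  simp
  ring

/-- The constant in the Hardy inequality on cubes. -/
noncomputable def hardyConst (n : ℕ) : ℝ := 4 * (n + 1)

theorem hardyConst_pos (n : ℕ) : 0 < hardyConst n := by unfold hardyConst; positivity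

theorem norm_sub_sq_le_of_abs_le {z x : E n} {r : ℝ} (h : ∀ j, |x j - z j| ≤ r) :
    ‖x - z‖ ^ 2 ≤ n * r ^ 2 := by
  rw [EuclideanSpace.real_norm_sq_eq]
  calc ∑ j, (x - z) j ^ 2 ≤ ∑ _j : Fin n, r ^ 2 :=
        Finset.sum_le_sum fun j _ => sq_le_sq' (abs_le.1 (h j)).1 (abs_le.1 (h j)).2
    _ = _ := by simp

/-- For `n ≥ 3` and `ρ = |x - z|² + d²`, the field `(x - z) / ρ` has divergence at least `(n - 2) /
ρ ≥ 1 / ρ ≥ |X|²` everywhere. For `n = 2` this argument breaks down; instead `X = (x - z) / d²` has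
divergence `2 / d²`, which dominates `|X|²` on the square of edge `2 d`, and that is why the support
must lie there. In both cases the divergence is at least `1 / ((n + 1) d²)` on the cube. -/
theorem hardy (hn : 2 ≤ n) (z : E n) {d : ℝ} (hd : 0 < d) (hP : LipschitzWith K P)
    (hc : HasCompactSupport P) (h2 : n = 2 → tsupport P ⊆ openCube z (2 * d)) :
    ∫⁻ x in cube z d, ‖P x‖ₑ ^ 2 ≤
      ENNReal.ofReal (hardyConst n * d ^ 2) * ∫⁻ x, ‖fderiv ℝ P x‖ₑ ^ 2 := by
  obtain ⟨β, hβ0, hβ1, hβ⟩ : ∃ β : ℝ, 0 ≤ β ∧ β ≤ 1 ∧ (β = 0 ∧ n = 2 ∨ β = 1 ∧ 3 ≤ n) := by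
    rcases hn.eq_or_lt with h | h
    · exact ⟨0, le_rfl, zero_le_one, Or.inl ⟨rfl, h.symm⟩⟩
    · exact ⟨1, zero_le_one, le_rfl, Or.inr ⟨rfl, h⟩⟩
  have hd2 : 0 < d ^ 2 := by positivity
  have hlow : ∀ x : E n, 1 / (β * ‖x - z‖ ^ 2 + d ^ 2) ≤ n / (β * ‖x - z‖ ^ 2 + d ^ 2) -
        2 * β * ‖x - z‖ ^ 2 / (β * ‖x - z‖ ^ 2 + d ^ 2) ^ 2 := by
    intro x
    set r := ‖x - z‖ ^ 2
    have hr : 0 ≤ r := by positivity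
    have hρ : 0 < β * r + d ^ 2 := by positivity
    rw [div_sub_div _ _ hρ.ne' (by positivity), div_le_div_iff₀ hρ (by positivity)]
    have hn' : (β = 0 ∧ (n : ℝ) = 2) ∨ (β = 1 ∧ (3 : ℝ) ≤ n) := by
      rcases hβ with ⟨h, h'⟩ | ⟨h, h'⟩
      · exact Or.inl ⟨h, by simp [h']⟩
      · exact Or.inr ⟨h, by exact_mod_cast h'⟩
    -- The only place where the choice of `β` matters for the lower bound of the divergence: `n - 2β
    -- ≥ 1` in both cases.
    have key : (β * r + d ^ 2) ≤ n * (β * r + d ^ 2) - 2 * β * r := by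
      rcases hn' with ⟨h, h'⟩ | ⟨h, h'⟩
      · rw [h, h']; linarith
      · rw [h]; nlinarith
    have h3 : (0 : ℝ) ≤ (β * r + d ^ 2) ^ 2 := by positivity
    nlinarith [mul_le_mul_of_nonneg_left key h3]
  have hdiv : ∀ x ∈ tsupport P, ∑ j, ((x j - z j) / (β * ‖x - z‖ ^ 2 + d ^ 2)) ^ 2 ≤
      ∑ j, fderiv ℝ (fun y : E n => (y j - z j) / (β * ‖y - z‖ ^ 2 + d ^ 2)) x
        (EuclideanSpace.single j 1) := by
    intro x hx
    rw [div_radial z x hd hβ0]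
    have hsum : ∑ j, ((x j - z j) / (β * ‖x - z‖ ^ 2 + d ^ 2)) ^ 2 =
        ‖x - z‖ ^ 2 / (β * ‖x - z‖ ^ 2 + d ^ 2) ^ 2 := by
      simp only [div_pow]
      rw [← Finset.sum_div, EuclideanSpace.real_norm_sq_eq]
      simp
    rw [hsum]
    rcases hβ with ⟨h, h'⟩ | ⟨h, h'⟩
    · have hx2 : ‖x - z‖ ^ 2 ≤ n * d ^ 2 := norm_sub_sq_le_of_abs_le fun j =>
        ((h2 h' hx) j).le.trans (by linarith)
      rw [h]
      simp only [zero_mul, zero_add, mul_zero, zero_div, sub_zero]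
      rw [div_le_div_iff₀ (by positivity) (by positivity)]
      nlinarith
    · refine le_trans ?_ (hlow x)
      rw [h, div_le_div_iff₀ (by positivity) (by positivity)]
      nlinarith [sq_nonneg ‖x - z‖]
  obtain ⟨hI, hle⟩ := hardy_of_field hP hc (X := fun j y => (y j - z j) / (β * ‖y - z‖ ^ 2 + d ^ 2))
    (fun j => lipschitzWith_radial z hd hβ0 j)
    (fun j x => (hasFDerivAt_radial z x β hd hβ0 j).differentiableAt) hdiv
  simp only [div_radial z _ hd hβ0] at hI hle
  have hn1 : (0 : ℝ) < n + 1 := by positivity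
  have hnn : ∀ x : E n, 0 ≤ (n / (β * ‖x - z‖ ^ 2 + d ^ 2) -
        2 * β * ‖x - z‖ ^ 2 / (β * ‖x - z‖ ^ 2 + d ^ 2) ^ 2) * P x ^ 2 := fun x =>
    mul_nonneg (le_trans (by positivity) (hlow x)) (sq_nonneg _)
  have hi3 : Integrable fun x => ‖fderiv ℝ P x‖ ^ 2 := by
    refine integrable_of_bounded_of_compact ?_ hc
      (fun x hx => by simp [fderiv_eq_zero_of_notMem_tsupport hx]) (M := K ^ 2) fun x => ?_
    · exact ((measurable_fderiv ℝ P).norm.pow_const 2).aestronglyMeasurable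
    · rw [norm_pow, norm_norm]
      gcongr
      exact norm_fderiv_le_of_lipschitzWith hP x
  calc ∫⁻ x in cube z d, ‖P x‖ₑ ^ 2
      ≤ ∫⁻ x in cube z d, ENNReal.ofReal ((n + 1) * d ^ 2) *
          ENNReal.ofReal ((n / (β * ‖x - z‖ ^ 2 + d ^ 2) -
            2 * β * ‖x - z‖ ^ 2 / (β * ‖x - z‖ ^ 2 + d ^ 2) ^ 2) * P x ^ 2) := by
        refine setLIntegral_mono' (isCompact_cube z d).measurableSet fun x hx => ?_
        rw [enorm_sq_eq_ofReal, ← ENNReal.ofReal_mul (by positivity)]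
        refine ENNReal.ofReal_le_ofReal ?_
        rw [Real.norm_eq_abs, sq_abs, ← mul_assoc]
        refine le_mul_of_one_le_left (sq_nonneg _) ?_
        have hx2 : ‖x - z‖ ^ 2 ≤ n * (d / 2) ^ 2 := norm_sub_sq_le_of_abs_le hx
        have h1 := hlow x
        have hρ : 0 < β * ‖x - z‖ ^ 2 + d ^ 2 := by positivity
        have hρ2 : β * ‖x - z‖ ^ 2 + d ^ 2 ≤ (n + 1) * d ^ 2 := by
          have : β * ‖x - z‖ ^ 2 ≤ 1 * ‖x - z‖ ^ 2 := by gcongr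
          have h0 : (0 : ℝ) ≤ n * d ^ 2 := by positivity
          nlinarith
        calc (1 : ℝ) ≤ (n + 1) * d ^ 2 * (1 / (β * ‖x - z‖ ^ 2 + d ^ 2)) := by
              rw [mul_one_div, le_div_iff₀ hρ]; linarith
          _ ≤ _ := by gcongr
    _ ≤ ENNReal.ofReal ((n + 1) * d ^ 2) * ENNReal.ofReal (4 * ∫ x, ‖fderiv ℝ P x‖ ^ 2) := by
        rw [lintegral_const_mul' _ _ ENNReal.ofReal_ne_top]
        gcongr
        refine (setLIntegral_le_lintegral _ _).trans ?_
        rw [← ofReal_integral_eq_lintegral_ofReal hI (Eventually.of_forall hnn)]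
        exact ENNReal.ofReal_le_ofReal hle
    _ = _ := by
        simp only [enorm_sq_eq_ofReal]
        rw [← ofReal_integral_eq_lintegral_ofReal hi3 (Eventually.of_forall fun _ => by positivity),
          ← ENNReal.ofReal_mul (by positivity), ← ENNReal.ofReal_mul
            (by have := hardyConst_pos n; positivity)]
        congr 1
        unfold hardyConst
        ring

end Hardy

/-! ### Capacity potentials and the capacity of cubes -/

section Capacity

variable {n : ℕ} {z : E n} {d : ℝ}

/-- A real competitor supported in the cube of edge `2 d` is admissible in every dimension, so upper
bounds need no case distinction. The factor `n` pays for passing from the operator norm to the sum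
over coordinates. -/
theorem capacity_le_of_real {P : E n → ℝ} {K : NNReal} (hP : LipschitzWith K P)
    (hc : HasCompactSupport P) (hs : tsupport P ⊆ openCube z (2 * d)) {F : Set (E n)}
    (hF : ∀ x ∈ F, P x = 1) :
    capacity z d F ≤ n * ∫⁻ x, ‖fderiv ℝ P x‖ₑ ^ 2 := by
  have hLip : LipschitzWith K fun x => (P x : ℂ) :=
    LipschitzWith.of_dist_le_mul fun x y => by
      rw [dist_eq_norm, ← Complex.ofReal_sub, Complex.norm_real, ← dist_eq_norm]
      exact hP.dist_le_mul x y
  have hsupp : Function.support (fun x => (P x : ℂ)) = Function.support P := by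
    ext x; simp
  have htsupp : tsupport (fun x => (P x : ℂ)) = tsupport P := by rw [tsupport, hsupp, tsupport]
  have hcc : HasCompactSupport fun x => (P x : ℂ) := by
    rw [HasCompactSupport, htsupp]; exact hc
  have hint : ∫⁻ x, ∑ j, ‖partialDeriv (fun x => (P x : ℂ)) x j‖ₑ ^ 2 ≤
      n * ∫⁻ x, ‖fderiv ℝ P x‖ₑ ^ 2 := by
    rw [← lintegral_const_mul' _ _ (ENNReal.natCast_ne_top n)]
    refine lintegral_mono_ae ?_
    filter_upwards [hP.ae_differentiableAt] with x hx
    simp only [partialDeriv_ofReal hx]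
    rw [sum_enorm_sq_eq_ofReal, enorm_sq_eq_ofReal, ← ENNReal.ofReal_natCast,
      ← ENNReal.ofReal_mul (by positivity)]
    refine ENNReal.ofReal_le_ofReal ?_
    simp only [Complex.norm_real]
    exact sum_sq_le_opNorm _
  have hF' : ∀ x ∈ F, (P x : ℂ) = 1 := fun x hx => by simp [hF x hx]
  refine le_trans ?_ hint
  unfold capacity capacityIn
  split_ifs
  · exact iInf_le_of_le (fun x => (P x : ℂ)) <| iInf_le_of_le ⟨K, hLip⟩ <| iInf_le_of_le hcc <|
      iInf_le_of_le (htsupp ▸ hs) <| iInf_le_of_le hF' le_rfl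
  · exact iInf_le_of_le (fun x => (P x : ℂ)) <| iInf_le_of_le ⟨K, hLip⟩ <| iInf_le_of_le hcc <|
      iInf_le_of_le (subset_univ _) <| iInf_le_of_le hF' le_rfl

/-- A competitor `u` is replaced by its real part clipped to `[0, 1]`. This is a contraction of the
values, so it does not raise the Dirichlet integral, and it keeps the value `1` on `F` and shrinks
the support. The mass bound then comes from `hardy`. -/
theorem exists_of_capacity_lt (hn : 2 ≤ n) (hd : 0 < d) {F : Set (E n)} {M : ℝ≥0∞}
    (h : capacity z d F < M) :
    ∃ P : E n → ℝ, (∃ K, LipschitzWith K P) ∧ (∀ x, 0 ≤ P x) ∧ (∀ x, P x ≤ 1) ∧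
      (∀ x ∈ F, P x = 1) ∧ ∫⁻ x, ‖fderiv ℝ P x‖ₑ ^ 2 ≤ M ∧
      ∫⁻ x in cube z d, ‖P x‖ₑ ^ 2 ≤ ENNReal.ofReal (hardyConst n * d ^ 2) * M := by
  obtain ⟨u, K, hu, hc, hs, hF, hM⟩ : ∃ (u : E n → ℂ) (K : NNReal), LipschitzWith K u ∧
      HasCompactSupport u ∧ (n = 2 → tsupport u ⊆ openCube z (2 * d)) ∧ (∀ x ∈ F, u x = 1) ∧
      ∫⁻ x, ∑ j, ‖partialDeriv u x j‖ₑ ^ 2 < M := by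
    unfold capacity capacityIn at h
    split_ifs at h with h2
    · simp only [iInf_lt_iff] at h
      obtain ⟨u, ⟨K, hK⟩, hc, hs, hF, hM⟩ := h
      exact ⟨u, K, hK, hc, fun _ => hs, hF, hM⟩
    · simp only [iInf_lt_iff] at h
      obtain ⟨u, ⟨K, hK⟩, hc, hs, hF, hM⟩ := h
      exact ⟨u, K, hK, hc, fun h => absurd h h2, hF, hM⟩
  set P : E n → ℝ := fun x => max 0 (min 1 (u x).re) with hPdef
  have hPu : ∀ x y, |P x - P y| ≤ ‖u x - u y‖ := fun x y => by
    refine (abs_max_sub_max_le_max _ _ _ _).trans (max_le (by simp) ?_)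
    refine (abs_min_sub_min_le_max _ _ _ _).trans (max_le (by simp) ?_)
    rw [← Complex.sub_re]
    exact Complex.abs_re_le_norm _
  have hPL : LipschitzWith K P := LipschitzWith.of_dist_le_mul fun x y =>
    (hPu x y).trans (by rw [← dist_eq_norm]; exact hu.dist_le_mul x y)
  have hsub : Function.support P ⊆ Function.support u := fun x hx hx0 => hx (by simp [hPdef, hx0])
  have hts : tsupport P ⊆ tsupport u := closure_mono hsub
  have hPc : HasCompactSupport P := hc.mono hsub
  have hgrad : ∫⁻ x, ‖fderiv ℝ P x‖ₑ ^ 2 ≤ M := by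
    refine le_trans (lintegral_mono_ae ?_) hM.le
    filter_upwards [hu.ae_differentiableAt] with x hx
    rw [sum_enorm_sq_eq_ofReal, enorm_sq_eq_ofReal]
    refine ENNReal.ofReal_le_ofReal (le_trans ?_ (opNorm_sq_le_sum (fderiv ℝ u x)))
    have := norm_fderiv_le_of_local (f := P) (R := id) hx continuousAt_id rfl (fun _ => le_rfl)
      zero_le_one (fun x' => by rw [one_mul]; exact hPu x' x)
    rw [one_mul] at this
    gcongr
  refine ⟨P, ⟨K, hPL⟩, fun x => le_max_left _ _, fun x => max_le zero_le_one (min_le_left _ _),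
    fun x hx => by simp [hPdef, hF x hx], hgrad, ?_⟩
  exact (hardy hn z hd hPL hPc fun h => hts.trans (hs h)).trans (by gcongr)

/-- A potential of the whole cube has mass at least that of the cube, so Hardy bounds its Dirichlet
integral below. The factor `2` leaves room for a strict contradiction. -/
theorem le_capacity_cube (hn : 2 ≤ n) (z : E n) (hd : 0 < d) :
    ENNReal.ofReal (1 / (2 * hardyConst n) * (d ^ n / d ^ 2)) ≤ capacity z d (cube z d) := by
  have hH := hardyConst_pos n
  by_contra! h
  obtain ⟨P, -, -, -, hF, -, hle⟩ := exists_of_capacity_lt hn hd h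
  have h1 : ∫⁻ x in cube z d, ‖P x‖ₑ ^ 2 = ENNReal.ofReal (d ^ n) := by
    rw [← volume_cube z hd, ← setLIntegral_one]
    exact setLIntegral_congr_fun (isCompact_cube z d).measurableSet fun x hx => by simp [hF x hx]
  rw [h1, ← ENNReal.ofReal_mul (by positivity), ENNReal.ofReal_le_ofReal_iff (by positivity)] at hle
  have : hardyConst n * d ^ 2 * (1 / (2 * hardyConst n) * (d ^ n / d ^ 2)) = d ^ n / 2 := by
    field_simp
  have h2 : 0 < d ^ n := by positivity
  linarith

/-- The constant in the upper bound for the capacity of a cube. -/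
noncomputable def capConst (n : ℕ) : ℝ := 16 * n * 2 ^ n

/-- The cutoff at scale `2 d` is `1` on the cube of edge `d`, lives in the cube of edge `3 d / 2`
and has slope `4 / d`. -/
theorem capacity_cube_le (z : E n) (hd : 0 < d) :
    capacity z d (cube z d) ≤ ENNReal.ofReal (capConst n * (d ^ n / d ^ 2)) := by
  have hd2 : 0 < 2 * d := by positivity
  have hts := tsupport_cutoff_subset z hd2
  have hL := lipschitzWith_cutoff z hd2
  have hc : HasCompactSupport (cutoff z (2 * d)) :=
    (isCompact_cube z _).of_isClosed_subset (isClosed_tsupport _) hts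
  refine (capacity_le_of_real hL hc
    (hts.trans (cube_subset_openCube (by linarith))) (fun x hx => cutoff_eq_one hd2 (by
      convert! hx using 1; congr 1; ring))).trans ?_
  have hzero : ∀ x ∉ cube z (3 * (2 * d) / 4), ‖fderiv ℝ (cutoff z (2 * d)) x‖ₑ ^ 2 = 0 :=
    fun x hx => by
      rw [fderiv_eq_zero_of_notMem_tsupport fun h => hx (hts h), enorm_sq_eq_ofReal, norm_zero]
      simp
  calc (n : ℝ≥0∞) * ∫⁻ x, ‖fderiv ℝ (cutoff z (2 * d)) x‖ₑ ^ 2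
      = n * ∫⁻ x in cube z (3 * (2 * d) / 4), ‖fderiv ℝ (cutoff z (2 * d)) x‖ₑ ^ 2 := by
        rw [setLIntegral_eq_of_support_subset
          (fun x hx => by_contra fun h => hx (hzero x h))]
    _ ≤ n * ∫⁻ x in cube z (3 * (2 * d) / 4), ENNReal.ofReal ((4 / d) ^ 2) := by
        gcongr with x
        rw [enorm_sq_eq_ofReal]
        refine ENNReal.ofReal_le_ofReal ?_
        have := norm_fderiv_le_of_lipschitzWith hL x
        rw [Real.coe_toNNReal _ (by positivity)] at this
        have h8 : 8 / (2 * d) = 4 / d := by field_simp; norm_num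
        rw [h8] at this
        gcongr
    _ = ENNReal.ofReal (n * ((4 / d) ^ 2 * (3 * (2 * d) / 4) ^ n)) := by
        rw [setLIntegral_const, volume_cube z (by positivity), ← ENNReal.ofReal_mul (by positivity),
          ← ENNReal.ofReal_natCast, ← ENNReal.ofReal_mul (by positivity)]
    _ ≤ _ := by
        refine ENNReal.ofReal_le_ofReal ?_
        have : (3 * (2 * d) / 4) ^ n ≤ 2 ^ n * d ^ n := by
          rw [← mul_pow]; gcongr; linarith
        calc (n : ℝ) * ((4 / d) ^ 2 * (3 * (2 * d) / 4) ^ n)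
            ≤ n * ((4 / d) ^ 2 * (2 ^ n * d ^ n)) := by gcongr
          _ = _ := by unfold capConst; field_simp; ring

end Capacity

/-! ### The form density and an integrable majorant -/

section FormDensity

variable {n : ℕ} {a : E n → E n} {V : E n → ℝ} {u : E n → ℂ}

theorem L2loc.aestronglyMeasurable (ha : L2loc a) (j : Fin n) :
    AEStronglyMeasurable (fun x => a x j) volume := by
  have h : AEStronglyMeasurable (fun x => a x j)
      (volume.restrict (⋃ k : ℕ, Metric.closedBall (0 : E n) k)) :=
    aestronglyMeasurable_iUnion_iff.2 fun k =>
      (ha j _ (isCompact_closedBall 0 (k : ℝ))).aestronglyMeasurable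
  rwa [Metric.iUnion_closedBall_nat, Measure.restrict_univ] at h

theorem eLpNorm_two_sq {α F : Type*} [MeasurableSpace α] [NormedAddCommGroup F] (μ : Measure α)
    (f : α → F) : eLpNorm f 2 μ ^ 2 = ∫⁻ x, ‖f x‖ₑ ^ 2 ∂μ := by
  have h := eLpNorm_nnreal_pow_eq_lintegral (μ := μ) (f := f) (p := 2) two_ne_zero
  simpa using h

theorem MemLp.lintegral_enorm_sq_lt_top {α F : Type*} [MeasurableSpace α] [NormedAddCommGroup F]
    {μ : Measure α} {f : α → F} (hf : MemLp f 2 μ) : ∫⁻ x, ‖f x‖ₑ ^ 2 ∂μ < ⊤ := by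
  rw [← eLpNorm_two_sq]
  exact ENNReal.pow_lt_top hf.eLpNorm_lt_top

/-- The density of the form `h_{a,V}`. -/
noncomputable def formDensity (a : E n → E n) (V : E n → ℝ) (u : E n → ℂ) (x : E n) : ℝ≥0∞ :=
  (∑ j, ‖magGrad a u x j‖ₑ ^ 2) + ENNReal.ofReal (V x) * ‖u x‖ₑ ^ 2

theorem quadForm_eq (a : E n → E n) (V : E n → ℝ) (G : Set (E n)) (u : E n → ℂ) :
    quadForm a V G u = ∫⁻ x in G, formDensity a V u x := rfl

theorem aestronglyMeasurable_magGrad (ha : L2loc a) (hu : AEStronglyMeasurable u volume)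
    (j : Fin n) : AEStronglyMeasurable (fun x => magGrad a u x j) volume := by
  have h1 : AEStronglyMeasurable (fun x => (a x j : ℂ)) volume :=
    Complex.continuous_ofReal.comp_aestronglyMeasurable (ha.aestronglyMeasurable j)
  exact (measurable_fderiv_apply_const ℝ u _).aestronglyMeasurable.add
    ((h1.const_mul Complex.I).mul hu)

theorem aemeasurable_formDensity (ha : L2loc a) (hV : AEMeasurable V volume)
    (hu : AEStronglyMeasurable u volume) : AEMeasurable (formDensity a V u) volume := by
  refine (Finset.aemeasurable_fun_sum _ fun j _ => ?_).add
    (hV.ennreal_ofReal.mul (hu.enorm.pow_const 2))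
  exact (aestronglyMeasurable_magGrad ha hu j).enorm.pow_const 2

/-- A majorant of the form density of functions with bounds on the values and the derivatives. -/
noncomputable def formMajorant (a : E n → E n) (V : E n → ℝ) (S : Set (E n)) (C M : ℝ) :
    E n → ℝ≥0∞ :=
  S.indicator fun x => (∑ j, (ENNReal.ofReal (2 * C ^ 2) +
    ENNReal.ofReal (2 * M ^ 2) * ‖a x j‖ₑ ^ 2)) + ENNReal.ofReal (M ^ 2) * ‖V x‖ₑ

theorem lintegral_formMajorant_lt_top (ha : L2loc a) (hV : LocallyIntegrable V volume)
    {S : Set (E n)} (hS : IsCompact S) (C M : ℝ) : ∫⁻ x, formMajorant a V S C M x < ⊤ := by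
  have hVi : IntegrableOn V S := hV.integrableOn_isCompact hS
  unfold formMajorant
  rw [lintegral_indicator hS.measurableSet, lintegral_add_right']
  · refine ENNReal.add_lt_top.2 ⟨?_, ?_⟩
    · rw [lintegral_finsetSum']
      · refine ENNReal.sum_lt_top.2 fun j _ => ?_
        rw [lintegral_add_left measurable_const, setLIntegral_const,
          lintegral_const_mul' _ _ ENNReal.ofReal_ne_top]
        exact ENNReal.add_lt_top.2 ⟨ENNReal.mul_lt_top ENNReal.ofReal_lt_top hS.measure_lt_top,
          ENNReal.mul_lt_top ENNReal.ofReal_lt_top (MemLp.lintegral_enorm_sq_lt_top (ha j S hS))⟩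
      · exact fun j _ => (((ha.aestronglyMeasurable j).restrict.enorm.pow_const 2).const_mul
          _).const_add _
    · rw [lintegral_const_mul' _ _ ENNReal.ofReal_ne_top]
      exact ENNReal.mul_lt_top ENNReal.ofReal_lt_top hVi.hasFiniteIntegral
  · exact hVi.aestronglyMeasurable.enorm.const_mul _

theorem formDensity_eq_zero {x : E n} (hx : x ∉ tsupport u) : formDensity a V u x = 0 := by
  simp [formDensity, magGrad, partialDeriv, fderiv_eq_zero_of_notMem_tsupport hx,
    image_eq_zero_of_notMem_tsupport hx]

theorem formDensity_le_majorant {S : Set (E n)} (hS : tsupport u ⊆ S) {C M : ℝ} {x : E n}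
    (hC : ∀ j, ‖partialDeriv u x j‖ ≤ C) (hM : ‖u x‖ ≤ M) :
    formDensity a V u x ≤ formMajorant a V S C M x := by
  by_cases hx : x ∈ S
  · rw [formMajorant, indicator_of_mem hx, formDensity]
    refine add_le_add (Finset.sum_le_sum fun j _ => ?_) ?_
    · rw [enorm_sq_eq_ofReal, enorm_sq_eq_ofReal, ← ENNReal.ofReal_mul (by positivity),
        ← ENNReal.ofReal_add (by positivity) (by positivity)]
      refine ENNReal.ofReal_le_ofReal ?_
      have h1 : ‖magGrad a u x j‖ ≤ C + ‖a x j‖ * M := by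
        refine (norm_add_le _ _).trans (add_le_add (hC j) ?_)
        rw [norm_mul, norm_mul, Complex.norm_I, one_mul, Complex.norm_real]
        gcongr
      calc ‖magGrad a u x j‖ ^ 2 ≤ (C + ‖a x j‖ * M) ^ 2 := by gcongr
        _ ≤ _ := by nlinarith [sq_nonneg (C - ‖a x j‖ * M)]
    · rw [mul_comm, enorm_sq_eq_ofReal]
      refine mul_le_mul' (ENNReal.ofReal_le_ofReal (by gcongr)) ?_
      rw [Real.enorm_eq_ofReal_abs]
      exact ENNReal.ofReal_le_ofReal (le_abs_self _)
  · rw [formDensity_eq_zero fun h => hx (hS h)]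
    exact zero_le

theorem IsTest.exists_bounds {φ : E n → ℂ} (hφ : IsTest φ) :
    ∃ C M : ℝ, (∀ x j, ‖partialDeriv φ x j‖ ≤ C) ∧ ∀ x, ‖φ x‖ ≤ M := by
  obtain ⟨K, hK⟩ := ContDiff.lipschitzWith_of_hasCompactSupport hφ.2 hφ.1 (by simp)
  obtain ⟨M, hM⟩ := LipschitzWith.exists_bound_of_hasCompactSupport hK hφ.2
  exact ⟨K, M, fun x j => (norm_map_single_le _ _).trans (norm_fderiv_le_of_lipschitz ℝ hK), hM⟩

theorem IsTest.quadForm_lt_top (ha : L2loc a) (hV : LocallyIntegrable V volume) {φ : E n → ℂ}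
    (hφ : IsTest φ) : quadForm a V univ φ < ⊤ := by
  obtain ⟨C, M, hC, hM⟩ := hφ.exists_bounds
  rw [quadForm_eq, Measure.restrict_univ]
  exact (lintegral_mono fun x => formDensity_le_majorant le_rfl (hC x) (hM x)).trans_lt
    (lintegral_formMajorant_lt_top ha hV hφ.2 C M)

end FormDensity

/-! ### Mollification: from test functions to Lipschitz functions -/

section Mollify

open scoped Pointwise

variable {n : ℕ}

/-- A sequence of bump functions with shrinking supports. -/
noncomputable def mollifier (n k : ℕ) : ContDiffBump (0 : E n) where
  rIn := 1 / (k + 2)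
  rOut := 2 / (k + 2)
  rIn_pos := by positivity
  rIn_lt_rOut := by gcongr; norm_num

theorem mollifier_rOut_le_one (n k : ℕ) : (mollifier n k).rOut ≤ 1 := by
  change (2 : ℝ) / (k + 2) ≤ 1
  rw [div_le_one (by positivity)]
  linarith [(Nat.cast_nonneg k : (0 : ℝ) ≤ k)]

theorem tendsto_mollifier_rOut (n : ℕ) :
    Tendsto (fun k => (mollifier n k).rOut) atTop (𝓝 0) := by
  change Tendsto (fun k : ℕ => (2 : ℝ) / (k + 2)) atTop (𝓝 0)
  exact tendsto_const_nhds.div_atTop (tendsto_atTop_add_const_right _ _ tendsto_natCast_atTop_atTop)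

/-- The regularizations of a function. -/
noncomputable def mollify (k : ℕ) (φ : E n → ℂ) : E n → ℂ :=
  convolution ((mollifier n k).normed volume) φ (ContinuousLinearMap.lsmul ℝ ℝ) volume

theorem norm_mollify_le {k : ℕ} {g : E n → ℂ} (hg : AEStronglyMeasurable g volume) {M : ℝ}
    (hM : ∀ x, ‖g x‖ ≤ M) (x : E n) : ‖mollify k g x‖ ≤ M := by
  have := dist_convolution_le (μ := volume) (z₀ := (0 : ℂ)) (x₀ := x)
    ((norm_nonneg _).trans (hM 0)) (mollifier n k).support_normed_eq.subset
    (mollifier n k).nonneg_normed (mollifier n k).integral_normed hg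
    (fun y _ => by simpa using hM y)
  simpa [mollify] using this

variable {φ : E n → ℂ} {K : NNReal}

theorem isTest_mollify (hφ : LipschitzWith K φ) (hc : HasCompactSupport φ) (k : ℕ) :
    IsTest (mollify k φ) :=
  ⟨HasCompactSupport.contDiff_convolution_left _ (mollifier n k).hasCompactSupport_normed
    (mollifier n k).contDiff_normed hφ.continuous.locallyIntegrable,
    HasCompactSupport.convolution _ (mollifier n k).hasCompactSupport_normed hc⟩

theorem tsupport_mollify_subset (hc : HasCompactSupport φ) (k : ℕ) :
    tsupport (mollify k φ) ⊆ Metric.closedBall (0 : E n) 1 + tsupport φ := by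
  refine closure_minimal ((support_convolution_subset _).trans ?_)
    ((isCompact_closedBall 0 1).add hc).isClosed
  refine add_subset_add ?_ (subset_tsupport _)
  rw [(mollifier n k).support_normed_eq]
  exact Metric.ball_subset_closedBall.trans
    (Metric.closedBall_subset_closedBall (mollifier_rOut_le_one n k))

theorem norm_partialDeriv_le (hφ : LipschitzWith K φ) (x : E n) (j : Fin n) :
    ‖partialDeriv φ x j‖ ≤ K :=
  (norm_map_single_le _ _).trans (norm_fderiv_le_of_lipschitz ℝ hφ)

/-- The derivative is moved onto `φ`: the difference quotients are bounded by the Lipschitz constant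
and converge almost everywhere by Rademacher's theorem. Consequently the mollified gradients inherit
the bound on the gradient, uniformly in `k`. -/
theorem partialDeriv_mollify (hφ : LipschitzWith K φ) (hc : HasCompactSupport φ) (k : ℕ) (x : E n)
    (j : Fin n) :
    partialDeriv (mollify k φ) x j = mollify k (fun y => partialDeriv φ y j) x := by
  set e : E n := EuclideanSpace.single j 1
  set ρ := (mollifier n k).normed (volume : Measure (E n)) with hρ
  have hρi : Integrable ρ := (mollifier n k).integrable_normed
  have hρc : Continuous ρ := (mollifier n k).continuous_normed
  have hd : HasLineDerivAt ℝ (mollify k φ) (partialDeriv (mollify k φ) x j) x e :=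
    (((isTest_mollify hφ hc k).1.differentiable (by simp)) x).hasFDerivAt.hasLineDerivAt e
  have hex : ∀ y, Integrable fun t => ρ t • φ (y - t) := fun y => by
    refine ((hρc.smul (hφ.continuous.comp (by fun_prop : Continuous fun t => y - t)))
      ).integrable_of_hasCompactSupport ?_
    exact (mollifier n k).hasCompactSupport_normed.smul_right
  refine tendsto_nhds_unique hd.tendsto_slope_zero_right ?_
  have hq : ∀ t : ℝ, t⁻¹ • (mollify k φ (x + t • e) - mollify k φ x) =
      ∫ y, ρ y • (t⁻¹ • (φ (x - y + t • e) - φ (x - y))) := fun t => by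
    simp only [mollify, convolution_def, ContinuousLinearMap.lsmul_apply]
    rw [← integral_sub (hex _) (hex _), ← integral_smul]
    refine integral_congr_ae (Eventually.of_forall fun y => ?_)
    dsimp only
    rw [← smul_sub, smul_comm, sub_add_eq_add_sub]
  simp only [hq]
  simp only [mollify, convolution_def, ContinuousLinearMap.lsmul_apply]
  refine tendsto_integral_filter_of_dominated_convergence (fun y => ‖ρ y‖ * (K * ‖e‖)) ?_ ?_
    (hρi.norm.mul_const _) ?_
  · refine Eventually.of_forall fun t => Continuous.aestronglyMeasurable ?_
    have := hφ.continuous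
    fun_prop
  · filter_upwards [self_mem_nhdsWithin] with t (ht : 0 < t)
    refine Eventually.of_forall fun y => ?_
    rw [norm_smul, norm_smul]
    refine mul_le_mul_of_nonneg_left ?_ (norm_nonneg _)
    have h1 : ‖φ (x - y + t • e) - φ (x - y)‖ ≤ K * ‖t • e‖ := by
      simpa [dist_eq_norm] using hφ.dist_le_mul (x - y + t • e) (x - y)
    rw [norm_inv, inv_mul_le_iff₀ (norm_pos_iff.2 ht.ne')]
    refine h1.trans (le_of_eq ?_)
    rw [norm_smul]; ring
  · have hae : ∀ᵐ y, DifferentiableAt ℝ φ (x - y) :=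
      (Measure.measurePreserving_sub_left volume x).quasiMeasurePreserving.ae
        (hφ.ae_differentiableAt)
    filter_upwards [hae] with y hy
    exact ((hy.hasFDerivAt.hasLineDerivAt e).tendsto_slope_zero_right).const_smul _

theorem tendsto_partialDeriv_mollify (hφ : LipschitzWith K φ) (hc : HasCompactSupport φ)
    (j : Fin n) : ∀ᵐ x, Tendsto (fun k => partialDeriv (mollify k φ) x j) atTop
      (𝓝 (partialDeriv φ x j)) := by
  have hm : AEStronglyMeasurable (fun y => partialDeriv φ y j) volume :=
    (measurable_fderiv_apply_const ℝ φ _).aestronglyMeasurable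
  have hli : LocallyIntegrable (fun y => partialDeriv φ y j) volume :=
    (memLp_top_of_bound hm K (Eventually.of_forall fun x =>
      norm_partialDeriv_le hφ x j)).locallyIntegrable le_top
  -- Lebesgue differentiation for the bounded gradient; it requires the ratio of outer to inner
  -- radius to stay bounded, and here it is exactly `2`.
  filter_upwards [ContDiffBump.ae_convolution_tendsto_right_of_locallyIntegrable (K := 2)
    (tendsto_mollifier_rOut n) (Eventually.of_forall fun k => by
      change (2 : ℝ) / (k + 2) ≤ 2 * (1 / (k + 2)); rw [mul_one_div]) hli] with x hx
  simp only [partialDeriv_mollify hφ hc]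
  exact hx

/-- The form bound `h_{a,V} ≥ ε` on test functions. -/
def FormBound (a : E n → E n) (V : E n → ℝ) (ε : ℝ) : Prop :=
  ∀ φ : E n → ℂ, IsTest φ → ENNReal.ofReal ε * ∫⁻ x, ‖φ x‖ₑ ^ 2 ≤ quadForm a V univ φ

/-- The form bound extends to Lipschitz functions with compact support. -/
theorem FormBound.of_lipschitz {a : E n → E n} {V : E n → ℝ} {ε : ℝ} (h : FormBound a V ε)
    (ha : L2loc a) (hV : LocallyIntegrable V volume)
    (hφ : LipschitzWith K φ) (hc : HasCompactSupport φ) :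
    ENNReal.ofReal ε * ∫⁻ x, ‖φ x‖ₑ ^ 2 ≤ quadForm a V univ φ := by
  obtain ⟨M, hM⟩ := LipschitzWith.exists_bound_of_hasCompactSupport hφ hc
  set S := Metric.closedBall (0 : E n) 1 + tsupport φ with hS
  have hSc : IsCompact S := (isCompact_closedBall 0 1).add hc
  have hφm : AEStronglyMeasurable φ volume := hφ.continuous.aestronglyMeasurable
  have hkM : ∀ k x, ‖mollify k φ x‖ ≤ M := fun k => norm_mollify_le hφm hM
  have hkS : ∀ k, tsupport (mollify k φ) ⊆ S := tsupport_mollify_subset hc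
  have hkC : ∀ k x j, ‖partialDeriv (mollify k φ) x j‖ ≤ K := fun k x j => by
    rw [partialDeriv_mollify hφ hc]
    exact norm_mollify_le (measurable_fderiv_apply_const ℝ φ _).aestronglyMeasurable
      (fun y => norm_partialDeriv_le hφ y j) x
  have hval : ∀ x, Tendsto (fun k => mollify k φ x) atTop (𝓝 (φ x)) := fun x =>
    ContDiffBump.convolution_tendsto_right_of_continuous (tendsto_mollifier_rOut n)
      hφ.continuous x
  have hkm : ∀ k, AEStronglyMeasurable (mollify k φ) volume := fun k =>
    (isTest_mollify hφ hc k).1.continuous.aestronglyMeasurable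
  have hlim : Tendsto (fun k => quadForm a V univ (mollify k φ)) atTop
      (𝓝 (quadForm a V univ φ)) := by
    simp only [quadForm_eq, Measure.restrict_univ]
    -- All mollifications share one compact set and the same bounds on values and derivatives, so
    -- one majorant serves, with only `a ∈ L²_loc` and `V ∈ L¹_loc`.
    refine tendsto_lintegral_of_dominated_convergence' (formMajorant a V S K M)
      (fun k => aemeasurable_formDensity ha hV.aestronglyMeasurable.aemeasurable (hkm k))
      (fun k => Eventually.of_forall fun x => formDensity_le_majorant (hkS k) (hkC k x) (hkM k x))
      (lintegral_formMajorant_lt_top ha hV hSc _ _).ne ?_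
    have hall : ∀ᵐ x, ∀ j, Tendsto (fun k => partialDeriv (mollify k φ) x j) atTop
      (𝓝 (partialDeriv φ x j)) := ae_all_iff.2 fun j => tendsto_partialDeriv_mollify hφ hc j
    filter_upwards [hall] with x hx
    refine Tendsto.add (tendsto_finsetSum _ fun j _ => ?_) ?_
    · exact ((ENNReal.continuous_pow 2).tendsto _).comp
        ((hx j).add ((hval x).const_mul _)).enorm
    · refine ENNReal.Tendsto.const_mul (((ENNReal.continuous_pow 2).tendsto _).comp (hval x).enorm)
        (Or.inr ENNReal.ofReal_ne_top)
  have hSvol := hSc.measure_lt_top (μ := (volume : Measure (E n)))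
  have hlim2 : Tendsto (fun k => ENNReal.ofReal ε * ∫⁻ x, ‖mollify k φ x‖ₑ ^ 2) atTop
      (𝓝 (ENNReal.ofReal ε * ∫⁻ x, ‖φ x‖ₑ ^ 2)) := by
    refine ENNReal.Tendsto.const_mul ?_ (Or.inr ENNReal.ofReal_ne_top)
    refine tendsto_lintegral_of_dominated_convergence'
      (S.indicator fun _ => ENNReal.ofReal (M ^ 2)) (fun k => (hkm k).enorm.pow_const 2)
      (fun k => Eventually.of_forall fun x => ?_) ?_ (Eventually.of_forall fun x =>
        ((ENNReal.continuous_pow 2).tendsto _).comp (hval x).enorm)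
    · by_cases hx : x ∈ S
      · simp only [indicator_of_mem hx, enorm_sq_eq_ofReal]
        refine ENNReal.ofReal_le_ofReal ?_
        have := hkM k x
        gcongr
      · simp [image_eq_zero_of_notMem_tsupport fun h => hx (hkS k h)]
    · rw [lintegral_indicator hSc.measurableSet, setLIntegral_const]
      exact ENNReal.mul_ne_top ENNReal.ofReal_ne_top hSvol.ne
  exact le_of_tendsto_of_tendsto' hlim2 hlim fun k => h _ (isTest_mollify hφ hc k)

end Mollify

/-! ### Form bounds and strict positivity of the operator -/

section Operator

variable {n : ℕ} {a : E n → E n} {V : E n → ℝ} {φ ψ : E n → ℂ}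

theorem IsTest.add (hφ : IsTest φ) (hψ : IsTest ψ) : IsTest (φ + ψ) :=
  ⟨hφ.1.add hψ.1, hφ.2.add hψ.2⟩

theorem IsTest.smul (c : ℂ) (hφ : IsTest φ) : IsTest (c • φ) :=
  ⟨contDiff_const.smul hφ.1, hφ.2.smul_left (f := fun _ => c)⟩

theorem IsTest.sub (hφ : IsTest φ) (hψ : IsTest ψ) : IsTest (φ - ψ) :=
  ⟨hφ.1.sub hψ.1, hφ.2.sub hψ.2⟩

theorem IsTest.differentiable (hφ : IsTest φ) : Differentiable ℝ φ :=
  hφ.1.differentiable (by simp)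

/-- The components of the embedding of test functions that turns the form `h_{a,V} + 1` into an
inner product. -/
noncomputable def formComp (a : E n → E n) (V : E n → ℝ) (φ : E n → ℂ) :
    Option (Option (Fin n)) → E n → ℂ
  | none => φ
  | some none => fun x => (√(V x) : ℂ) * φ x
  | some (some j) => fun x => magGrad a φ x j

theorem formComp_add (hφ : IsTest φ) (hψ : IsTest ψ) (i : Option (Option (Fin n))) :
    formComp a V (φ + ψ) i = formComp a V φ i + formComp a V ψ i := by
  rcases i with _ | _ | j
  · rfl
  · ext x; simp [formComp, mul_add]
  · ext x
    simp only [formComp, magGrad, partialDeriv, Pi.add_apply,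
      fderiv_add (hφ.differentiable x) (hψ.differentiable x), _root_.add_apply]
    ring

theorem formComp_smul (c : ℂ) (hφ : IsTest φ) (i : Option (Option (Fin n))) :
    formComp a V (c • φ) i = c • formComp a V φ i := by
  rcases i with _ | _ | j
  · rfl
  · ext x; simp [formComp]; ring
  · ext x
    simp only [formComp, magGrad, partialDeriv, Pi.smul_apply, smul_eq_mul,
      fderiv_const_smul (hφ.differentiable x), _root_.smul_apply]
    ring

theorem formComp_sub (hφ : IsTest φ) (hψ : IsTest ψ) (i : Option (Option (Fin n))) :
    formComp a V (φ - ψ) i = formComp a V φ i - formComp a V ψ i := by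
  have h : φ - ψ = φ + (-1 : ℂ) • ψ := by simp [sub_eq_add_neg]
  rw [h, formComp_add hφ (hψ.smul _), formComp_smul _ hψ]
  simp [sub_eq_add_neg]

theorem enorm_sqrt_mul_sq (V : E n → ℝ) (φ : E n → ℂ) (x : E n) :
    ‖(√(V x) : ℂ) * φ x‖ₑ ^ 2 = ENNReal.ofReal (V x) * ‖φ x‖ₑ ^ 2 := by
  rw [enorm_sq_eq_ofReal, enorm_sq_eq_ofReal, norm_mul, Complex.norm_real,
    Real.norm_of_nonneg (Real.sqrt_nonneg _), mul_pow, ENNReal.ofReal_mul (sq_nonneg _)]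
  congr 1
  rcases le_total 0 (V x) with h | h
  · rw [Real.sq_sqrt h]
  · rw [Real.sqrt_eq_zero_of_nonpos h, ENNReal.ofReal_of_nonpos h]; simp

theorem sum_enorm_formComp_sq (x : E n) :
    ∑ i, ‖formComp a V φ i x‖ₑ ^ 2 = ‖φ x‖ₑ ^ 2 + formDensity a V φ x := by
  rw [Fintype.sum_option, Fintype.sum_option, formDensity]
  simp only [formComp]
  rw [enorm_sqrt_mul_sq, add_comm (ENNReal.ofReal _ * _)]

variable (ha : L2loc a) (hV : LocallyIntegrable V volume)

include ha hV

theorem memLp_formComp (hφ : IsTest φ) (i : Option (Option (Fin n))) :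
    MemLp (formComp a V φ i) 2 volume := by
  have hm : AEStronglyMeasurable (formComp a V φ i) volume := by
    have hc : AEStronglyMeasurable φ volume := hφ.1.continuous.aestronglyMeasurable
    rcases i with _ | _ | j
    · exact hc
    · exact ((Complex.continuous_ofReal.comp Real.continuous_sqrt).comp_aestronglyMeasurable
        hV.aestronglyMeasurable).mul hc
    · exact aestronglyMeasurable_magGrad ha hc j
  refine ⟨hm, ?_⟩
  have h2 : ∫⁻ x, ‖φ x‖ₑ ^ 2 < ⊤ := MemLp.lintegral_enorm_sq_lt_top
    (hφ.1.continuous.memLp_of_hasCompactSupport hφ.2)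
  have h3 := hφ.quadForm_lt_top ha hV
  rw [quadForm_eq, Measure.restrict_univ] at h3
  have h4 : eLpNorm (formComp a V φ i) 2 volume ^ 2 < ⊤ := by
    rw [eLpNorm_two_sq]
    calc ∫⁻ x, ‖formComp a V φ i x‖ₑ ^ 2 ≤ ∫⁻ x, (‖φ x‖ₑ ^ 2 + formDensity a V φ x) :=
          lintegral_mono fun x => by
            rw [← sum_enorm_formComp_sq]
            exact Finset.single_le_sum (f := fun i => ‖formComp a V φ i x‖ₑ ^ 2)
              (fun _ _ => zero_le) (Finset.mem_univ i)
      _ = (∫⁻ x, ‖φ x‖ₑ ^ 2) + ∫⁻ x, formDensity a V φ x := by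
          rw [lintegral_add_left]
          exact hφ.1.continuous.enorm.measurable.pow_const 2
      _ < ⊤ := ENNReal.add_lt_top.2 ⟨h2, h3⟩
  exact lt_top_iff_ne_top.2 fun h => by simp [h] at h4

omit ha hV in
theorem inner_toLp {α : Type*} [MeasurableSpace α] {μ : Measure α} {f g : α → ℂ}
    (hf : MemLp f 2 μ) (hg : MemLp g 2 μ) :
    inner ℂ (hf.toLp f) (hg.toLp g) = ∫ x, g x * conj (f x) ∂μ := by
  rw [L2.inner_def]
  refine integral_congr_ae ?_
  filter_upwards [hf.coeFn_toLp, hg.coeFn_toLp] with x h1 h2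
  rw [h1, h2, RCLike.inner_apply]

/-- The embedding of test functions into a Hilbert space that turns the form `h_{a,V} + 1` into the
inner product. -/
noncomputable def formEmb (hφ : IsTest φ) : PiLp 2 (fun _ : Option (Option (Fin n)) => L2 n) :=
  WithLp.toLp 2 fun i => (memLp_formComp ha hV hφ i).toLp _

theorem formEmb_sub (hφ : IsTest φ) (hψ : IsTest ψ) :
    formEmb ha hV (hφ.sub hψ) = formEmb ha hV hφ - formEmb ha hV hψ := by
  ext1 i
  refine (MemLp.toLp_congr (memLp_formComp ha hV (hφ.sub hψ) i) ((memLp_formComp ha hV hφ i).sub (memLp_formComp ha hV hψ i))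
    (Eventually.of_forall fun x => ?_)).trans (MemLp.toLp_sub (memLp_formComp ha hV hφ i)
      (memLp_formComp ha hV hψ i))
  rw [formComp_sub hφ hψ]

theorem formEmb_add (hφ : IsTest φ) (hψ : IsTest ψ) :
    formEmb ha hV (hφ.add hψ) = formEmb ha hV hφ + formEmb ha hV hψ := by
  ext1 i
  refine (MemLp.toLp_congr (memLp_formComp ha hV (hφ.add hψ) i) ((memLp_formComp ha hV hφ i).add (memLp_formComp ha hV hψ i))
    (Eventually.of_forall fun x => ?_)).trans (MemLp.toLp_add (memLp_formComp ha hV hφ i)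
      (memLp_formComp ha hV hψ i))
  rw [formComp_add hφ hψ]

theorem formEmb_smul (c : ℂ) (hφ : IsTest φ) :
    formEmb ha hV (hφ.smul c) = c • formEmb ha hV hφ := by
  ext1 i
  refine (MemLp.toLp_congr (memLp_formComp ha hV (hφ.smul c) i) ((memLp_formComp ha hV hφ i).const_smul c)
    (Eventually.of_forall fun x => ?_)).trans (MemLp.toLp_const_smul c
      (memLp_formComp ha hV hφ i))
  rw [formComp_smul c hφ]

theorem ofReal_norm_formEmb_sq (hφ : IsTest φ) :
    ENNReal.ofReal (‖formEmb ha hV hφ‖ ^ 2) = (∫⁻ x, ‖φ x‖ₑ ^ 2) + quadForm a V univ φ := by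
  rw [PiLp.norm_sq_eq_of_L2, ← sum_enorm_sq_eq_ofReal]
  simp only [formEmb, Lp.enorm_toLp, eLpNorm_two_sq]
  rw [← lintegral_finsetSum', quadForm_eq, Measure.restrict_univ, ← lintegral_add_left]
  · exact lintegral_congr fun x => sum_enorm_formComp_sq x
  · exact hφ.1.continuous.enorm.measurable.pow_const 2
  · exact fun i _ => (memLp_formComp ha hV hφ i).1.enorm.pow_const 2

theorem ofReal_norm_formEmb_none_sq (hφ : IsTest φ) :
    ENNReal.ofReal (‖formEmb ha hV hφ none‖ ^ 2) = ∫⁻ x, ‖φ x‖ₑ ^ 2 := by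
  rw [← enorm_sq_eq_ofReal, formEmb, Lp.enorm_toLp, eLpNorm_two_sq]; rfl

/-- The component `none` carries the `L²` product and the others carry the form. Nonnegativity of
`V` is needed for `√V · √V = V`. -/
theorem inner_formEmb (h0 : ∀ᵐ x, 0 ≤ V x) (hφ : IsTest φ) (hψ : IsTest ψ) :
    inner ℂ (formEmb ha hV hψ) (formEmb ha hV hφ) =
      inner ℂ (formEmb ha hV hψ none) (formEmb ha hV hφ none) + sesqForm a V φ ψ := by
  have hi : ∀ i, Integrable fun x => formComp a V φ i x * conj (formComp a V ψ i x) := fun i => by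
    have := L2.integrable_inner (𝕜 := ℂ) ((memLp_formComp ha hV hψ i).toLp _)
      ((memLp_formComp ha hV hφ i).toLp _)
    refine this.congr ?_
    filter_upwards [(memLp_formComp ha hV hφ i).coeFn_toLp,
      (memLp_formComp ha hV hψ i).coeFn_toLp] with x h1 h2
    rw [h1, h2, RCLike.inner_apply]
  rw [PiLp.inner_apply, Fintype.sum_option]
  congr 1
  simp only [formEmb, inner_toLp]
  rw [← integral_finsetSum _ fun i _ => hi (some i), sesqForm]
  refine integral_congr_ae ?_
  filter_upwards [h0] with x hx
  rw [Fintype.sum_option, add_comm]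
  simp only [formComp]
  congr 1
  have : (V x : ℂ) = (√(V x) : ℂ) * (√(V x) : ℂ) := by
    rw [← Complex.ofReal_mul, Real.mul_self_sqrt hx]
  rw [this, map_mul, Complex.conj_ofReal]
  ring

theorem FormApprox.tendsto_none {φ : ℕ → E n → ℂ} {u : L2 n} (h : FormApprox a V φ u) :
    Tendsto (fun k => formEmb ha hV (h.1 k) none) atTop (𝓝 u) := by
  have := (Lp.tendsto_Lp_iff_tendsto_eLpNorm'' φ (fun k => memLp_formComp ha hV (h.1 k) none) u
    (Lp.memLp u)).2 h.2.1
  rwa [Lp.toLp_coeFn] at this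

theorem re_sesqForm_self (h0 : ∀ᵐ x, 0 ≤ V x) (hφ : IsTest φ) :
    ENNReal.ofReal (sesqForm a V φ φ).re = quadForm a V univ φ ∧ 0 ≤ (sesqForm a V φ φ).re := by
  have h1 := congrArg Complex.re (inner_formEmb ha hV h0 hφ hφ)
  have hsq : ∀ {H : Type _} [NormedAddCommGroup H] [InnerProductSpace ℂ H] (x : H),
      (inner ℂ x x : ℂ).re = ‖x‖ ^ 2 := fun x => by
    rw [inner_self_eq_norm_sq_to_K]; norm_cast
  rw [Complex.add_re, hsq, hsq] at h1
  have h2 := ofReal_norm_formEmb_sq ha hV hφ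
  have h3 : ENNReal.ofReal (‖formEmb ha hV hφ none‖ ^ 2) = ∫⁻ x, ‖φ x‖ₑ ^ 2 :=
    ofReal_norm_formEmb_none_sq ha hV hφ
  have h4 : 0 ≤ (sesqForm a V φ φ).re := by
    have : ‖formEmb ha hV hφ none‖ ^ 2 ≤ ‖formEmb ha hV hφ‖ ^ 2 := by
      gcongr; exact PiLp.norm_apply_le _ _
    linarith
  refine ⟨?_, h4⟩
  rw [h1, ENNReal.ofReal_add (by positivity) h4, h3] at h2
  refine (ENNReal.add_right_inj ?_).1 h2
  rw [← h3]; exact ENNReal.ofReal_ne_top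

/-- A form bound implies the corresponding operator bound. -/
theorem FormBound.strictlyPositive (h0 : ∀ᵐ x, 0 ≤ V x) {ε : ℝ} (hε : 0 < ε)
    (h : FormBound a V ε) : StrictlyPositive a V := by
  refine ⟨ε, hε, fun u f ⟨φ, hφ, hlim⟩ => ?_⟩
  -- The graph relation is tested with `v = u` and the same approximating sequence.
  have h1 := (Complex.continuous_re.tendsto _).comp (hlim u φ hφ)
  have h2 : Tendsto (fun k => ε * ‖formEmb ha hV (hφ.1 k) none‖ ^ 2) atTop (𝓝 (ε * ‖u‖ ^ 2)) :=
    ((hφ.tendsto_none ha hV).norm.pow 2).const_mul ε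
  refine le_of_tendsto_of_tendsto' h2 h1 fun k => ?_
  obtain ⟨h3, h4⟩ := re_sesqForm_self ha hV h0 (hφ.1 k)
  have h5 := h _ (hφ.1 k)
  rw [← h3] at h5
  have h6 : ENNReal.ofReal (‖formEmb ha hV (hφ.1 k) none‖ ^ 2) = ∫⁻ x, ‖φ k x‖ₑ ^ 2 :=
    ofReal_norm_formEmb_none_sq ha hV (hφ.1 k)
  rw [← h6, ← ENNReal.ofReal_mul hε.le, ENNReal.ofReal_le_ofReal_iff h4] at h5
  exact h5

/-- The squared distance of the embedded functions splits into the squared `L²` distance and the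
form of the difference. Form approximations thus become convergent sequences in a complete space. -/
theorem FormApprox.cauchySeq_formEmb {φ : ℕ → E n → ℂ} {u : L2 n} (h : FormApprox a V φ u) :
    CauchySeq fun k => formEmb ha hV (h.1 k) := by
  rw [cauchySeq_iff_tendsto_dist_atTop_0]
  have h1 := cauchySeq_iff_tendsto_dist_atTop_0.1 (h.tendsto_none ha hV).cauchySeq
  have h2 : ∀ p : ℕ × ℕ, dist (formEmb ha hV (h.1 p.1)) (formEmb ha hV (h.1 p.2)) ^ 2 =
      dist (formEmb ha hV (h.1 p.1) none) (formEmb ha hV (h.1 p.2) none) ^ 2 +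
        (quadForm a V univ (fun x => φ p.1 x - φ p.2 x)).toReal := fun p => by
    have ht := (h.1 p.1).sub (h.1 p.2)
    have e1 := ofReal_norm_formEmb_sq ha hV ht
    have e2 : ENNReal.ofReal (‖formEmb ha hV ht none‖ ^ 2) = ∫⁻ x, ‖(φ p.1 - φ p.2) x‖ₑ ^ 2 :=
      ofReal_norm_formEmb_none_sq ha hV ht
    have e3 := congrArg ENNReal.toReal e1
    rw [← e2, ENNReal.toReal_add ENNReal.ofReal_ne_top (ht.quadForm_lt_top ha hV).ne,
      ENNReal.toReal_ofReal (by positivity), ENNReal.toReal_ofReal (by positivity),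
      formEmb_sub] at e3
    rw [dist_eq_norm, dist_eq_norm]
    exact e3
  have h3 : Tendsto (fun p : ℕ × ℕ =>
      dist (formEmb ha hV (h.1 p.1)) (formEmb ha hV (h.1 p.2)) ^ 2) atTop (𝓝 0) := by
    simp only [h2]
    have := (h1.pow 2).add ((ENNReal.tendsto_toReal ENNReal.zero_ne_top).comp h.2.2)
    simpa using this
  have h4 := h3.sqrt
  simpa [Real.sqrt_sq dist_nonneg] using h4

/-- The space of embedded test functions. -/
noncomputable def formRange : Submodule ℂ (PiLp 2 (fun _ : Option (Option (Fin n)) => L2 n)) where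
  carrier := {h | ∃ (φ : E n → ℂ) (hφ : IsTest φ), h = formEmb ha hV hφ}
  add_mem' := by
    rintro _ _ ⟨φ, hφ, rfl⟩ ⟨ψ, hψ, rfl⟩
    exact ⟨_, hφ.add hψ, (formEmb_add ha hV hφ hψ).symm⟩
  zero_mem' := by
    have h : IsTest (0 : E n → ℂ) := ⟨contDiff_const, HasCompactSupport.zero⟩
    refine ⟨_, h.smul 0, ?_⟩
    rw [formEmb_smul ha hV 0 h, zero_smul]
  smul_mem' := by
    rintro c _ ⟨φ, hφ, rfl⟩
    exact ⟨_, hφ.smul c, (formEmb_smul ha hV c hφ).symm⟩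

/-- The resolvent `(H_{a,V} + 1)⁻¹`, in the form of the Riesz representation. -/
theorem exists_resolvent (h0 : ∀ᵐ x, 0 ≤ V x) (f : L2 n) :
    ∃ p : PiLp 2 (fun _ : Option (Option (Fin n)) => L2 n),
      (p none, f - p none) ∈ operatorGraph a V ∧ inner ℂ p p = inner ℂ (p none) f ∧
      ∀ (ψ : E n → ℂ) (hψ : IsTest ψ),
        inner ℂ (formEmb ha hV hψ) p = inner ℂ (formEmb ha hV hψ none) f := by
  set S := (formRange ha hV).topologicalClosure with hS
  have : CompleteSpace S := (formRange ha hV).isClosed_topologicalClosure.completeSpace_coe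
  -- Pairing with `(f, 0, …, 0)` sees only the `L²` component. Its projection to the closure of the
  -- embedded test functions is therefore the Riesz representative of `v ↦ (v, f)` on the form
  -- domain.
  set g : PiLp 2 (fun _ : Option (Option (Fin n)) => L2 n) :=
    WithLp.toLp 2 fun i => if i = none then f else 0 with hg
  have hgi : ∀ q : PiLp 2 (fun _ : Option (Option (Fin n)) => L2 n),
      inner ℂ q g = inner ℂ (q none) f := fun q => by
    rw [PiLp.inner_apply, Fintype.sum_option]
    simp [hg]
  set p := S.starProjection g with hp
  have hpS : p ∈ S := S.starProjection_apply_mem g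
  have hq : ∀ q ∈ S, inner ℂ q p = inner ℂ (q none) f := fun q hqS => by
    have h := S.starProjection_inner_eq_zero g q hqS
    rw [← hgi, ← sub_eq_zero, ← inner_sub_right, ← inner_conj_symm, ← neg_sub, inner_neg_left, h]
    simp
  have hmem : ∀ {ψ : E n → ℂ} (hψ : IsTest ψ), formEmb ha hV hψ ∈ S := fun hψ =>
    (formRange ha hV).le_topologicalClosure ⟨_, hψ, rfl⟩
  refine ⟨p, ?_, hq p hpS, fun ψ hψ => hq _ (hmem hψ)⟩
  obtain ⟨x, hxS, hxp⟩ := mem_closure_iff_seq_limit.1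
    (show p ∈ closure (formRange ha hV : Set _) from hpS)
  choose φ hφ hxφ using hxS
  have hlimp : Tendsto (fun k => formEmb ha hV (hφ k)) atTop (𝓝 p) := by
    simpa only [← hxφ] using hxp
  have hcoord : ∀ {y : ℕ → PiLp 2 (fun _ : Option (Option (Fin n)) => L2 n)}
      {q : PiLp 2 (fun _ : Option (Option (Fin n)) => L2 n)}, Tendsto y atTop (𝓝 q) →
      Tendsto (fun k => y k none) atTop (𝓝 (q none)) := fun h =>
    ((PiLp.continuous_apply 2 _ none).tendsto _).comp h
  have hFA : FormApprox a V φ (p none) := by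
    refine ⟨hφ, ?_, ?_⟩
    · have h := hcoord hlimp
      rw [← Lp.toLp_coeFn (p none) (Lp.memLp (p none))] at h
      exact (Lp.tendsto_Lp_iff_tendsto_eLpNorm'' φ (fun k => memLp_formComp ha hV (hφ k) none)
        (p none) (Lp.memLp (p none))).1 h
    · have hd := cauchySeq_iff_tendsto_dist_atTop_0.1 hlimp.cauchySeq
      have hd2 : Tendsto (fun q : ℕ × ℕ => ENNReal.ofReal
          (dist (formEmb ha hV (hφ q.1)) (formEmb ha hV (hφ q.2)) ^ 2)) atTop (𝓝 0) := by
        have := (ENNReal.continuous_ofReal.tendsto _).comp (hd.pow 2)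
        simpa [Function.comp_def] using this
      refine tendsto_of_tendsto_of_tendsto_of_le_of_le tendsto_const_nhds hd2
        (fun _ => zero_le) fun q => ?_
      have := ofReal_norm_formEmb_sq ha hV ((hφ q.1).sub (hφ q.2))
      simp only [dist_eq_norm, ← formEmb_sub, this]
      exact le_add_self
  refine ⟨φ, hFA, fun v ψ hψ => ?_⟩
  obtain ⟨q, hlimq⟩ := cauchySeq_tendsto_of_complete (hψ.cauchySeq_formEmb ha hV)
  have hqS : q ∈ S := (formRange ha hV).isClosed_topologicalClosure.mem_of_tendsto hlimq
    (Eventually.of_forall fun k => hmem (hψ.1 k))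
  have hqv : q none = v := tendsto_nhds_unique (hcoord hlimq) (hψ.tendsto_none ha hV)
  -- In the limit the form equals `⟨q, p⟩ - ⟨v, p none⟩ = ⟨v, f - p none⟩`, so `p none` solves `H u
  -- = f - u`.
  have hs : ∀ k, sesqForm a V (φ k) (ψ k) =
      inner ℂ (formEmb ha hV (hψ.1 k)) (formEmb ha hV (hφ k)) -
        inner ℂ (formEmb ha hV (hψ.1 k) none) (formEmb ha hV (hφ k) none) := fun k => by
    rw [inner_formEmb ha hV h0]; ring
  simp only [hs]
  have := (hlimq.inner (𝕜 := ℂ) hlimp).sub ((hcoord hlimq).inner (𝕜 := ℂ) (hcoord hlimp))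
  rwa [hq q hqS, hqv, ← inner_sub_right] at this

/-- Strict positivity of the operator implies a bound of the form. -/
theorem StrictlyPositive.exists_formBound (h0 : ∀ᵐ x, 0 ≤ V x) (h : StrictlyPositive a V) :
    ∃ ε, 0 < ε ∧ FormBound a V ε := by
  obtain ⟨ε, hε, h⟩ := h
  refine ⟨ε, hε, fun φ hφ => ?_⟩
  set f : L2 n := formEmb ha hV hφ none with hf
  obtain ⟨p, hgraph, hpp, hψ⟩ := exists_resolvent ha hV h0 f
  set u : L2 n := p none
  have hsq : ∀ {H : Type _} [NormedAddCommGroup H] [InnerProductSpace ℂ H] (x : H),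
      (inner ℂ x x : ℂ).re = ‖x‖ ^ 2 := fun x => by
    rw [inner_self_eq_norm_sq_to_K]; norm_cast
  have h1 := h _ _ hgraph
  rw [inner_sub_right, Complex.sub_re, hsq] at h1
  have h2 : ‖p‖ ^ 2 = (inner ℂ u f : ℂ).re := by rw [← hsq, hpp]
  have h3 : (inner ℂ u f : ℂ).re ≤ ‖u‖ * ‖f‖ :=
    (Complex.re_le_norm _).trans (norm_inner_le_norm _ _)
  -- Duality: `‖φ‖² = ⟨φ, (H + 1) u⟩` is the product of `φ` and `u` in the form norm. A general test
  -- function need not belong to the operator domain, and this circumvents any approximation by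
  -- elements of it.
  have h4 : ‖f‖ ^ 2 ≤ ‖formEmb ha hV hφ‖ * ‖p‖ := by
    rw [← hsq f, ← hψ φ hφ]
    exact (Complex.re_le_norm _).trans (norm_inner_le_norm _ _)
  have h5 := ofReal_norm_formEmb_sq ha hV hφ
  have h6 : ENNReal.ofReal (‖f‖ ^ 2) = ∫⁻ x, ‖φ x‖ₑ ^ 2 :=
    ofReal_norm_formEmb_none_sq ha hV hφ
  -- The operator bound says `(1 + ε) ‖u‖ ≤ ‖f‖`, and `‖p‖² = Re ⟨u, f⟩ ≤ ‖u‖ ‖f‖`. Combined with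
  -- `h4` this yields `(1 + ε) ‖φ‖² ≤ ‖φ‖² + h(φ, φ)`.
  have h7 : (1 + ε) * ‖p‖ ^ 2 ≤ ‖f‖ ^ 2 := by
    have e1 : (1 + ε) * ‖u‖ ^ 2 ≤ ‖u‖ * ‖f‖ := by linarith
    have e2 : (1 + ε) * ‖u‖ ≤ ‖f‖ := by
      rcases (norm_nonneg u).eq_or_lt with h | h
      · rw [← h]; simp
      · refine le_of_mul_le_mul_left ?_ h
        linarith
    calc (1 + ε) * ‖p‖ ^ 2 ≤ (1 + ε) * (‖u‖ * ‖f‖) := by rw [h2]; gcongr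
      _ = ((1 + ε) * ‖u‖) * ‖f‖ := by ring
      _ ≤ ‖f‖ * ‖f‖ := by gcongr
      _ = _ := by ring
  have h8 : (1 + ε) * ‖f‖ ^ 2 ≤ ‖formEmb ha hV hφ‖ ^ 2 := by
    rcases (sq_nonneg ‖f‖).eq_or_lt with h | h
    · rw [← h]; simp
    · refine le_of_mul_le_mul_right ?_ h
      calc (1 + ε) * ‖f‖ ^ 2 * ‖f‖ ^ 2 = (1 + ε) * (‖f‖ ^ 2) ^ 2 := by ring
        _ ≤ (1 + ε) * (‖formEmb ha hV hφ‖ * ‖p‖) ^ 2 := by gcongr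
        _ = ‖formEmb ha hV hφ‖ ^ 2 * ((1 + ε) * ‖p‖ ^ 2) := by ring
        _ ≤ ‖formEmb ha hV hφ‖ ^ 2 * ‖f‖ ^ 2 := by gcongr
  have h9 := ENNReal.ofReal_le_ofReal h8
  rw [h5, ← h6, add_mul, one_mul, ENNReal.ofReal_add (by positivity) (by positivity),
    ENNReal.ofReal_mul hε.le] at h9
  rw [← h6]
  exact (ENNReal.add_le_add_iff_left ENNReal.ofReal_ne_top).1 h9

end Operator

/-! ### Reflection into a cube -/

section Fold

variable {n : ℕ} {z : E n} {d : ℝ}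

/-- The reflection of the real line into the interval `[-d/2, d/2]`, near that interval. -/
noncomputable def foldReal (d t : ℝ) : ℝ := 2 * max (-(d / 2)) (min (d / 2) t) - t

theorem foldReal_cases (hd : 0 < d) (t : ℝ) :
    foldReal d t = t ∨ foldReal d t = d - t ∨ foldReal d t = -d - t := by
  unfold foldReal
  rcases le_total (d / 2) t with h | h
  · right; left; rw [min_eq_left h, max_eq_right (by linarith)]; ring
  · rw [min_eq_right h]
    rcases le_total (-(d / 2)) t with h' | h'
    · left; rw [max_eq_right h']; ring
    · right; right; rw [max_eq_left h']; ring

theorem foldReal_eq_self {t : ℝ} (ht : |t| ≤ d / 2) : foldReal d t = t := by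
  rw [abs_le] at ht
  rw [foldReal, min_eq_right ht.2, max_eq_right ht.1]; ring

theorem abs_foldReal_le {t : ℝ} (hd : 0 < d) (ht : |t| ≤ 3 * d / 2) : |foldReal d t| ≤ d / 2 := by
  rw [abs_le] at ht
  unfold foldReal
  rw [abs_le]
  rcases le_total (d / 2) t with h | h
  · rw [min_eq_left h, max_eq_right (by linarith)]
    constructor <;> linarith
  · rw [min_eq_right h]
    rcases le_total (-(d / 2)) t with h' | h'
    · rw [max_eq_right h']; constructor <;> linarith
    · rw [max_eq_left h']; constructor <;> linarith

/-- The map is twice a clipping minus the identity. Clipping is monotone and 1-Lipschitz, so an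
increment `s - t ≥ 0` is sent into `[-(s - t), s - t]`. -/
theorem abs_foldReal_sub_le (d s t : ℝ) : |foldReal d s - foldReal d t| ≤ |s - t| := by
  wlog h : t ≤ s generalizing s t
  · rw [abs_sub_comm, abs_sub_comm s]; exact this t s (le_of_not_ge h)
  have h1 : max (-(d / 2)) (min (d / 2) t) ≤ max (-(d / 2)) (min (d / 2) s) := by gcongr
  have h2 : max (-(d / 2)) (min (d / 2) s) - max (-(d / 2)) (min (d / 2) t) ≤ s - t := by
    have e1 := (abs_max_sub_max_le_max (-(d / 2)) (min (d / 2) s) (-(d / 2)) (min (d / 2) t))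
    have e2 := (abs_min_sub_min_le_max (d / 2) s (d / 2) t)
    simp only [sub_self, abs_zero, abs_nonneg, max_eq_right] at e1 e2
    rw [abs_of_nonneg (sub_nonneg.2 h)] at e2
    exact (le_abs_self _).trans (e1.trans e2)
  unfold foldReal
  rw [abs_of_nonneg (sub_nonneg.2 h), abs_le]
  constructor <;> linarith

/-- The coordinatewise reflection of a neighbourhood of a cube into the cube. -/
noncomputable def fold (z : E n) (d : ℝ) (x : E n) : E n :=
  WithLp.toLp 2 fun j => z j + foldReal d (x j - z j)

theorem norm_fold_sub_le (z : E n) (d : ℝ) (x y : E n) : ‖fold z d x - fold z d y‖ ≤ ‖x - y‖ := by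
  rw [EuclideanSpace.norm_eq, EuclideanSpace.norm_eq]
  gcongr with j
  have := abs_foldReal_sub_le d (x j - z j) (y j - z j)
  simpa [fold] using this

theorem fold_mem_cube (hd : 0 < d) {x : E n} (hx : x ∈ cube z (3 * d)) : fold z d x ∈ cube z d :=
  fun j => by simpa [fold] using abs_foldReal_le hd (hx j)

theorem fold_eq_self {x : E n} (hx : x ∈ cube z d) : fold z d x = x := by
  ext j
  simp [fold, foldReal_eq_self (hx j)]

/-- The affine maps that make up the folding map. -/
noncomputable def foldPiece (z : E n) (d : ℝ) (σ : Fin n → Option Bool) (x : E n) : E n :=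
  WithLp.toLp 2 fun j => match σ j with
    | none => x j
    | some true => (2 * z j + d) - x j
    | some false => (2 * z j - d) - x j

theorem exists_fold_eq_foldPiece (hd : 0 < d) (x : E n) : ∃ σ, fold z d x = foldPiece z d σ x := by
  have h : ∀ j, ∃ o : Option Bool, z j + foldReal d (x j - z j) = match o with
    | none => x j
    | some true => (2 * z j + d) - x j
    | some false => (2 * z j - d) - x j := fun j => by
    rcases foldReal_cases hd (x j - z j) with h | h | h
    · exact ⟨none, by simp [h]⟩
    · exact ⟨some true, by simp only [h]; ring⟩
    · exact ⟨some false, by simp only [h]; ring⟩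
  choose σ hσ using h
  exact ⟨σ, by ext j; exact hσ j⟩

theorem measurePreserving_foldPiece (z : E n) (d : ℝ) (σ : Fin n → Option Bool) :
    MeasurePreserving (foldPiece z d σ) := by
  have h : MeasurePreserving (fun (y : Fin n → ℝ) j => match σ j with
    | none => y j
    | some true => (2 * z j + d) - y j
    | some false => (2 * z j - d) - y j) := by
    refine volume_preserving_pi (f := fun j (t : ℝ) => match σ j with
      | none => t
      | some true => (2 * z j + d) - t
      | some false => (2 * z j - d) - t) fun j => ?_
    rcases σ j with _ | _ | _
    · exact MeasurePreserving.id _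
    · exact Measure.measurePreserving_sub_left volume _
    · exact Measure.measurePreserving_sub_left volume _
  exact ((PiLp.volume_preserving_toLp (Fin n)).comp h).comp (PiLp.volume_preserving_ofLp (Fin n))

/-- At each point the fold agrees with one of `3ⁿ` measure-preserving maps. Summing the nonnegative
integrand over all of them avoids cutting the domain into pieces. -/
theorem lintegral_comp_fold_le (hd : 0 < d) {G : E n → ℝ≥0∞} (hG : Measurable G) {A : Set (E n)}
    (hA : MeasurableSet A) (hAs : A ⊆ cube z (3 * d)) :
    ∫⁻ x in A, G (fold z d x) ≤ 3 ^ n * ∫⁻ x in cube z d, G x := by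
  have hQ := (isCompact_cube z d).measurableSet
  have hG' : Measurable ((cube z d).indicator G) := hG.indicator hQ
  calc ∫⁻ x in A, G (fold z d x)
      ≤ ∫⁻ x in A, ∑ σ, (cube z d).indicator G (foldPiece z d σ x) := by
        refine setLIntegral_mono' hA fun x hx => ?_
        obtain ⟨σ, hσ⟩ := exists_fold_eq_foldPiece (z := z) hd x
        rw [← indicator_of_mem (fold_mem_cube hd (hAs hx)) G, hσ]
        exact Finset.single_le_sum (f := fun σ => (cube z d).indicator G (foldPiece z d σ x))
          (fun _ _ => zero_le) (Finset.mem_univ σ)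
    _ ≤ ∫⁻ x, ∑ σ, (cube z d).indicator G (foldPiece z d σ x) := setLIntegral_le_lintegral _ _
    _ = ∑ σ : Fin n → Option Bool, ∫⁻ x in cube z d, G x := by
        have hm : ∀ σ ∈ (Finset.univ : Finset (Fin n → Option Bool)),
            Measurable fun x => (cube z d).indicator G (foldPiece z d σ x) := fun σ _ =>
          hG'.comp (measurePreserving_foldPiece z d σ).measurable
        rw [lintegral_finsetSum _ hm]
        refine Finset.sum_congr rfl fun σ _ => ?_
        rw [(measurePreserving_foldPiece z d σ).lintegral_comp hG', lintegral_indicator hQ]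
    _ = _ := by simp

end Fold

/-! ### From the criterion on cubes to the form bound -/

section LowerBound

variable {n : ℕ} {z : E n} {d : ℝ}

/-- The capacity of a sublevel set of a function that is close to a constant is small. -/
theorem capacity_sublevel_le (hd : 0 < d) {v : E n → ℝ} (hv : Differentiable ℝ v) {L : NNReal}
    (hL : LipschitzWith L v) {m : ℝ} (hm : 3 / 4 ≤ m) :
    capacity z d {x | x ∈ cube z d ∧ v x ≤ 1 / 2} ≤ n * (3 ^ n *
      (ENNReal.ofReal 32 * (∫⁻ x in openCube z d, ‖fderiv ℝ v x‖ₑ ^ 2) +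
        ENNReal.ofReal (512 / d ^ 2) * ∫⁻ x in openCube z d, ‖v x - m‖ₑ ^ 2)) := by
  have hd2 : 0 < 2 * d := by positivity
  -- This function is `1` where the folded `v` is at most `1/2` and `0` where it is at least `3/4`.
  -- Since `m ≥ 3/4`, it is dominated by `4 |v - m|`, so its own mass is controlled by the
  -- oscillation.
  set k : E n → ℝ := fun x => max 0 (min 1 (4 * (3 / 4 - v (fold z d x)))) with hk
  have hk0 : ∀ x, 0 ≤ k x := fun x => le_max_left _ _
  have hk1 : ∀ x, k x ≤ 1 := fun x => max_le zero_le_one (min_le_left _ _)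
  have hkm : ∀ x, k x ≤ 4 * |v (fold z d x) - m| := fun x => by
    refine max_le (by positivity) ((min_le_right _ _).trans ?_)
    have := neg_abs_le (v (fold z d x) - m)
    linarith
  have hkv : ∀ x y, ‖k x - k y‖ ≤ 4 * ‖v (fold z d x) - v (fold z d y)‖ := fun x y => by
    refine (abs_max_sub_max_le_max _ _ _ _).trans (max_le (by simp) ?_)
    refine (abs_min_sub_min_le_max _ _ _ _).trans (max_le (by simp) ?_)
    have : 4 * (3 / 4 - v (fold z d x)) - 4 * (3 / 4 - v (fold z d y)) =
      4 * (v (fold z d y) - v (fold z d x)) := by ring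
    rw [this, abs_mul, abs_of_pos (by norm_num : (0 : ℝ) < 4), abs_sub_comm, Real.norm_eq_abs]
  have hkL : LipschitzWith (4 * L) k := LipschitzWith.of_dist_le_mul fun x y => by
    rw [dist_eq_norm, dist_eq_norm]
    refine (hkv x y).trans ?_
    have h1 : ‖v (fold z d x) - v (fold z d y)‖ ≤ L * ‖fold z d x - fold z d y‖ := by
      simpa [dist_eq_norm] using hL.dist_le_mul (fold z d x) (fold z d y)
    have h2 := norm_fold_sub_le z d x y
    push_cast
    rw [mul_assoc]
    gcongr
    exact h1.trans (by gcongr)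
  -- The cutoff is `1` on the given cube and lives in the cube of edge `3 d / 2`, inside the region
  -- of edge `3 d` that folds into the given cube.
  set χ := cutoff z (2 * d) with hχ
  have hχL := lipschitzWith_cutoff z hd2
  have hχ1 : ∀ x, ‖χ x‖ ≤ 1 := abs_cutoff_le_one z (2 * d)
  have hk1' : ∀ x, ‖k x‖ ≤ 1 := fun x => by rw [Real.norm_of_nonneg (hk0 x)]; exact hk1 x
  have hPL := lipschitzWith_mul_of_bounded hχL hkL (M := 1) (N := 1) hχ1 hk1'
  have hχs := tsupport_cutoff_subset z hd2
  have hts : tsupport (fun x => χ x * k x) ⊆ cube z (3 * (2 * d) / 4) :=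
    (tsupport_mul_subset_left (f := χ) (g := k)).trans hχs
  have hcs : HasCompactSupport fun x => χ x * k x :=
    (isCompact_cube z _).of_isClosed_subset (isClosed_tsupport _) hts
  have hfc : Continuous (fold z d) := (LipschitzWith.of_dist_le_mul (K := 1) fun x y => by
    rw [dist_eq_norm, dist_eq_norm, NNReal.coe_one, one_mul]
    exact norm_fold_sub_le z d x y).continuous
  refine (capacity_le_of_real hPL hcs (hts.trans (cube_subset_openCube (by linarith)))
    fun x hx => ?_).trans ?_
  · have h1 : χ x = 1 := cutoff_eq_one hd2 (by convert! hx.1 using 1; congr 1; ring)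
    have h2 : k x = 1 := by
      simp only [hk, fold_eq_self hx.1]
      rw [min_eq_left (by linarith [hx.2]), max_eq_right zero_le_one]
    change χ x * k x = 1
    rw [h1, h2, one_mul]
  gcongr
  set G : E n → ℝ≥0∞ := fun y => ENNReal.ofReal 32 * ‖fderiv ℝ v y‖ₑ ^ 2 +
    ENNReal.ofReal (512 / d ^ 2) * ‖v y - m‖ₑ ^ 2 with hG
  have hvm : Measurable v := hv.continuous.measurable
  have hG1 : Measurable fun y => ENNReal.ofReal 32 * ‖fderiv ℝ v y‖ₑ ^ 2 :=
    ((measurable_fderiv ℝ v).enorm.pow_const 2).const_mul _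
  have hG2 : Measurable fun y => ENNReal.ofReal (512 / d ^ 2) * ‖v y - m‖ₑ ^ 2 :=
    ((hvm.sub_const m).enorm.pow_const 2).const_mul _
  have hA := (isCompact_cube z (3 * (2 * d) / 4)).measurableSet
  have hzero : ∀ x ∉ cube z (3 * (2 * d) / 4), ‖fderiv ℝ (fun x => χ x * k x) x‖ₑ ^ 2 = 0 :=
    fun x hx => by
      rw [fderiv_eq_zero_of_notMem_tsupport fun h => hx (hts h), enorm_sq_eq_ofReal, norm_zero]
      simp
  calc ∫⁻ x, ‖fderiv ℝ (fun x => χ x * k x) x‖ₑ ^ 2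
      = ∫⁻ x in cube z (3 * (2 * d) / 4), ‖fderiv ℝ (fun x => χ x * k x) x‖ₑ ^ 2 := by
        rw [setLIntegral_eq_of_support_subset (fun x hx => by_contra fun h => hx (hzero x h))]
    _ ≤ ∫⁻ x in cube z (3 * (2 * d) / 4), G (fold z d x) := by
        refine lintegral_mono_ae (ae_restrict_of_ae ?_)
        filter_upwards [hχL.ae_differentiableAt, hkL.ae_differentiableAt] with x hx1 hx2
        have e1 : ‖fderiv ℝ k x‖ ≤ 4 * ‖fderiv ℝ v (fold z d x)‖ :=
          norm_fderiv_le_of_local (R := fold z d) (hv _) hfc.continuousAt rfl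
            (fun x' => norm_fold_sub_le z d x' x) (by norm_num) fun x' => hkv x' x
        have e2 : ‖fderiv ℝ χ x‖ ≤ 4 / d := by
          refine (norm_fderiv_le_of_lipschitzWith hχL x).trans (le_of_eq ?_)
          rw [Real.coe_toNNReal _ (by positivity)]
          field_simp; norm_num
        have e3 : ‖fderiv ℝ (fun x => χ x * k x) x‖ ≤
            4 * ‖fderiv ℝ v (fold z d x)‖ + 4 * |v (fold z d x) - m| * (4 / d) := by
          rw [fderiv_fun_mul hx1 hx2]
          refine (norm_add_le _ _).trans (add_le_add ?_ ?_)
          · rw [norm_smul]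
            calc ‖χ x‖ * ‖fderiv ℝ k x‖ ≤ 1 * (4 * ‖fderiv ℝ v (fold z d x)‖) := by
                  gcongr; exact hχ1 x
              _ = _ := one_mul _
          · rw [norm_smul, Real.norm_of_nonneg (hk0 x)]
            gcongr
            exact hkm x
        simp only [hG]
        rw [enorm_sq_eq_ofReal, enorm_sq_eq_ofReal, enorm_sq_eq_ofReal,
          ← ENNReal.ofReal_mul (by positivity), ← ENNReal.ofReal_mul (by positivity),
          ← ENNReal.ofReal_add (by positivity) (by positivity)]
        refine ENNReal.ofReal_le_ofReal ?_
        calc ‖fderiv ℝ (fun x => χ x * k x) x‖ ^ 2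
            ≤ (4 * ‖fderiv ℝ v (fold z d x)‖ + 4 * |v (fold z d x) - m| * (4 / d)) ^ 2 := by gcongr
          _ ≤ 2 * (4 * ‖fderiv ℝ v (fold z d x)‖) ^ 2 +
              2 * (4 * |v (fold z d x) - m| * (4 / d)) ^ 2 := by
            nlinarith [sq_nonneg (4 * ‖fderiv ℝ v (fold z d x)‖ -
              4 * |v (fold z d x) - m| * (4 / d))]
          _ = _ := by rw [Real.norm_eq_abs]; field_simp; ring
    _ ≤ 3 ^ n * ∫⁻ x in cube z d, G x :=
        lintegral_comp_fold_le hd (hG1.add hG2) hA (cube_subset_cube (by linarith))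
    _ = _ := by
        rw [← setLIntegral_congr (openCube_ae_eq_cube z hd), hG, lintegral_add_left hG1,
          lintegral_const_mul' _ _ ENNReal.ofReal_ne_top,
          lintegral_const_mul' _ _ ENNReal.ofReal_ne_top]

theorem magGrad_smul {a : E n → E n} {u : E n → ℂ} {x : E n} (hu : DifferentiableAt ℝ u x) (c : ℂ)
    (j : Fin n) : magGrad a (c • u) x j = c * magGrad a u x j := by
  simp only [magGrad, partialDeriv, Pi.smul_apply, smul_eq_mul,
    fderiv_const_smul hu, _root_.smul_apply]
  ring

theorem formDensity_smul {a : E n → E n} {V : E n → ℝ} {u : E n → ℂ} {x : E n}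
    (hu : DifferentiableAt ℝ u x) (c : ℂ) :
    formDensity a V (c • u) x = ‖c‖ₑ ^ 2 * formDensity a V u x := by
  simp only [formDensity, magGrad_smul hu, Pi.smul_apply, smul_eq_mul, enorm_mul, mul_pow]
  rw [mul_add, Finset.mul_sum]
  ring

theorem exists_normalizing {A : ℝ≥0∞} (hA0 : A ≠ 0) (hA : A ≠ ⊤) {b : ℝ} (hb : 0 < b) :
    ∃ c : ℂ, c ≠ 0 ∧ ‖c‖ₑ ^ 2 * A = ENNReal.ofReal b := by
  have hpos := ENNReal.toReal_pos hA0 hA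
  refine ⟨(√(b / A.toReal) : ℝ), by
    simp only [ne_eq, Complex.ofReal_eq_zero]; positivity, ?_⟩
  rw [enorm_sq_eq_ofReal, Complex.norm_real, Real.norm_of_nonneg (Real.sqrt_nonneg _),
    Real.sq_sqrt (by positivity)]
  generalize hr : A.toReal = r at *
  have hA' : A = ENNReal.ofReal r := by rw [← hr, ENNReal.ofReal_toReal hA]
  rw [hA', ← ENNReal.ofReal_mul (by positivity)]
  congr 1
  field_simp

/-- The constant in the capacity bound for sublevel sets. -/
noncomputable def sublevelConst (n : ℕ) : ℝ := n * (3 ^ n * (32 + 512 * poincareConst n))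

theorem IsTest.lipschitz_smoothAbs {u : E n → ℂ} (hu : IsTest u) {δ : ℝ} (hδ : 0 < δ) :
    ∃ L, LipschitzWith L (smoothAbs δ u) := by
  obtain ⟨K, hK⟩ := ContDiff.lipschitzWith_of_hasCompactSupport hu.2 hu.1 (by simp)
  exact ⟨K, LipschitzWith.of_dist_le_mul fun x y => (abs_smoothAbs_sub_le hδ u x y).trans
    (by rw [← dist_eq_norm]; exact hK.dist_le_mul x y)⟩

theorem localEnergy_le {a : E n → E n} {u : E n → ℂ} (hu : ContDiffOn ℝ ∞ u (openCube z d))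
    (hm : MemLp u 2 (volume.restrict (openCube z d))) (h0 : ∃ x ∈ openCube z d, u x ≠ 0) :
    localEnergy a z d ≤ (∫⁻ x in openCube z d, ∑ j, ‖magGrad a u x j‖ₑ ^ 2) /
      ∫⁻ x in openCube z d, ‖u x‖ₑ ^ 2 := by
  have h : localEnergy a z d ≤ quadForm a (fun _ => 0) (openCube z d) u /
      ∫⁻ x in openCube z d, ‖u x‖ₑ ^ 2 :=
    iInf_le_of_le u <| iInf_le_of_le hu <| iInf_le_of_le hm <| iInf_le_of_le h0 le_rfl
  simpa [quadForm] using h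

theorem molchanov_le {c : ℝ} {V : E n → ℝ} {F : Set (E n)} (hF : IsCompact F)
    (hFs : F ⊆ cube z d) (hc : capacity z d F ≤ ENNReal.ofReal c * capacity z d (cube z d)) :
    molchanov c V z d ≤ ∫⁻ x in cube z d \ F, ENNReal.ofReal (V x) :=
  iInf_le_of_le F <| iInf_le_of_le hF <| iInf_le_of_le hFs <| iInf_le_of_le hc le_rfl

/-- The criterion in one cube implies a lower bound of the form in that cube. -/
theorem exists_local_bound (hn : 2 ≤ n) {c d₁ d : ℝ} (hc : 0 < c) (hd₁ : 0 < d₁) (hd : 0 < d) :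
    ∃ ε : ℝ, 0 < ε ∧ ∀ (a : E n → E n) (V : E n → ℝ) (z : E n),
      ENNReal.ofReal (1 / d₁ ^ 2) ≤ criterion c a V z d →
      ∀ u : E n → ℂ, IsTest u →
        ENNReal.ofReal ε * ∫⁻ x in openCube z d, ‖u x‖ₑ ^ 2 ≤ quadForm a V (cube z d) u := by
  have hP := poincareConst_pos n
  have hH := hardyConst_pos n
  have hn0 : (0 : ℝ) < n := by exact_mod_cast (by omega : 0 < n)
  have hS : 0 < sublevelConst n := by unfold sublevelConst; positivity
  -- The first bound is what `exists_mean` requires; the second makes the capacity of the sublevel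
  -- set at most `c` times the lower bound for the capacity of the cube.
  set κ := min (3 / (32 * poincareConst n)) (c / (2 * hardyConst n * sublevelConst n)) with hκ
  have hκ0 : 0 < κ := lt_min (by positivity) (by positivity)
  have hκ1 : poincareConst n * κ ≤ 3 / 32 := by
    calc poincareConst n * κ ≤ poincareConst n * (3 / (32 * poincareConst n)) := by
          gcongr; exact min_le_left _ _
      _ = _ := by field_simp
  have hκ2 : sublevelConst n * κ ≤ c * (1 / (2 * hardyConst n)) := by
    calc sublevelConst n * κ ≤ sublevelConst n * (c / (2 * hardyConst n * sublevelConst n)) := by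
          gcongr; exact min_le_right _ _
      _ = _ := by field_simp
  -- The first entry gives energy at most `κ / d²`; the second makes `9 ε < 1 / d₁²`, where `9` is
  -- `1` for the local energy plus `8` for the Molchanov term.
  set ε := min (κ / d ^ 2) (1 / (10 * d₁ ^ 2)) with hε
  have hε0 : 0 < ε := lt_min (by positivity) (by positivity)
  have hdn : 0 < d ^ n := by positivity
  refine ⟨ε, hε0, fun a V z hcrit u hu => ?_⟩
  have hG := isOpen_openCube z d
  have hGm := hG.measurableSet
  by_contra! hlt
  set A := ∫⁻ x in openCube z d, ‖u x‖ₑ ^ 2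
  have hA0 : A ≠ 0 := by rintro h; simp [h] at hlt
  have hum : MemLp u 2 volume := hu.1.continuous.memLp_of_hasCompactSupport hu.2
  have hA : A ≠ ⊤ := (MemLp.lintegral_enorm_sq_lt_top (hum.restrict _)).ne
  obtain ⟨b, hb0, hb⟩ := exists_normalizing hA0 hA hdn
  set w := b • u with hw
  have hwt : IsTest w := hu.smul b
  have hwm : MemLp w 2 volume := hwt.1.continuous.memLp_of_hasCompactSupport hwt.2
  have hwn : ∫⁻ x in openCube z d, ‖w x‖ₑ ^ 2 = ENNReal.ofReal (d ^ n) := by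
    rw [← hb, ← lintegral_const_mul' _ _ (by finiteness)]
    exact lintegral_congr fun x => by simp [hw, enorm_mul, mul_pow]
  have hwq : quadForm a V (cube z d) w ≤ ENNReal.ofReal (ε * d ^ n) := by
    have : quadForm a V (cube z d) w = ‖b‖ₑ ^ 2 * quadForm a V (cube z d) u := by
      rw [quadForm_eq, quadForm_eq, ← lintegral_const_mul' _ _ (by finiteness)]
      exact lintegral_congr fun x => formDensity_smul (hu.differentiable x) b
    rw [this, ENNReal.ofReal_mul hε0.le, ← hb]
    calc ‖b‖ₑ ^ 2 * quadForm a V (cube z d) u ≤ ‖b‖ₑ ^ 2 * (ENNReal.ofReal ε * A) := by gcongr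
      _ = _ := by ring
  have hwE : ∫⁻ x in openCube z d, ∑ j, ‖magGrad a w x j‖ₑ ^ 2 ≤ ENNReal.ofReal (ε * d ^ n) := by
    refine le_trans ?_ hwq
    rw [quadForm_eq]
    exact (lintegral_mono_set (openCube_subset_cube z d)).trans
      (lintegral_mono fun x => le_self_add)
  obtain ⟨⟨m, hm, hvm⟩, hvg⟩ := exists_mean a z hd ((hwt.1.of_le (by simp)).contDiffOn) hwn hκ0.le
    hκ1 (hwE.trans (ENNReal.ofReal_le_ofReal (by gcongr; exact min_le_left _ _)))
  set v := smoothAbs (1 / 8) w with hv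
  have h8 : (0 : ℝ) < 1 / 8 := by norm_num
  set F := {x | x ∈ cube z d ∧ v x ≤ 1 / 2} with hF
  have hvc : Continuous v := continuous_smoothAbs hwt.1.continuous
  have hFc : IsCompact F :=
    (isCompact_cube z d).inter_right (isClosed_le hvc continuous_const)
  have hcap : capacity z d F ≤ ENNReal.ofReal c * capacity z d (cube z d) := by
    obtain ⟨L, hL⟩ := hwt.lipschitz_smoothAbs h8
    refine (capacity_sublevel_le hd
      (fun x => (hasFDerivAt_smoothAbs h8 (hwt.differentiable x)).differentiableAt) hL hm).trans ?_
    refine le_trans ?_ (mul_le_mul_right (le_capacity_cube hn z hd) _)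
    calc (n : ℝ≥0∞) * (3 ^ n *
          (ENNReal.ofReal 32 * (∫⁻ x in openCube z d, ‖fderiv ℝ v x‖ₑ ^ 2) +
            ENNReal.ofReal (512 / d ^ 2) * ∫⁻ x in openCube z d, ‖v x - m‖ₑ ^ 2))
        ≤ ENNReal.ofReal n * (ENNReal.ofReal (3 ^ n) *
          (ENNReal.ofReal 32 * ENNReal.ofReal (κ / d ^ 2 * d ^ n) +
            ENNReal.ofReal (512 / d ^ 2) * ENNReal.ofReal (poincareConst n * κ * d ^ n))) := by
          rw [ENNReal.ofReal_natCast, ENNReal.ofReal_pow (by norm_num), ENNReal.ofReal_ofNat 3]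
          gcongr
      _ = ENNReal.ofReal (sublevelConst n * κ * (d ^ n / d ^ 2)) := by
          rw [← ENNReal.ofReal_mul (by positivity), ← ENNReal.ofReal_mul (by positivity),
            ← ENNReal.ofReal_add (by positivity) (by positivity),
            ← ENNReal.ofReal_mul (by positivity), ← ENNReal.ofReal_mul (by positivity)]
          congr 1
          unfold sublevelConst
          field_simp
      _ ≤ ENNReal.ofReal c * ENNReal.ofReal (1 / (2 * hardyConst n) * (d ^ n / d ^ 2)) := by
          rw [← ENNReal.ofReal_mul hc.le, ← mul_assoc]
          exact ENNReal.ofReal_le_ofReal (by gcongr)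
  have hmol : molchanov c V z d ≤ ENNReal.ofReal (8 * (ε * d ^ n)) := by
    refine (molchanov_le hFc (fun x hx => hx.1) hcap).trans ?_
    rw [ENNReal.ofReal_mul (by norm_num)]
    refine le_trans ?_ (mul_le_mul_right hwq _)
    rw [quadForm_eq, ← lintegral_const_mul' _ _ ENNReal.ofReal_ne_top]
    refine le_trans ?_ (lintegral_mono_set (sdiff_subset (t := F)))
    refine setLIntegral_mono' ((isCompact_cube z d).measurableSet.diff hFc.measurableSet)
      fun x hx => ?_
    have hvx : 1 / 2 < v x := not_le.1 fun h => hx.2 ⟨hx.1, h⟩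
    -- Off `F`, `1/8 + |w|² > 1/4`; the smoothing parameter `1/8` leaves `|w|² > 1/8`.
    have hwx : 1 ≤ 8 * ‖w x‖ ^ 2 := by
      have := smoothAbs_sq h8.le w x
      rw [← hv] at this
      nlinarith
    calc ENNReal.ofReal (V x) = ENNReal.ofReal (V x) * ENNReal.ofReal 1 := by simp
      _ ≤ ENNReal.ofReal (V x) * ENNReal.ofReal (8 * ‖w x‖ ^ 2) := by gcongr
      _ = ENNReal.ofReal 8 * (ENNReal.ofReal (V x) * ‖w x‖ₑ ^ 2) := by
        rw [enorm_sq_eq_ofReal, ENNReal.ofReal_mul (by norm_num)]; ring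
      _ ≤ _ := by
        gcongr
        exact le_add_self
  have hloc : localEnergy a z d ≤ ENNReal.ofReal ε := by
    refine (localEnergy_le hwt.1.contDiffOn (hwm.restrict _) ?_).trans ?_
    · by_contra! h
      have : ∫⁻ x in openCube z d, ‖w x‖ₑ ^ 2 = 0 := by
        rw [setLIntegral_congr_fun hGm (g := fun _ => 0) fun x hx => by simp [h x hx]]
        simp
      rw [hwn, ENNReal.ofReal_eq_zero] at this
      linarith
    · rw [hwn]
      refine ENNReal.div_le_of_le_mul ?_
      rw [← ENNReal.ofReal_mul hε0.le]
      exact hwE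
  have hfin : ENNReal.ofReal (1 / d₁ ^ 2) ≤ ENNReal.ofReal (9 * ε) := by
    refine hcrit.trans ?_
    calc criterion c a V z d
        ≤ ENNReal.ofReal ε + ENNReal.ofReal ((d ^ n)⁻¹) * ENNReal.ofReal (8 * (ε * d ^ n)) := by
          unfold criterion; gcongr
      _ = ENNReal.ofReal (9 * ε) := by
          rw [← ENNReal.ofReal_mul (by positivity), ← ENNReal.ofReal_add hε0.le (by positivity)]
          congr 1
          field_simp
          ring
  rw [ENNReal.ofReal_le_ofReal_iff (by positivity)] at hfin
  have hεd : ε ≤ 1 / (10 * d₁ ^ 2) := min_le_right _ _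
  have : 1 / (10 * d₁ ^ 2) = 1 / d₁ ^ 2 / 10 := by rw [div_div, mul_comm]
  have : 0 < 1 / d₁ ^ 2 := by positivity
  linarith

/-- Averaging over all translates of a cube. -/
theorem lintegral_lintegral_translates {S : E n → Set (E n)}
    (hS : MeasurableSet {p : E n × E n | p.2 ∈ S p.1}) (hsymm : ∀ x y, x ∈ S y ↔ y ∈ S x)
    {b : ℝ≥0∞} (hb : ∀ z, volume (S z) = b) {f : E n → ℝ≥0∞} (hf : AEMeasurable f volume) :
    ∫⁻ z, ∫⁻ x in S z, f x = b * ∫⁻ x, f x := by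
  have hSz : ∀ z, MeasurableSet (S z) := fun z => hS.preimage (measurable_prodMk_left (x := z))
  calc ∫⁻ z, ∫⁻ x in S z, f x = ∫⁻ z, ∫⁻ x, (S z).indicator f x := by
        simp only [lintegral_indicator (hSz _)]
    _ = ∫⁻ x, ∫⁻ z, (S z).indicator f x := by
        refine lintegral_lintegral_swap ?_
        have : AEMeasurable (fun p : E n × E n => f p.2) (volume.prod volume) := hf.comp_snd
        refine (this.indicator hS).congr (Eventually.of_forall fun p => ?_)
        simp [Set.indicator, Function.uncurry]
    _ = ∫⁻ x, b * f x := by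
        refine lintegral_congr fun x => ?_
        have : ∀ z, (S z).indicator f x = (S x).indicator (fun _ => f x) z := fun z => by
          by_cases h : x ∈ S z
          · rw [indicator_of_mem h, indicator_of_mem ((hsymm x z).1 h)]
          · rw [indicator_of_notMem h, indicator_of_notMem fun h' => h ((hsymm x z).2 h')]
        simp only [this, lintegral_indicator (hSz x), setLIntegral_const, hb, mul_comm]
    _ = _ := lintegral_const_mul'' _ hf

theorem measurableSet_openCube_prod (d : ℝ) :
    MeasurableSet {p : E n × E n | p.2 ∈ openCube p.1 d} := by
  have h : {p : E n × E n | p.2 ∈ openCube p.1 d} =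
      ⋂ j, {p : E n × E n | |p.2 j - p.1 j| < d / 2} := by
    ext p; simp [openCube]
  rw [h]
  refine MeasurableSet.iInter fun j => (isOpen_lt ?_ continuous_const).measurableSet
  fun_prop

/-- Every point lies in translates whose centers fill a set of measure `dⁿ`. Averaging over centers
therefore multiplies both sides by `dⁿ`, and no tiling of space is needed. -/
theorem formBound_of_local {a : E n → E n} {V : E n → ℝ} {ε d : ℝ} (hd : 0 < d) (ha : L2loc a)
    (hV : LocallyIntegrable V volume)
    (h : ∀ z u, IsTest u →
      ENNReal.ofReal ε * ∫⁻ x in openCube z d, ‖u x‖ₑ ^ 2 ≤ quadForm a V (cube z d) u) :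
    FormBound a V ε := by
  intro u hu
  have hsymm : ∀ x y : E n, x ∈ openCube y d ↔ y ∈ openCube x d := fun x y =>
    forall_congr' fun j => by rw [abs_sub_comm]
  have hav := fun {f : E n → ℝ≥0∞} (hf : AEMeasurable f volume) =>
    lintegral_lintegral_translates (measurableSet_openCube_prod d) hsymm
      (fun z => volume_openCube z hd) hf
  have hum : AEMeasurable (fun x => ‖u x‖ₑ ^ 2) volume :=
    (hu.1.continuous.enorm.measurable.pow_const 2).aemeasurable
  have hdm := aemeasurable_formDensity (a := a) (V := V) (u := u) ha
    hV.aestronglyMeasurable.aemeasurable hu.1.continuous.aestronglyMeasurable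
  have hint : ENNReal.ofReal (d ^ n) * (ENNReal.ofReal ε * ∫⁻ x, ‖u x‖ₑ ^ 2) ≤
      ENNReal.ofReal (d ^ n) * quadForm a V univ u := by
    rw [quadForm_eq, Measure.restrict_univ, ← hav hdm, mul_left_comm, ← hav hum,
      ← lintegral_const_mul' _ _ ENNReal.ofReal_ne_top]
    refine lintegral_mono fun z => (h z u hu).trans (le_of_eq ?_)
    rw [quadForm_eq, setLIntegral_congr (openCube_ae_eq_cube z hd)]
  exact (ENNReal.mul_le_mul_iff_right (by simp; positivity) ENNReal.ofReal_ne_top).1 hint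

end LowerBound

/-! ### From the form bound to the criterion on large cubes -/

section Necessity

variable {n : ℕ} {z : E n} {d : ℝ}

theorem convex_cube (z : E n) (d : ℝ) : Convex ℝ (cube z d) := by
  rw [cube_eq_preimage]
  exact (convex_Icc _ _).linear_preimage (EuclideanSpace.equiv (Fin n) ℝ).toLinearMap

theorem exists_lipschitzOnWith_of_contDiffOn {G S : Set (E n)} (hG : IsOpen G) (hS : IsCompact S)
    (hSc : Convex ℝ S) (hSG : S ⊆ G) {w : E n → ℂ} (hw : ContDiffOn ℝ 1 w G) :
    ∃ L, LipschitzOnWith L w S := by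
  obtain ⟨C, hC⟩ := hS.exists_bound_of_continuousOn
    ((hw.continuousOn_fderiv_of_isOpen hG le_rfl).mono hSG)
  refine ⟨C.toNNReal, hSc.lipschitzOnWith_of_nnnorm_fderiv_le (𝕜 := ℝ) (fun x hx =>
    (hw.contDiffAt (hG.mem_nhds (hSG hx))).differentiableAt one_ne_zero) fun x hx => ?_⟩
  rw [← NNReal.coe_le_coe, coe_nnnorm]
  exact (hC x hx).trans (Real.le_coe_toNNReal C)

/-- If `y ∉ S`, the increment is `(ζ x - ζ y) w x`, so only the bound on `w` is used there. This
matters because `u` is regular only inside the open cube and arbitrary elsewhere. -/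
theorem lipschitzWith_mul_of_eq_zero_off {S : Set (E n)} {w ζ : E n → ℂ} {K L : NNReal}
    (hw : LipschitzOnWith L w S) (hζ : LipschitzWith K ζ) (hw1 : ∀ x, ‖w x‖ ≤ 1)
    (hζ1 : ∀ x, ‖ζ x‖ ≤ 1) (hS : ∀ x ∉ S, ζ x = 0) :
    LipschitzWith (K + L) fun x => ζ x * w x := by
  have hζ' : ∀ x y, ‖ζ x - ζ y‖ ≤ K * ‖x - y‖ := fun x y => by
    simpa [dist_eq_norm] using hζ.dist_le_mul x y
  have hout : ∀ x y, y ∉ S → ‖ζ x * w x - ζ y * w y‖ ≤ (K + L : ℝ) * ‖x - y‖ := fun x y hy => by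
    have h : ζ x * w x - ζ y * w y = (ζ x - ζ y) * w x := by rw [hS y hy]; ring
    rw [h, norm_mul]
    calc ‖ζ x - ζ y‖ * ‖w x‖ ≤ (K * ‖x - y‖) * 1 := by
          gcongr
          · exact hζ' x y
          · exact hw1 x
      _ ≤ _ := by
          have : 0 ≤ (L : ℝ) * ‖x - y‖ := by positivity
          linarith
  refine LipschitzWith.of_dist_le_mul fun x y => ?_
  rw [dist_eq_norm, dist_eq_norm, NNReal.coe_add]
  by_cases hy : y ∈ S
  · by_cases hx : x ∈ S
    · have h : ζ x * w x - ζ y * w y = (ζ x - ζ y) * w x + ζ y * (w x - w y) := by ring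
      have h2 : ‖w x - w y‖ ≤ L * ‖x - y‖ := by
        simpa [dist_eq_norm] using hw.dist_le_mul x hx y hy
      rw [h]
      refine (norm_add_le _ _).trans ?_
      rw [norm_mul, norm_mul]
      calc ‖ζ x - ζ y‖ * ‖w x‖ + ‖ζ y‖ * ‖w x - w y‖
          ≤ (K * ‖x - y‖) * 1 + 1 * (L * ‖x - y‖) := by
            gcongr
            · exact hζ' x y
            · exact hw1 x
            · exact hζ1 y
        _ = _ := by ring
    · rw [norm_sub_rev, norm_sub_rev x]
      exact hout y x hx
  · exact hout x y hy

/-- If the local energy is small, it is almost attained by a normalized function. -/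
theorem exists_normalized_of_localEnergy_lt (a : E n → E n) (hd : 0 < d) {κ : ℝ} (hκ : 0 < κ)
    (h : localEnergy a z d < ENNReal.ofReal κ) :
    ∃ u : E n → ℂ, ContDiffOn ℝ ∞ u (openCube z d) ∧
      ∫⁻ x in openCube z d, ‖u x‖ₑ ^ 2 = ENNReal.ofReal (d ^ n) ∧
      ∫⁻ x in openCube z d, ∑ j, ‖magGrad a u x j‖ₑ ^ 2 ≤ ENNReal.ofReal (κ * d ^ n) := by
  have hG := isOpen_openCube z d
  unfold localEnergy neumannBottom at h
  simp only [iInf_lt_iff] at h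
  obtain ⟨u, hu, hm, ⟨x₀, hx₀, hux₀⟩, hlt⟩ := h
  have hdiff : ∀ x ∈ openCube z d, DifferentiableAt ℝ u x := fun x hx =>
    (hu.contDiffAt (hG.mem_nhds hx)).differentiableAt (by simp)
  set A := ∫⁻ x in openCube z d, ‖u x‖ₑ ^ 2 with hA
  have hA1 : A ≠ ⊤ := (MemLp.lintegral_enorm_sq_lt_top hm).ne
  -- By continuity `u` is nonzero on a nonempty open subset of the cube, which has positive measure.
  have hA0 : A ≠ 0 := by
    intro h0
    have hmeas : AEMeasurable (fun x => ‖u x‖ₑ ^ 2) (volume.restrict (openCube z d)) :=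
      hm.1.enorm.pow_const 2
    rw [hA, lintegral_eq_zero_iff' hmeas] at h0
    have hU : IsOpen (openCube z d ∩ u ⁻¹' {0}ᶜ) :=
      hu.continuousOn.isOpen_inter_preimage hG isOpen_compl_singleton
    have hpos := hU.measure_pos volume ⟨x₀, hx₀, hux₀⟩
    rw [EventuallyEq, ae_restrict_iff' hG.measurableSet] at h0
    refine hpos.ne' (measure_mono_null (fun x hx => ?_) (ae_iff.1 h0))
    intro hx'
    have := hx' hx.1
    simp only [Pi.zero_apply, ne_eq, OfNat.ofNat_ne_zero, not_false_eq_true, pow_eq_zero_iff,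
      enorm_eq_zero] at this
    exact hx.2 this
  obtain ⟨b, hb0, hb⟩ := exists_normalizing hA0 hA1 (by positivity : 0 < d ^ n)
  refine ⟨b • u, contDiffOn_const.smul hu, ?_, ?_⟩
  · rw [← hb, hA, ← lintegral_const_mul' _ _ (by finiteness)]
    exact lintegral_congr fun x => by simp [enorm_mul, mul_pow]
  · rw [ENNReal.div_lt_iff (Or.inl hA0) (Or.inl hA1)] at hlt
    rw [ENNReal.ofReal_mul hκ.le, ← hb]
    calc ∫⁻ x in openCube z d, ∑ j, ‖magGrad a (b • u) x j‖ₑ ^ 2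
        = ∫⁻ x in openCube z d, ‖b‖ₑ ^ 2 * formDensity a (fun _ => 0) u x := by
          refine setLIntegral_congr_fun hG.measurableSet fun x hx => ?_
          rw [← formDensity_smul (hdiff x hx)]
          simp [formDensity]
      _ = ‖b‖ₑ ^ 2 * quadForm a (fun _ => 0) (openCube z d) u := by
          rw [lintegral_const_mul' _ _ (by finiteness), quadForm_eq]
      _ ≤ ‖b‖ₑ ^ 2 * (ENNReal.ofReal κ * A) := by gcongr
      _ = _ := by ring

variable {a : E n → E n} {V : E n → ℝ} {u : E n → ℂ} {P : E n → ℝ} {x : E n}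

/-- The test function built from a function `u` on a cube and a capacity potential `P`. -/
noncomputable def trial (z : E n) (d : ℝ) (P : E n → ℝ) (u : E n → ℂ) (x : E n) : ℂ :=
  ((cutoff z d x * (1 - P x) : ℝ) : ℂ) * truncate u x

theorem norm_trial_le_one (hP0 : ∀ x, 0 ≤ P x) (hP1 : ∀ x, P x ≤ 1) (x : E n) :
    ‖trial z d P u x‖ ≤ 1 := by
  rw [trial, norm_mul, Complex.norm_real, Real.norm_eq_abs, abs_mul]
  have h2 : |1 - P x| ≤ 1 := abs_le.2 ⟨by linarith [hP1 x], by linarith [hP0 x]⟩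
  exact mul_le_one₀ (mul_le_one₀ (abs_cutoff_le_one z d x) (abs_nonneg _) h2) (norm_nonneg _)
    (norm_truncate_le_one u x)

theorem exists_lipschitzWith_trial (hd : 0 < d) {K : NNReal} (hP : LipschitzWith K P)
    (hP0 : ∀ x, 0 ≤ P x) (hP1 : ∀ x, P x ≤ 1) (hu : ContDiffOn ℝ 1 u (openCube z d)) :
    ∃ L, LipschitzWith L (trial z d P u) := by
  have hS := isCompact_cube z (3 * d / 4)
  obtain ⟨L, hL⟩ := exists_lipschitzOnWith_of_contDiffOn (isOpen_openCube z d) hS (convex_cube _ _)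
    (cube_subset_openCube (by linarith)) (contDiffOn_truncate hu)
  have hQ : LipschitzWith K fun x => 1 - P x := LipschitzWith.of_dist_le_mul fun x y => by
    rw [Real.dist_eq, sub_sub_sub_cancel_left, abs_sub_comm, ← Real.dist_eq]
    exact hP.dist_le_mul x y
  have hQ1 : ∀ x, ‖1 - P x‖ ≤ (1 : NNReal) := fun x => by
    rw [NNReal.coe_one, Real.norm_eq_abs]
    exact abs_le.2 ⟨by linarith [hP1 x], by linarith [hP0 x]⟩
  have hζ := lipschitzWith_mul_of_bounded (lipschitzWith_cutoff z hd) hQ (M := 1) (N := 1)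
    (abs_cutoff_le_one z d) hQ1
  have hζ' := Complex.isometry_ofReal.lipschitz.comp hζ
  refine ⟨_, lipschitzWith_mul_of_eq_zero_off hL hζ' (norm_truncate_le_one u) (fun x => ?_)
    fun x hx => ?_⟩
  · simp only [Complex.norm_real, norm_mul]
    exact mul_le_one₀ (abs_cutoff_le_one z d x) (norm_nonneg _) (hQ1 x)
  · simp [cutoff_eq_zero hd hx]

theorem tsupport_trial_subset (hd : 0 < d) : tsupport (trial z d P u) ⊆ cube z (3 * d / 4) :=
  closure_minimal (fun x hx => by_contra fun h => hx (by simp [trial, cutoff_eq_zero hd h]))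
    (isCompact_cube _ _).isClosed

/-- By the Leibniz rule each component is at most `2 |(∇ₐ u)_j| + 8 / d + |∇P|`: the cutoff, `1 - P`
and the truncated function are all bounded by `1`. Without truncation the derivative terms would
carry a factor `|u|`. -/
theorem sum_norm_magGrad_trial_sq_le (hd : 0 < d) (hP0 : ∀ x, 0 ≤ P x) (hP1 : ∀ x, P x ≤ 1)
    (hu : DifferentiableAt ℝ u x) (ht : DifferentiableAt ℝ (truncate u) x)
    (hη : DifferentiableAt ℝ (cutoff z d) x) (hP : DifferentiableAt ℝ P x) :
    ∑ j, ‖magGrad a (trial z d P u) x j‖ ^ 2 ≤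
      8 * ∑ j, ‖magGrad a u x j‖ ^ 2 + 256 * n / d ^ 2 + 4 * n * ‖fderiv ℝ P x‖ ^ 2 := by
  have hζ : DifferentiableAt ℝ (fun y => cutoff z d y * (1 - P y)) x :=
    hη.mul ((differentiableAt_const _).sub hP)
  have hζc : DifferentiableAt ℝ (fun y => ((cutoff z d y * (1 - P y) : ℝ) : ℂ)) x :=
    Complex.ofRealCLM.differentiableAt.comp x hζ
  have hQ : |1 - P x| ≤ 1 := abs_le.2 ⟨by linarith [hP1 x], by linarith [hP0 x]⟩
  have hη1 := abs_cutoff_le_one z d x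
  have hDη : ‖fderiv ℝ (cutoff z d) x‖ ≤ 8 / d := by
    have := norm_fderiv_le_of_lipschitzWith (lipschitzWith_cutoff z hd) x
    rwa [Real.coe_toNNReal _ (by positivity)] at this
  have hDζ : ‖fderiv ℝ (fun y => cutoff z d y * (1 - P y)) x‖ ≤ 8 / d + ‖fderiv ℝ P x‖ := by
    have hsub : DifferentiableAt ℝ (fun y => 1 - P y) x := (differentiableAt_const _).sub hP
    rw [fderiv_fun_mul hη hsub, fderiv_const_sub]
    refine (norm_add_le _ _).trans ?_
    rw [norm_smul, norm_smul, norm_neg, Real.norm_eq_abs, Real.norm_eq_abs, add_comm]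
    refine add_le_add ((mul_le_of_le_one_left (norm_nonneg _) hQ).trans hDη)
      (mul_le_of_le_one_left (norm_nonneg _) hη1)
  have hj : ∀ j, ‖magGrad a (trial z d P u) x j‖ ^ 2 ≤ 8 * ‖magGrad a u x j‖ ^ 2 +
      2 * (8 / d + ‖fderiv ℝ P x‖) ^ 2 := fun j => by
    have e : ‖magGrad a (trial z d P u) x j‖ ≤
        2 * ‖magGrad a u x j‖ + (8 / d + ‖fderiv ℝ P x‖) := by
      change ‖magGrad a (fun y => ((cutoff z d y * (1 - P y) : ℝ) : ℂ) * truncate u y) x j‖ ≤ _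
      rw [magGrad_mul hζc ht, partialDeriv_ofReal hζ]
      refine (norm_add_le _ _).trans (add_le_add ?_ ?_)
      · rw [norm_mul, Complex.norm_real, norm_mul, Real.norm_eq_abs, Real.norm_eq_abs]
        exact (mul_le_of_le_one_left (norm_nonneg _) (mul_le_one₀ hη1 (abs_nonneg _) hQ)).trans
          (norm_magGrad_truncate_le a hu j)
      · rw [norm_mul, Complex.norm_real]
        exact (mul_le_of_le_one_left (norm_nonneg _) (norm_truncate_le_one u x)).trans
          ((norm_map_single_le _ _).trans hDζ)
    calc ‖magGrad a (trial z d P u) x j‖ ^ 2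
        ≤ (2 * ‖magGrad a u x j‖ + (8 / d + ‖fderiv ℝ P x‖)) ^ 2 := by gcongr
      _ ≤ _ := by nlinarith [sq_nonneg (2 * ‖magGrad a u x j‖ - (8 / d + ‖fderiv ℝ P x‖))]
  have hsq : (8 / d + ‖fderiv ℝ P x‖) ^ 2 ≤ 128 / d ^ 2 + 2 * ‖fderiv ℝ P x‖ ^ 2 := by
    have : 128 / d ^ 2 = 2 * (8 / d) ^ 2 := by field_simp; norm_num
    rw [this]
    nlinarith [sq_nonneg (8 / d - ‖fderiv ℝ P x‖)]
  calc ∑ j, ‖magGrad a (trial z d P u) x j‖ ^ 2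
      ≤ ∑ j, (8 * ‖magGrad a u x j‖ ^ 2 + 2 * (128 / d ^ 2 + 2 * ‖fderiv ℝ P x‖ ^ 2)) :=
        Finset.sum_le_sum fun j _ => (hj j).trans (by gcongr)
    _ = _ := by
        rw [Finset.sum_add_distrib, ← Finset.mul_sum]
        simp
        ring

/-- The energy of the trial function. -/
theorem quadForm_trial_le (hd : 0 < d) (hV : LocallyIntegrable V volume) {K : NNReal}
    (hP : LipschitzWith K P) (hP0 : ∀ x, 0 ≤ P x) (hP1 : ∀ x, P x ≤ 1) {F : Set (E n)}
    (hF : IsCompact F) (hPF : ∀ x ∈ F, P x = 1) (hu : ContDiffOn ℝ 1 u (openCube z d)) :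
    quadForm a V univ (trial z d P u) ≤
      ENNReal.ofReal 8 * (∫⁻ x in openCube z d, ∑ j, ‖magGrad a u x j‖ₑ ^ 2) +
        ENNReal.ofReal (256 * n / d ^ 2 * d ^ n) +
        ENNReal.ofReal (4 * n) * (∫⁻ x, ‖fderiv ℝ P x‖ₑ ^ 2) +
        ∫⁻ x in cube z d \ F, ENNReal.ofReal (V x) := by
  have hG := isOpen_openCube z d
  have hts : tsupport (trial z d P u) ⊆ openCube z d :=
    (tsupport_trial_subset hd).trans (cube_subset_openCube (by linarith))
  have hVm : AEMeasurable (Fᶜ.indicator fun x => ENNReal.ofReal (V x)) volume :=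
    hV.aestronglyMeasurable.aemeasurable.ennreal_ofReal.indicator hF.measurableSet.compl
  have hDm : Measurable fun x => ENNReal.ofReal (4 * n) * ‖fderiv ℝ P x‖ₑ ^ 2 :=
    ((measurable_fderiv ℝ P).enorm.pow_const 2).const_mul _
  have hsupp : Function.support (formDensity a V (trial z d P u)) ⊆ openCube z d := fun x hx =>
    hts (by_contra fun h => hx (formDensity_eq_zero h))
  have htd : ContDiffOn ℝ 1 (truncate u) (openCube z d) := contDiffOn_truncate hu
  calc quadForm a V univ (trial z d P u)
      = ∫⁻ x in openCube z d, formDensity a V (trial z d P u) x := by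
        rw [quadForm_eq, Measure.restrict_univ, setLIntegral_eq_of_support_subset hsupp]
    _ ≤ ∫⁻ x in openCube z d, (((ENNReal.ofReal 8 * ∑ j, ‖magGrad a u x j‖ₑ ^ 2 +
          ENNReal.ofReal (256 * n / d ^ 2)) + ENNReal.ofReal (4 * n) * ‖fderiv ℝ P x‖ₑ ^ 2) +
          Fᶜ.indicator (fun x => ENNReal.ofReal (V x)) x) := by
        refine lintegral_mono_ae ?_
        filter_upwards [ae_restrict_mem hG.measurableSet,
          ae_restrict_of_ae (lipschitzWith_cutoff z hd).ae_differentiableAt,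
          ae_restrict_of_ae hP.ae_differentiableAt] with x hx hη hPx
        refine add_le_add ?_ ?_
        · rw [sum_enorm_sq_eq_ofReal, sum_enorm_sq_eq_ofReal, enorm_sq_eq_ofReal,
            ← ENNReal.ofReal_mul (by positivity), ← ENNReal.ofReal_mul (by positivity),
            ← ENNReal.ofReal_add (by positivity) (by positivity),
            ← ENNReal.ofReal_add (by positivity) (by positivity)]
          exact ENNReal.ofReal_le_ofReal (sum_norm_magGrad_trial_sq_le hd hP0 hP1
            ((hu.contDiffAt (hG.mem_nhds hx)).differentiableAt one_ne_zero)
            ((htd.contDiffAt (hG.mem_nhds hx)).differentiableAt one_ne_zero) hη hPx)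
        -- On `F` the factor `1 - P` vanishes; off `F` the trial function is at most `1` in modulus,
        -- so only `∫_{Q \ F} V` remains.
        · by_cases hxF : x ∈ F
          · simp [trial, hPF x hxF]
          · rw [indicator_of_mem (by exact hxF)]
            refine mul_le_of_le_one_right' ?_
            rw [enorm_sq_eq_ofReal, ENNReal.ofReal_le_one]
            exact pow_le_one₀ (norm_nonneg _) (norm_trial_le_one hP0 hP1 x)
    _ = ENNReal.ofReal 8 * (∫⁻ x in openCube z d, ∑ j, ‖magGrad a u x j‖ₑ ^ 2) +
          ENNReal.ofReal (256 * n / d ^ 2 * d ^ n) +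
          ENNReal.ofReal (4 * n) * (∫⁻ x in openCube z d, ‖fderiv ℝ P x‖ₑ ^ 2) +
          ∫⁻ x in openCube z d, Fᶜ.indicator (fun x => ENNReal.ofReal (V x)) x := by
        rw [lintegral_add_right' _ hVm.restrict, lintegral_add_right _ hDm,
          lintegral_add_right _ measurable_const, lintegral_const_mul' _ _ ENNReal.ofReal_ne_top,
          lintegral_const_mul' _ _ ENNReal.ofReal_ne_top, setLIntegral_const,
          volume_openCube z hd, ← ENNReal.ofReal_mul (by positivity)]
    _ ≤ _ := by
        refine add_le_add (add_le_add le_rfl (mul_le_mul_right (setLIntegral_le_lintegral _ _) _)) ?_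
        rw [setLIntegral_indicator hF.measurableSet.compl]
        exact lintegral_mono_set fun x hx => ⟨openCube_subset_cube z d hx.2, hx.1⟩

/-- A lower bound for the mass of the trial function. -/
theorem le_lintegral_trial (hd : 0 < d) {K : NNReal} (hP : LipschitzWith K P)
    (hP0 : ∀ x, 0 ≤ P x) (hP1 : ∀ x, P x ≤ 1) (hu : ContDiffOn ℝ 1 u (openCube z d)) {m : ℝ}
    (hm : 3 / 4 ≤ m) :
    ENNReal.ofReal ((d / 2) ^ n) ≤ ENNReal.ofReal 36 * (∫⁻ x, ‖trial z d P u x‖ₑ ^ 2) +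
      ENNReal.ofReal 4 * (∫⁻ x in cube z d, ‖P x‖ₑ ^ 2) +
      ENNReal.ofReal 16 * ∫⁻ x in openCube z d, ‖smoothAbs (1 / 8) u x - m‖ₑ ^ 2 := by
  have h8 : (0 : ℝ) < 1 / 8 := by norm_num
  obtain ⟨L, hL⟩ := exists_lipschitzWith_trial hd hP hP0 hP1 hu
  have htm : Measurable fun x => ENNReal.ofReal 36 * ‖trial z d P u x‖ₑ ^ 2 :=
    (hL.continuous.enorm.measurable.pow_const 2).const_mul _
  have hPm : Measurable fun x => ENNReal.ofReal 4 * ‖P x‖ₑ ^ 2 :=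
    (hP.continuous.enorm.measurable.pow_const 2).const_mul _
  have hQ := (isCompact_cube z (d / 2)).measurableSet
  have hsub : cube z (d / 2) ⊆ openCube z d := cube_subset_openCube (by linarith)
  calc ENNReal.ofReal ((d / 2) ^ n) = ∫⁻ _ in cube z (d / 2), 1 := by
        rw [setLIntegral_one, volume_cube z (by positivity)]
    _ ≤ ∫⁻ x in cube z (d / 2), ((ENNReal.ofReal 36 * ‖trial z d P u x‖ₑ ^ 2 +
          ENNReal.ofReal 4 * ‖P x‖ₑ ^ 2) +
          ENNReal.ofReal 16 * ‖smoothAbs (1 / 8) u x - m‖ₑ ^ 2) := by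
        refine setLIntegral_mono' hQ fun x hx => ?_
        rw [enorm_sq_eq_ofReal, enorm_sq_eq_ofReal, enorm_sq_eq_ofReal,
          ← ENNReal.ofReal_mul (by positivity), ← ENNReal.ofReal_mul (by positivity),
          ← ENNReal.ofReal_mul (by positivity), ← ENNReal.ofReal_add (by positivity)
          (by positivity), ← ENNReal.ofReal_add (by positivity) (by positivity),
          ENNReal.one_le_ofReal]
        have n1 : 0 ≤ ‖trial z d P u x‖ ^ 2 := by positivity
        have n2 : 0 ≤ ‖P x‖ ^ 2 := by positivity
        have n3 : 0 ≤ ‖smoothAbs (1 / 8) u x - m‖ ^ 2 := by positivity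
        rw [Real.norm_eq_abs, sq_abs] at n2 n3 ⊢
        rw [Real.norm_eq_abs, sq_abs]
        -- If `P ≥ 1/2`, the term `4 P²` suffices. If the smoothed modulus is at most `1/2`, it is
        -- `1/4` away from `m`, and `16 (s - m)²` suffices. Otherwise `|u|² ≥ 1/8`, and the trial
        -- function has square at least `(1/4)(1/9) = 1/36`.
        rcases le_total (1 / 2) (P x) with h1 | h1
        · nlinarith
        rcases le_total (smoothAbs (1 / 8) u x) (1 / 2) with h2 | h2
        · nlinarith
        have h3 : 1 / 8 ≤ ‖u x‖ ^ 2 := by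
          have := smoothAbs_sq h8.le u x
          nlinarith
        have h4 : 1 / 9 ≤ ‖truncate u x‖ ^ 2 := by
          rw [norm_truncate_sq, div_le_div_iff₀ (by norm_num) (by positivity)]
          linarith
        have h5 : ‖trial z d P u x‖ ^ 2 = (1 - P x) ^ 2 * ‖truncate u x‖ ^ 2 := by
          rw [trial, cutoff_eq_one hd hx, one_mul, norm_mul, Complex.norm_real, mul_pow,
            Real.norm_eq_abs, sq_abs]
        have h6 : 1 / 4 ≤ (1 - P x) ^ 2 := by nlinarith
        have h7 : 1 / 4 * (1 / 9) ≤ (1 - P x) ^ 2 * ‖truncate u x‖ ^ 2 := by gcongr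
        rw [h5] at n1 ⊢
        linarith
    _ = ENNReal.ofReal 36 * (∫⁻ x in cube z (d / 2), ‖trial z d P u x‖ₑ ^ 2) +
          ENNReal.ofReal 4 * (∫⁻ x in cube z (d / 2), ‖P x‖ₑ ^ 2) +
          ENNReal.ofReal 16 * ∫⁻ x in cube z (d / 2), ‖smoothAbs (1 / 8) u x - m‖ₑ ^ 2 := by
        have hs : Measurable fun x => ENNReal.ofReal 36 * ‖trial z d P u x‖ₑ ^ 2 +
            ENNReal.ofReal 4 * ‖P x‖ₑ ^ 2 := htm.add hPm
        rw [lintegral_add_left hs, lintegral_add_left htm,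
          lintegral_const_mul' _ _ ENNReal.ofReal_ne_top,
          lintegral_const_mul' _ _ ENNReal.ofReal_ne_top,
          lintegral_const_mul' _ _ ENNReal.ofReal_ne_top]
    _ ≤ _ := by
        gcongr
        · exact Measure.restrict_le_self
        · exact cube_subset_cube (by linarith)

/-- The constant `c_n` of the criterion. -/
noncomputable def capRatio (n : ℕ) : ℝ := 1 / (32 * 2 ^ n * hardyConst n * (capConst n + 1))

/-- The constant `c̃_n` of the criterion. -/
noncomputable def energyRatio (n : ℕ) : ℝ := 1 / (64 * 2 ^ n * poincareConst n)

theorem capConst_nonneg (n : ℕ) : 0 ≤ capConst n := by unfold capConst; positivity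

theorem capRatio_pos (n : ℕ) : 0 < capRatio n := by
  have := hardyConst_pos n
  have := capConst_nonneg n
  unfold capRatio; positivity

theorem capRatio_lt_one (n : ℕ) : capRatio n < 1 := by
  have h1 : 4 ≤ hardyConst n := by unfold hardyConst; linarith [(Nat.cast_nonneg n : (0 : ℝ) ≤ n)]
  have h2 := capConst_nonneg n
  have h3 : (1 : ℝ) ≤ 2 ^ n := one_le_pow₀ (by norm_num)
  rw [capRatio, div_lt_one (by positivity)]
  calc (1 : ℝ) < 32 * 1 * 4 * (0 + 1) := by norm_num
    _ ≤ _ := by gcongr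

theorem energyRatio_pos (n : ℕ) : 0 < energyRatio n := by
  have := poincareConst_pos n
  unfold energyRatio; positivity

/-- A form bound implies the criterion on all large cubes. -/
theorem FormBound.exists_criterion (hn : 2 ≤ n) {ε : ℝ} (hε : 0 < ε) (ha : L2loc a)
    (hV : LocallyIntegrable V volume) (h : FormBound a V ε) :
    ∃ d₂ : ℝ, 0 < d₂ ∧ ∀ d, d₂ < d → ∀ z,
      ENNReal.ofReal (energyRatio n / d ^ 2) ≤ criterion (capRatio n) a V z d := by
  have hP := poincareConst_pos n
  have hH := hardyConst_pos n
  have hC := capConst_nonneg n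
  have hr := capRatio_pos n
  have he := energyRatio_pos n
  -- The energy of the trial function in units of `d^{n-2}`: `8 + 1` copies of the energy ratio for
  -- the magnetic energy and the potential, then the gradients of the cutoff and of `P`.
  set B : ℝ := 9 * energyRatio n + 256 * n + 4 * n * (2 * capRatio n * (capConst n + 1)) with hB
  have hB0 : 0 < B := by positivity
  refine ⟨√(72 * 2 ^ n * B / ε), by positivity, fun d hd₂ z => ?_⟩
  have hd : 0 < d := (Real.sqrt_nonneg _).trans_lt hd₂
  have hdsq : 72 * 2 ^ n * B / ε < d ^ 2 := (Real.sqrt_lt' hd).1 hd₂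
  have hdn : 0 < d ^ n := by positivity
  by_contra! hlt
  have hloc : localEnergy a z d < ENNReal.ofReal (energyRatio n / d ^ 2) :=
    lt_of_le_of_lt le_self_add hlt
  have hmol : molchanov (capRatio n) V z d < ENNReal.ofReal (energyRatio n / d ^ 2 * d ^ n) := by
    have h1 : ENNReal.ofReal ((d ^ n)⁻¹) * molchanov (capRatio n) V z d <
        ENNReal.ofReal (energyRatio n / d ^ 2) := lt_of_le_of_lt le_add_self hlt
    have h2 : ENNReal.ofReal (energyRatio n / d ^ 2) =
        ENNReal.ofReal ((d ^ n)⁻¹) * ENNReal.ofReal (energyRatio n / d ^ 2 * d ^ n) := by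
      rw [← ENNReal.ofReal_mul (by positivity)]
      congr 1; field_simp
    rw [h2] at h1
    exact lt_of_mul_lt_mul_left' h1
  obtain ⟨u, hu, hun, hue⟩ := exists_normalized_of_localEnergy_lt a hd (by positivity) hloc
  unfold molchanov at hmol
  simp only [iInf_lt_iff] at hmol
  obtain ⟨F, hF, hFs, hcap, hVF⟩ := hmol
  -- The factor `2` and the `+ 1` make the inequality strict, as needed to extract a potential.
  have hcap' : capacity z d F <
      ENNReal.ofReal (2 * capRatio n * (capConst n + 1) * (d ^ n / d ^ 2)) := by
    refine (hcap.trans (mul_le_mul_right (capacity_cube_le z hd) _)).trans_lt ?_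
    rw [← ENNReal.ofReal_mul hr.le, ENNReal.ofReal_lt_ofReal_iff (by positivity)]
    have : 0 < capRatio n * (d ^ n / d ^ 2) := by positivity
    nlinarith
  obtain ⟨p, ⟨K, hK⟩, hp0, hp1, hpF, hpg, hpm⟩ := exists_of_capacity_lt hn hd hcap'
  have hu1 : ContDiffOn ℝ 1 u (openCube z d) := hu.of_le (by simp)
  have heκ : poincareConst n * energyRatio n = 1 / (64 * 2 ^ n) := by
    unfold energyRatio; field_simp
  have h2n : (1 : ℝ) ≤ 2 ^ n := one_le_pow₀ (by norm_num)
  obtain ⟨⟨m, hm, hvm⟩, -⟩ := exists_mean a z hd hu1 hun he.le (by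
    rw [heκ, div_le_div_iff₀ (by positivity) (by norm_num)]; linarith) hue
  obtain ⟨L, hL⟩ := exists_lipschitzWith_trial hd hK hp0 hp1 hu1
  have hcs : HasCompactSupport (trial z d p u) :=
    (isCompact_cube z _).of_isClosed_subset (isClosed_tsupport _) (tsupport_trial_subset hd)
  have hform := h.of_lipschitz ha hV hL hcs
  have hup : quadForm a V univ (trial z d p u) ≤ ENNReal.ofReal (B * (d ^ n / d ^ 2)) := by
    refine (quadForm_trial_le hd hV hK hp0 hp1 hF hpF hu1).trans ?_
    calc _ ≤ ENNReal.ofReal 8 * ENNReal.ofReal (energyRatio n / d ^ 2 * d ^ n) +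
          ENNReal.ofReal (256 * n / d ^ 2 * d ^ n) + ENNReal.ofReal (4 * n) *
          ENNReal.ofReal (2 * capRatio n * (capConst n + 1) * (d ^ n / d ^ 2)) +
          ENNReal.ofReal (energyRatio n / d ^ 2 * d ^ n) := by gcongr
      _ = _ := by
          rw [← ENNReal.ofReal_mul (by positivity), ← ENNReal.ofReal_mul (by positivity),
            ← ENNReal.ofReal_add (by positivity) (by positivity),
            ← ENNReal.ofReal_add (by positivity) (by positivity),
            ← ENNReal.ofReal_add (by positivity) (by positivity)]
          congr 1
          rw [hB]
          field_simp
          ring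
  have hlow := le_lintegral_trial hd hK hp0 hp1 hu1 hm
  -- By the choice of `capRatio` and `energyRatio`, the mass of `P` and the oscillation of the
  -- modulus each use up a quarter of `(d / 2)ⁿ`. Half is left for the trial function.
  have hfin : ENNReal.ofReal (ε * (d / 2) ^ n) ≤
      ENNReal.ofReal (36 * (B * (d ^ n / d ^ 2)) + ε * (1 / 2 * (d / 2) ^ n)) := by
    calc ENNReal.ofReal (ε * (d / 2) ^ n)
        = ENNReal.ofReal ε * ENNReal.ofReal ((d / 2) ^ n) := ENNReal.ofReal_mul hε.le
      _ ≤ ENNReal.ofReal ε * (ENNReal.ofReal 36 * (∫⁻ x, ‖trial z d p u x‖ₑ ^ 2) +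
            ENNReal.ofReal 4 * (ENNReal.ofReal (hardyConst n * d ^ 2) *
              ENNReal.ofReal (2 * capRatio n * (capConst n + 1) * (d ^ n / d ^ 2))) +
            ENNReal.ofReal 16 * ENNReal.ofReal (poincareConst n * energyRatio n * d ^ n)) := by
          refine mul_le_mul_right (hlow.trans ?_) _
          gcongr
      _ = ENNReal.ofReal 36 * (ENNReal.ofReal ε * ∫⁻ x, ‖trial z d p u x‖ₑ ^ 2) +
            ENNReal.ofReal ε * (ENNReal.ofReal (4 * (hardyConst n * d ^ 2 *
              (2 * capRatio n * (capConst n + 1) * (d ^ n / d ^ 2))) +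
              16 * (poincareConst n * energyRatio n * d ^ n))) := by
          rw [← ENNReal.ofReal_mul (by positivity), ← ENNReal.ofReal_mul (by positivity),
            ← ENNReal.ofReal_mul (by positivity), add_assoc,
            ← ENNReal.ofReal_add (by positivity) (by positivity)]
          ring
      _ ≤ ENNReal.ofReal 36 * ENNReal.ofReal (B * (d ^ n / d ^ 2)) +
            ENNReal.ofReal ε * ENNReal.ofReal (1 / 2 * (d / 2) ^ n) := by
          gcongr
          · exact hform.trans hup
          · refine le_of_eq ?_
            rw [heκ, capRatio, div_pow]
            field_simp
            ring
      _ = _ := by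
          rw [← ENNReal.ofReal_mul (by positivity), ← ENNReal.ofReal_mul (by positivity),
            ← ENNReal.ofReal_add (by positivity) (by positivity)]
  rw [ENNReal.ofReal_le_ofReal_iff (by positivity)] at hfin
  have hd2 : 0 < d ^ 2 := by positivity
  rw [div_lt_iff₀ hε] at hdsq
  have e1 : (d / 2) ^ n = d ^ n / 2 ^ n := div_pow d 2 n
  -- Cleared of denominators this is `ε d² ≤ 72 · 2ⁿ B`, contrary to the choice of `d₂`.
  have e2 : ε * (1 / 2 * (d / 2) ^ n) ≤ 36 * (B * (d ^ n / d ^ 2)) := by linarith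
  rw [e1, ← mul_le_mul_iff_left₀ (by positivity : 0 < 2 * 2 ^ n * d ^ 2 / d ^ n)] at e2
  have e3 : ε * (1 / 2 * (d ^ n / 2 ^ n)) * (2 * 2 ^ n * d ^ 2 / d ^ n) = d ^ 2 * ε := by
    field_simp
  have e4 : 36 * (B * (d ^ n / d ^ 2)) * (2 * 2 ^ n * d ^ 2 / d ^ n) = 72 * 2 ^ n * B := by
    field_simp; ring
  rw [e3, e4] at e2
  linarith

end Necessity

end MagneticSchroedinger

/-! ### The cycle of implications -/

theorem theoremT (n : ℕ) (hn : 2 ≤ n) :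
    ∃ cn cn' : ℝ, 0 < cn ∧ cn < 1 ∧ 0 < cn' ∧
      ∀ (a : MagneticSchroedinger.E n → MagneticSchroedinger.E n)
        (V : MagneticSchroedinger.E n → ℝ),
        MagneticSchroedinger.L2loc a → LocallyIntegrable V volume → (∀ᵐ x, 0 ≤ V x) →
        List.TFAE [
          MagneticSchroedinger.StrictlyPositive a V,
          ∃ c d₁ d : ℝ, 0 < c ∧ c < 1 ∧ 0 < d₁ ∧ 0 < d ∧
            ∀ z, ENNReal.ofReal (1 / d₁ ^ 2) ≤ MagneticSchroedinger.criterion c a V z d,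
          ∃ d₁ d : ℝ, 0 < d₁ ∧ 0 < d ∧
            ∀ z, ENNReal.ofReal (1 / d₁ ^ 2) ≤ MagneticSchroedinger.criterion cn a V z d,
          ∃ c c' d₂ : ℝ, 0 < c ∧ c < 1 ∧ 0 < c' ∧ 0 < d₂ ∧
            ∀ d, d₂ < d → ∀ z,
              ENNReal.ofReal (c' / d ^ 2) ≤ MagneticSchroedinger.criterion c a V z d,
          ∃ d₂ : ℝ, 0 < d₂ ∧
            ∀ d, d₂ < d → ∀ z,
              ENNReal.ofReal (cn' / d ^ 2) ≤ MagneticSchroedinger.criterion cn a V z d] := by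
  open MagneticSchroedinger in
  refine ⟨capRatio n, energyRatio n, capRatio_pos n, capRatio_lt_one n, energyRatio_pos n,
    fun a V ha hV h0 => ?_⟩
  have hlarge : ∀ {c c' d₂ : ℝ}, 0 < c' → 0 < d₂ → (∀ d, d₂ < d → ∀ z,
      ENNReal.ofReal (c' / d ^ 2) ≤ MagneticSchroedinger.criterion c a V z d) →
      ∃ d₁ d : ℝ, 0 < d₁ ∧ 0 < d ∧
        ∀ z, ENNReal.ofReal (1 / d₁ ^ 2) ≤ MagneticSchroedinger.criterion c a V z d := by
    intro c c' d₂ hc' hd₂ h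
    -- A single admissible edge `d = d₂ + 1` is enough, and `d₁` is chosen so that `d₁⁻² = c' d⁻²`.
    refine ⟨(d₂ + 1) / √c', d₂ + 1, by positivity, by positivity, fun z => ?_⟩
    have := h (d₂ + 1) (by linarith) z
    rwa [div_pow, Real.sq_sqrt hc'.le, one_div_div]
  tfae_have 1 → 5 := fun h => by
    obtain ⟨ε, hε, hb⟩ := h.exists_formBound ha hV h0
    exact hb.exists_criterion hn hε ha hV
  tfae_have 5 → 3 := fun ⟨d₂, hd₂, h⟩ => hlarge (MagneticSchroedinger.energyRatio_pos n) hd₂ h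
  tfae_have 3 → 2 := fun ⟨d₁, d, hd₁, hd, h⟩ =>
    ⟨_, d₁, d, MagneticSchroedinger.capRatio_pos n, MagneticSchroedinger.capRatio_lt_one n, hd₁,
      hd, h⟩
  tfae_have 5 → 4 := fun ⟨d₂, hd₂, h⟩ =>
    ⟨_, _, d₂, MagneticSchroedinger.capRatio_pos n, MagneticSchroedinger.capRatio_lt_one n,
      MagneticSchroedinger.energyRatio_pos n, hd₂, h⟩
  tfae_have 4 → 2 := fun ⟨c, c', d₂, hc, hc1, hc', hd₂, h⟩ => by
    obtain ⟨d₁, d, hd₁, hd, h'⟩ := hlarge hc' hd₂ h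
    exact ⟨c, d₁, d, hc, hc1, hd₁, hd, h'⟩
  tfae_have 2 → 1 := fun ⟨c, d₁, d, hc, _, hd₁, hd, h⟩ => by
    obtain ⟨ε, hε, hloc⟩ := MagneticSchroedinger.exists_local_bound hn hc hd₁ hd
    exact (MagneticSchroedinger.formBound_of_local hd ha hV fun z u hu =>
      hloc a V z (h z) u hu).strictlyPositive ha hV h0 hε
  tfae_finish
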